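/- **Setting.** Let $q\ge 1$ and let $\mathcal T$ be a homogeneous tree of order $q$ (an acyclic connected undirected graph in which every node belongs to exactly $q+1$ edges). Rays are infinite paths $(t_0,t_1,\dots)$ with $t_k$ adjacent to $t_{k+1}$ and $t_k\ne t_{k+2}$; two rays are equivalent if $t_{m+k}=s_{n+k}$ for some $m,n$ and all $k\ge0$. Fix an equivalence class $\infty_{\mathcal T}$; every node starts exactly one ray of this class. For nodes $s,t$ with rays $(s_k),(t_k)\in\infty_{\mathcal T}$, let $m,n$ be minimal with $t_{m+k}=s_{n+k}$ for all $k$, and put $s\wedge t=t_m=s_n$. Write $s\preceq t$ if $\operatorname{dist}(s,s\wedge t)\le\operatorname{dist}(t,s\wedge t)$ and $s\asymp t$ in case of equality. Fix maps $\alpha_1,\dots,\alpha_q$ on $\mathcal T$, acting on the right, with $\{t\alpha_1,\dots,t\alpha_q\}=\{s: t\preceq s,\ \operatorname{dist}(t,s)=1\}$ for all $t$; they act on $\ell_2(\mathcal T)$ by $(\alpha_jf)(t)=f(t\alpha_j)$. A word $w=\alpha_{i_1}\cdots\alpha_{i_n}$ in the free semigroup $\mathcal F_q$ has length $|w|=n$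 (the empty word has length $0$) and acts by $(wf)(t)=f(tw)$. Let $\chi_t$ be the standard basis of $\ell_2(\mathcal T)$. A bounded operator $S$ on $\ell_2(\mathcal T)$ is *causal* if for every node $s$ and every $f$ with $f(t)=0$ for all $t\preceq s$ one has $(Sf)(t)=0$ for all $t\preceq s$. $\mathbf H(\mathcal T)$ is the algebra of causal operators, $\mathcal C=\{S: S,S^*\in\mathbf H(\mathcal T)\}$, $\mathbf H_2(\mathcal T)$ is the Hilbert space of causal Hilbert–Schmidt operators with $\langle F,G\rangle_2=\operatorname{trace}(G^*F)$, and $\mathcal C_2=\mathcal C\cap\mathbf H_2(\mathcal T)$. Every $S\in\mathbf H(\mathcal T)$ has a unique pointwise absolutely convergent expansion $S=\sum_{w\in\mathcal F_q}w^*S_{[w]}$ with $S_{[w]}\in\mathcal C$, namely $(S_{[w]}\chi_t)(s)=(S\chi_t)(sw)$ if $t\asymp s$, and $0$ otherwise. Let $\mathbb B(\mathcal T)$ be the set of rows $c=(c_1,\dots,c_q)\in\mathcal C^q$ with $\lim_n\|(c\alpha)^n\|^{1/n}<1$, where $c\alpha=\sum_jc_j\alpha_j$, and for $S\in\mathbf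 H(\mathcal T)$, $c\in\mathbb B(\mathcal T)$ put $$S^\wedge(c)=\sum_{n\ge0}(c\alpha)^n\sum_{|w|=n}w^*S_{[w]},\qquad K_S^d=(I-SS^\wedge(d)^*)(I-(d\alpha)^*)^{-1}.$$ A *Schur multiplier* is an $S\in\mathbf H(\mathcal T)$ with $\|S\|\le1$. For such $S$ let $M_SF=SF$ on $\mathbf H_2(\mathcal T)$, $\mathcal B_S=I-M_SM_S^*$, and let $\pi_S$ be the orthogonal projection of $\mathbf H_2(\mathcal T)$ onto $\ker\mathcal B_S$; $\mathbf H(S)$ is the Hilbert space $\sqrt{\mathcal B_S}\,\mathbf H_2(\mathcal T)$ with norm $\|\sqrt{\mathcal B_S}G\|_{\mathbf H(S)}=\|(I-\pi_S)G\|_2$. A Hilbert space $\mathbf H$ of elements of $\mathbf H_2(\mathcal T)$ is *right $\mathcal C$-invariant* if for all $F,G\in\mathbf H$, $c\in\mathcal C$: $Fc\in\mathbf H$, $\|Fc\|_{\mathbf H}\le\|F\|_{\mathbf H}\|c\|$ and $\langle Fc,G\rangle_{\mathbf H}=\langle F,Gc^*\rangle_{\mathbf H}$. **Theorem.** Let $\mathbf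 H$ be a right $\mathcal C$-invariant Hilbert space of elements of $\mathbf H_2(\mathcal T)$. Assume that for some $j$, $1\le j\le q$, there is a bounded linear operator $$V_j=\begin{pmatrix}A_j&B_j\\ C&D\end{pmatrix}:\mathbf H\oplus\mathcal C_2\to\mathbf H\oplus\mathcal C_2$$ such that for all $F\in\mathbf H$, $d\in\mathcal C_2$, $c\in\mathcal C$ $$A_j(Fc)=(A_jF)\alpha_j^*c\alpha_j,\quad B_j(dc)=(B_jd)\alpha_j^*c\alpha_j,\quad C(Fc)=(CF)c,\quad D(dc)=(Dd)c,$$ and such that $V_jV_j^*(F,e)=(F\alpha_j^*\alpha_j,\,e)$ for all $F\in\mathbf H$, $e\in\mathcal C_2$. Then: 1. There are unique coefficients $S_{[w]}\in\mathcal C$, $w\in\mathcal F_q$, such that for all $d\in\mathcal C_2$ $$S_{[\emptyset]}d=Dd,\qquad S_{[w]}d=w\,(CA_j^{n-1}B_jd)\,\alpha_j^{n*}\quad\text{if }|w|=n\ge1,$$ and the series $S=\sum_{w\in\mathcal F_q}w^*S_{[w]}$ defines, in the sense of pointwise absolute convergence, a Schur multiplier $S\in\mathbf H(\mathcal T)$.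 2. For every $c\in\mathbb B(\mathcal T)$ the series $E_cF=\sum_{n\ge0}(c\alpha)^n(CA_j^nF)\alpha_j^{n*}$, $F\in\mathbf H$, has terms in $\mathcal C_2$, converges absolutely in $\mathcal C_2$, and defines a bounded linear operator $E_c:\mathbf H\to\mathcal C_2$. Moreover $(K_S^d)^\wedge(c)\,k=E_cE_d^*k$ for all $c,d\in\mathbb B(\mathcal T)$, $k\in\mathcal C_2$. 3. If $A_jF=(F-F^\wedge(0))\alpha_j$ and $CF=F^\wedge(0)$ for all $F\in\mathbf H$, then $\mathbf H=\mathbf H(S)$ as Hilbert spaces (same elements and same norm). -/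

import Mathlib

open Filter Topology
open scoped ENNReal InnerProductSpace InnerProduct

noncomputable section

/-! ## Homogeneous trees, boundary points, the ordering and the primitive shifts -/

/-- An infinite path of a graph in which any two consecutive edges are distinct. -/
structure TreeRay {T : Type*} (G : SimpleGraph T) where
  node : ℕ → T
  adj : ∀ k, G.Adj (node k) (node (k + 1))
  nonbacktracking : ∀ k, node k ≠ node (k + 2)

/-- Two rays are equivalent if they coincide modulo a finite number of edges. -/
instance TreeRay.setoid {T : Type*} (G : SimpleGraph T) : Setoid (TreeRay G) where
  r p r := ∃ m n : ℕ, ∀ k, p.node (m + k) = r.node (n + k)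
  iseqv :=
    { refl := fun _ => ⟨0, 0, fun _ => rfl⟩
      symm := fun ⟨m, n, h⟩ => ⟨n, m, fun k => (h k).symm⟩
      trans := by
        rintro x y z ⟨m, n, h⟩ ⟨m', n', h'⟩
        refine ⟨m + m', n' + n, fun k => ?_⟩
        have h1 := h (m' + k)
        have h2 := h' (n + k)
        rw [add_assoc, h1, add_assoc, ← h2]
        congr 1
        omega }

/-- The boundary points of a tree: equivalence classes of rays. -/
def TreeBoundary {T : Type*} (G : SimpleGraph T) : Type _ := Quotient (TreeRay.setoid G)

/-- `IsMeet G ω s t u` says that `u = s ∧ t`: if `p`, `r` are the rays of the class `ω` which begin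
at `t`, `s`, and `m`, `n` are minimal with `p (m + k) = r (n + k)` for all `k`, then
`u = p m = r n`. -/
def IsMeet {T : Type*} (G : SimpleGraph T) (ω : TreeBoundary G) (s t u : T) : Prop :=
  ∃ (p r : TreeRay G) (m n : ℕ),
    (Quotient.mk (TreeRay.setoid G) p : TreeBoundary G) = ω ∧
    (Quotient.mk (TreeRay.setoid G) r : TreeBoundary G) = ω ∧
    p.node 0 = t ∧ r.node 0 = s ∧
    (∀ k, p.node (m + k) = r.node (n + k)) ∧
    (∀ m' n' : ℕ, (∀ k, p.node (m' + k) = r.node (n' + k)) → m ≤ m' ∧ n ≤ n') ∧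
    u = p.node m

/-- `s ⪯ t` if `dist (s, s ∧ t) ≤ dist (t, s ∧ t)`. -/
def TreePrec {T : Type*} (G : SimpleGraph T) (ω : TreeBoundary G) (s t : T) : Prop :=
  ∃ u, IsMeet G ω s t u ∧ G.dist s u ≤ G.dist t u

/-- `s ≍ t` if `dist (s, s ∧ t) = dist (t, s ∧ t)`; the classes are the horocycles. -/
def TreeHoro {T : Type*} (G : SimpleGraph T) (ω : TreeBoundary G) (s t : T) : Prop :=
  ∃ u, IsMeet G ω s t u ∧ G.dist s u = G.dist t u

/-- A homogeneous tree of order `q` (every node belongs to exactly `q + 1` edges) with a chosen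
boundary point and chosen primitive shifts `t ↦ t α_j`,
`{t α_1, …, t α_q} = {s : t ⪯ s, dist (t, s) = 1}`. -/
structure MultiscaleTree (q : ℕ) (T : Type*) where
  graph : SimpleGraph T
  isTree : graph.IsTree
  degree : ∀ t, (graph.neighborSet t).ncard = q + 1
  bdry : TreeBoundary graph
  shift : Fin q → T → T
  range_shift : ∀ t,
    Set.range (fun j => shift j t) = {s | TreePrec graph bdry t s ∧ graph.dist t s = 1}

/-- The Hilbert space `ℓ²(T)`. -/
abbrev TreeL2 (T : Type*) : Type _ := lp (fun _ : T => ℂ) 2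

/-- The algebra of bounded linear operators on `ℓ²(T)`. -/
abbrev TreeOp (T : Type*) : Type _ := TreeL2 T →L[ℂ] TreeL2 T

open scoped Classical in
/-- The standard basis vector `χ_t` of `ℓ²(T)`. -/
def treeBasis {T : Type*} (t : T) : TreeL2 T := lp.single 2 t (1 : ℂ)

theorem treeSynth_bound {T : Type*} (g : lp (fun _ : T => TreeL2 T) 2) (f : TreeL2 T) :
    Summable (fun t => ‖f t • g t‖) ∧ ∑' t, ‖f t • g t‖ ≤ ‖g‖ * ‖f‖ := by
  have hpq : (2 : ℝ≥0∞).toReal.HolderConjugate (2 : ℝ≥0∞).toReal := by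
    simpa using Real.HolderConjugate.two_two
  have h := lp.tsum_mul_le_mul_norm hpq (lp.toNorm f) (lp.toNorm g)
  simp only [lp.norm_toNorm, lp.toNorm_coe, norm_norm] at h
  refine ⟨?_, ?_⟩
  · simpa only [norm_smul] using h.1
  · simpa only [norm_smul, mul_comm ‖g‖] using h.2

theorem treeSynth_summable {T : Type*} (g : lp (fun _ : T => TreeL2 T) 2) (f : TreeL2 T) :
    Summable (fun t => f t • g t) := (treeSynth_bound g f).1.of_norm

/-- The operator `f ↦ ∑ₜ f(t) gₜ` of a square summable family `gₜ` of vectors (the operator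
whose columns are the `gₜ`). -/
def treeSynth (T : Type*) : lp (fun _ : T => TreeL2 T) 2 →L[ℂ] TreeOp T :=
  LinearMap.mkContinuous₂
    (LinearMap.mk₂ ℂ (fun g f => ∑' t, f t • g t)
      (fun g g' f => by
        rw [← (treeSynth_summable g f).tsum_add (treeSynth_summable g' f)]
        simp [smul_add])
      (fun a g f => by
        rw [← (treeSynth_summable g f).tsum_const_smul]
        simp [smul_comm a])
      (fun g f f' => by
        rw [← (treeSynth_summable g f).tsum_add (treeSynth_summable g f')]
        simp [add_smul])
      (fun a g f => by
        rw [← (treeSynth_summable g f).tsum_const_smul]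
        simp [mul_smul]))
    1
    (fun g f => by
      have h := treeSynth_bound g f
      rw [one_mul]
      exact (norm_tsum_le_tsum_norm h.1).trans h.2)

theorem treeSynth_apply {T : Type*} (g : lp (fun _ : T => TreeL2 T) 2) (f : TreeL2 T) :
    treeSynth T g f = ∑' t, f t • g t := rfl

theorem treeSynth_basis {T : Type*} (g : lp (fun _ : T => TreeL2 T) 2) (t : T) :
    treeSynth T g (treeBasis t) = g t := by
  classical
  rw [treeSynth_apply, tsum_eq_single t]
  · simp [treeBasis]
  · intro s hs
    simp [treeBasis, hs]

theorem treeOp_hasSum {T : Type*} (F : TreeOp T) (f : TreeL2 T) :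
    HasSum (fun t => f t • F (treeBasis t)) (F f) := by
  classical
  have h := (lp.hasSum_single (p := 2) (by simp) f).mapL F
  convert h using 2 with t
  rw [← map_smul, treeBasis, ← lp.single_smul]
  simp

namespace MultiscaleTree

variable {q : ℕ} {T : Type*} (M : MultiscaleTree q T)

theorem shift_fibre (j : Fin q) (s : Finset T) (f : TreeL2 T) :
    ∑ t ∈ s, ‖f (M.shift j t)‖ ^ 2 ≤ ((q : ℝ) + 1) * ‖f‖ ^ 2 := by
  classical
  have hadj : ∀ t, M.graph.Adj (M.shift j t) t := by
    intro t
    have h : M.shift j t ∈ Set.range (fun j => M.shift j t) := ⟨j, rfl⟩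
    rw [M.range_shift t] at h
    exact (SimpleGraph.dist_eq_one_iff_adj.mp h.2).symm
  rw [Finset.sum_comp (fun u => ‖f u‖ ^ 2) (M.shift j)]
  calc ∑ u ∈ s.image (M.shift j), (s.filter (fun t => M.shift j t = u)).card • ‖f u‖ ^ 2
      ≤ ∑ u ∈ s.image (M.shift j), ((q : ℝ) + 1) * ‖f u‖ ^ 2 := by
        refine Finset.sum_le_sum fun u _ => ?_
        rw [nsmul_eq_mul]
        refine mul_le_mul_of_nonneg_right ?_ (by positivity)
        have hfin : (M.graph.neighborSet u).Finite :=
          Set.finite_of_ncard_ne_zero (by rw [M.degree u]; omega)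
        have hsub : ((s.filter (fun t => M.shift j t = u) : Finset T) : Set T) ⊆
            M.graph.neighborSet u := by
          intro t ht
          have ht' := (Finset.mem_filter.mp ht).2
          have := hadj t
          rw [ht'] at this
          exact this
        have h := Set.ncard_le_ncard hsub hfin
        rw [M.degree u, Set.ncard_coe_finset] at h
        exact_mod_cast h
    _ = ((q : ℝ) + 1) * ∑ u ∈ s.image (M.shift j), ‖f u‖ ^ 2 := by rw [Finset.mul_sum]
    _ ≤ ((q : ℝ) + 1) * ‖f‖ ^ 2 := by
        refine mul_le_mul_of_nonneg_left ?_ (by positivity)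
        have h := lp.sum_rpow_le_norm_rpow (p := 2) (by simp) f (s.image (M.shift j))
        simpa using h

/-- The primitive shift as an operator on `ℓ²(T)`: `(α_j f)(t) = f(t α_j)`. -/
def α (j : Fin q) : TreeOp T :=
  LinearMap.mkContinuous
    { toFun := fun f => ⟨fun t => f (M.shift j t), memℓp_gen' (C := ((q : ℝ) + 1) * ‖f‖ ^ 2)
        (fun s => by simpa using M.shift_fibre j s f)⟩
      map_add' := fun _ _ => rfl
      map_smul' := fun _ _ => rfl }
    (Real.sqrt ((q : ℝ) + 1))
    (fun f => by
      refine lp.norm_le_of_forall_sum_le (by simp) (by positivity) fun s => ?_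
      have h := M.shift_fibre j s f
      simp only [ENNReal.toReal_ofNat, Real.rpow_ofNat, mul_pow]
      rw [Real.sq_sqrt (by positivity)]
      exact h)

theorem α_apply (j : Fin q) (f : TreeL2 T) (t : T) : M.α j f t = f (M.shift j t) := rfl

/-! ## Words, causal operators, constants -/

/-- The action `t ↦ t w` of a word `w = α_{i₁} … α_{iₙ}` (the list `[i₁, …, iₙ]`) on the tree. -/
def node (t : T) (w : List (Fin q)) : T := w.foldl (fun s j => M.shift j s) t

/-- The operator `w = α_{i₁} … α_{iₙ}` on `ℓ²(T)`. -/
def word (w : List (Fin q)) : TreeOp T := (w.map M.α).prod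

/-- `s ⪯ t` -/
def Prec (s t : T) : Prop := TreePrec M.graph M.bdry s t

/-- `s ≍ t` -/
def Horo (s t : T) : Prop := TreeHoro M.graph M.bdry s t

/-- Causality of a bounded operator. -/
def IsCausal (S : TreeOp T) : Prop :=
  ∀ (s : T) (f : TreeL2 T), (∀ t, M.Prec t s → f t = 0) → ∀ t, M.Prec t s → S f t = 0

/-- The algebra `𝒞` of constants: `S` and `S*` are causal. -/
def IsConst (c : TreeOp T) : Prop := M.IsCausal c ∧ M.IsCausal (c†)

open scoped Classical in
/-- The coefficient `S_[w]`, the operator with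
`(S_[w] χ_t)(s) = (S χ_t)(s w)` if `t ≍ s`, and `0` otherwise. (For bounded `S` such an operator
exists, and it is unique because the `χ_t` span a dense subspace.) -/
def coeff (S : TreeOp T) (w : List (Fin q)) : TreeOp T :=
  if h : ∃ A : TreeOp T, ∀ t s,
      A (treeBasis t) s = if M.Horo t s then S (treeBasis t) (M.node s w) else 0
  then h.choose else 0

/-- `S = ∑_w w* σ_w` in the sense of pointwise absolute convergence. -/
def HasExpansion (S : TreeOp T) (σ : List (Fin q) → TreeOp T) : Prop :=
  ∀ (f : TreeL2 T) (t : T),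
    Summable (fun w : List (Fin q) => ‖((M.word w)†) (σ w f) t‖) ∧
    HasSum (fun w : List (Fin q) => ((M.word w)†) (σ w f) t) (S f t)

/-- A Schur multiplier: a causal contraction. -/
def IsSchur (S : TreeOp T) : Prop := M.IsCausal S ∧ ‖S‖ ≤ 1

/-! ## The point evaluation -/

/-- The operator `c α = ∑ⱼ c_j α_j` for a row `c = (c_1, …, c_q)`. -/
def rowα (c : Fin q → TreeOp T) : TreeOp T := ∑ j, c j * M.α j

/-- The ball `𝔹(T)`: rows of constants with `lim ‖(c α)ⁿ‖^{1/n} < 1`. -/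
def ball : Set (Fin q → TreeOp T) :=
  {c | (∀ j, M.IsConst (c j)) ∧
    ∃ r : ℝ, r < 1 ∧ Tendsto (fun n : ℕ => ‖M.rowα c ^ n‖ ^ (1 / (n : ℝ))) atTop (𝓝 r)}

/-- `S^∧(c) = ∑ₙ (c α)ⁿ (∑_{|w| = n} w* S_[w])`. -/
def eval (S : TreeOp T) (c : Fin q → TreeOp T) : TreeOp T :=
  ∑' n : ℕ, M.rowα c ^ n *
    ∑ w : Fin n → Fin q, ((M.word (List.ofFn w))†) * M.coeff S (List.ofFn w)

/-- `K_∧^c = (I - α* c*)⁻¹`. -/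
def kernel (c : Fin q → TreeOp T) : TreeOp T := Ring.inverse (1 - (M.rowα c)†)

/-- `K_S^d = (I - S S^∧(d)*) K_∧^d`. -/
def schurKernel (S : TreeOp T) (d : Fin q → TreeOp T) : TreeOp T :=
  (1 - S * (M.eval S d)†) * M.kernel d

/-! ## Causal Hilbert-Schmidt operators -/

theorem IsCausal.add {M : MultiscaleTree q T} {S R : TreeOp T} (hS : M.IsCausal S)
    (hR : M.IsCausal R) : M.IsCausal (S + R) := fun s f hf t ht => by
  simp [hS s f hf t ht, hR s f hf t ht]

theorem IsCausal.smul {M : MultiscaleTree q T} {S : TreeOp T} (hS : M.IsCausal S) (a : ℂ) :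
    M.IsCausal (a • S) := fun s f hf t ht => by
  simp [hS s f hf t ht]

theorem IsCausal.mul {M : MultiscaleTree q T} {S R : TreeOp T} (hS : M.IsCausal S)
    (hR : M.IsCausal R) : M.IsCausal (S * R) := fun s f hf t ht =>
  hS s (R f) (hR s f hf) t ht

theorem isCausal_zero : M.IsCausal 0 := fun _ _ _ _ _ => rfl

theorem continuous_apply_apply (f : TreeL2 T) (t : T) :
    Continuous (fun S : TreeOp T => S f t) := by
  have h1 : Continuous (fun S : TreeOp T => S f) :=
    (ContinuousLinearMap.apply ℂ (TreeL2 T) f).continuous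
  exact (lp.lipschitzWith_one_eval (E := fun _ : T => ℂ) 2 t).continuous.comp h1

theorem isClosed_causal : IsClosed {S : TreeOp T | M.IsCausal S} := by
  have : {S : TreeOp T | M.IsCausal S} =
      ⋂ (s : T) (f : TreeL2 T) (_ : ∀ t, M.Prec t s → f t = 0) (t : T) (_ : M.Prec t s),
        {S : TreeOp T | S f t = 0} := by
    ext S
    simp [IsCausal]
  rw [this]
  refine isClosed_iInter fun s => isClosed_iInter fun f => isClosed_iInter fun _ =>
    isClosed_iInter fun t => isClosed_iInter fun _ => ?_
  exact isClosed_eq (continuous_apply_apply f t) continuous_const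

/-- The columns `(F χ_t)ₜ` of the causal Hilbert-Schmidt operators `F`. -/
def causalColumns : Submodule ℂ (lp (fun _ : T => TreeL2 T) 2) where
  carrier := {g | M.IsCausal (treeSynth T g)}
  add_mem' := fun {a b} ha hb => by
    change M.IsCausal (treeSynth T (a + b))
    rw [map_add]
    exact IsCausal.add ha hb
  zero_mem' := by
    change M.IsCausal (treeSynth T 0)
    rw [map_zero]
    exact M.isCausal_zero
  smul_mem' := fun a g hg => by
    change M.IsCausal (treeSynth T (a • g))
    rw [map_smul]
    exact IsCausal.smul hg a

/-- The Hilbert space `𝐇₂(T)` of causal Hilbert-Schmidt operators `F`. An operator with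
`tr (F* F) = ∑ₜ ‖F χ_t‖² < ∞` is recorded by the square summable family of its columns `(F χ_t)ₜ`,
so that the inner product is `tr (F* G) = ∑ₜ ⟪F χ_t, G χ_t⟫`; see `H2.op`, `H2.op_injective`,
`H2.range_op`, `H2.inner_eq_tsum` and `H2.norm_sq_eq_tsum`. -/
def H2 : Type _ := ↥M.causalColumns

instance : NormedAddCommGroup M.H2 := inferInstanceAs (NormedAddCommGroup ↥M.causalColumns)

instance : InnerProductSpace ℂ M.H2 := inferInstanceAs (InnerProductSpace ℂ ↥M.causalColumns)

instance : CompleteSpace M.H2 := by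
  have h : IsClosed (M.causalColumns : Set (lp (fun _ : T => TreeL2 T) 2)) :=
    M.isClosed_causal.preimage (treeSynth T).continuous
  exact h.completeSpace_coe

namespace H2

variable {M}

/-- The columns of an element of `𝐇₂(T)`. -/
def columns : M.H2 →ₗᵢ[ℂ] lp (fun _ : T => TreeL2 T) 2 := M.causalColumns.subtypeₗᵢ

/-- The bounded operator on `ℓ²(T)` given by an element of `𝐇₂(T)`. -/
def op : M.H2 →L[ℂ] TreeOp T := treeSynth T ∘L columns.toContinuousLinearMap

theorem op_basis (F : M.H2) (t : T) :
    op F (treeBasis t) = columns F t := treeSynth_basis _ t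

theorem op_causal (F : M.H2) : M.IsCausal (op F) := F.2

theorem op_injective : Function.Injective (op (M := M)) := fun F G h => by
  refine columns.injective ?_
  ext1
  funext t
  rw [← op_basis, ← op_basis, h]

theorem range_op : Set.range (op (M := M)) =
    {S | M.IsCausal S ∧ Summable (fun t => ‖S (treeBasis t)‖ ^ 2)} := by
  ext S
  constructor
  · rintro ⟨F, rfl⟩
    refine ⟨op_causal F, ?_⟩
    have h := (memℓp_gen_iff (p := 2) (by simp)).mp (lp.memℓp (columns F))
    simpa [op_basis] using h
  · rintro ⟨hS, h⟩
    have hmem : Memℓp (fun t => S (treeBasis t)) 2 := memℓp_gen (by simpa using h)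
    have hsy : treeSynth T ⟨fun t => S (treeBasis t), hmem⟩ = S := by
      ext1 f
      rw [treeSynth_apply]
      exact (treeOp_hasSum S f).tsum_eq
    refine ⟨⟨⟨fun t => S (treeBasis t), hmem⟩, ?_⟩, hsy⟩
    change M.IsCausal (treeSynth T _)
    rw [hsy]
    exact hS

theorem inner_eq_tsum (F G : M.H2) :
    ⟪F, G⟫_ℂ = ∑' t, ⟪op F (treeBasis t), op G (treeBasis t)⟫_ℂ := by
  simp only [op_basis]
  exact lp.inner_eq_tsum (columns F) (columns G)

theorem norm_sq_eq_tsum (F : M.H2) : ‖F‖ ^ 2 = ∑' t, ‖op F (treeBasis t)‖ ^ 2 := by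
  have h := lp.norm_rpow_eq_tsum (p := 2) (by simp) (columns F)
  rw [columns.norm_map] at h
  simpa [op_basis] using h

theorem mul_mem (S : TreeOp T) (hS : M.IsCausal S) (F : M.H2) : ∃ G : M.H2, op G = S * op F := by
  have h : S * op F ∈ Set.range (op (M := M)) := by
    rw [range_op]
    refine ⟨hS.mul (op_causal F), ?_⟩
    have hF : op F ∈ Set.range (op (M := M)) := ⟨F, rfl⟩
    rw [range_op] at hF
    refine Summable.of_nonneg_of_le (fun t => by positivity) (fun t => ?_)
      (hF.2.mul_left (‖S‖ ^ 2))
    rw [← mul_pow]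
    exact pow_le_pow_left₀ (norm_nonneg _) (S.le_opNorm _) 2
  exact h

/-- Left multiplication `M_S F = S F` by a causal operator. -/
def mulLeft (S : TreeOp T) (hS : M.IsCausal S) : M.H2 →L[ℂ] M.H2 :=
  LinearMap.mkContinuous
    { toFun := fun F => (mul_mem S hS F).choose
      map_add' := fun F G => op_injective (by
        rw [map_add op (mul_mem S hS F).choose, (mul_mem S hS (F + G)).choose_spec, (mul_mem S hS F).choose_spec,
          (mul_mem S hS G).choose_spec, map_add, mul_add])
      map_smul' := fun a F => op_injective (by
        rw [RingHom.id_apply, map_smul op a (mul_mem S hS F).choose,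
          (mul_mem S hS (a • F)).choose_spec, (mul_mem S hS F).choose_spec, map_smul,
          mul_smul_comm]) }
    ‖S‖
    (fun F => by
      have hop : op (mul_mem S hS F).choose = S * op F := (mul_mem S hS F).choose_spec
      change ‖(mul_mem S hS F).choose‖ ≤ ‖S‖ * ‖F‖
      refine abs_le_of_sq_le_sq' ?_ (by positivity) |>.2
      have hs : ∀ G : M.H2, Summable (fun t => ‖op G (treeBasis t)‖ ^ 2) := fun G => by
        have hG : op G ∈ Set.range (op (M := M)) := ⟨G, rfl⟩
        rw [range_op] at hG
        exact hG.2
      rw [mul_pow, norm_sq_eq_tsum, norm_sq_eq_tsum, ← tsum_mul_left]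
      refine (hs _).tsum_le_tsum (fun t => ?_) ((hs F).mul_left _)
      rw [hop, ← mul_pow]
      exact pow_le_pow_left₀ (norm_nonneg _) (S.le_opNorm _) 2)

theorem op_mulLeft (S : TreeOp T) (hS : M.IsCausal S) (F : M.H2) :
    op (mulLeft S hS F) = S * op F := (mul_mem S hS F).choose_spec

end H2

/-- `𝒞₂ = 𝒞 ∩ 𝐇₂(T)` as a linear subspace of `𝐇₂(T)`. -/
def constHS : Submodule ℂ M.H2 where
  carrier := {k | M.IsConst (H2.op k)}
  add_mem' := fun {a b} ha hb => by
    change M.IsConst (H2.op (a + b))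
    refine ⟨by rw [map_add]; exact IsCausal.add ha.1 hb.1, ?_⟩
    rw [map_add, map_add]
    exact IsCausal.add ha.2 hb.2
  zero_mem' := by
    change M.IsConst (H2.op 0)
    refine ⟨by rw [map_zero]; exact M.isCausal_zero, ?_⟩
    rw [map_zero, map_zero]
    exact M.isCausal_zero
  smul_mem' := fun a F hF => by
    change M.IsConst (H2.op (a • F))
    refine ⟨by rw [map_smul]; exact IsCausal.smul hF.1 a, ?_⟩
    rw [map_smul, map_smulₛₗ]
    exact IsCausal.smul hF.2 _

/-- The Hilbert space `𝒞₂ = 𝒞 ∩ 𝐇₂(T)`, with the Hilbert-Schmidt norm. -/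
def C2 : Type _ := ↥M.constHS

instance : NormedAddCommGroup M.C2 := inferInstanceAs (NormedAddCommGroup ↥M.constHS)

instance : InnerProductSpace ℂ M.C2 := inferInstanceAs (InnerProductSpace ℂ ↥M.constHS)

instance : CompleteSpace M.C2 := by
  have hcl : IsClosed (M.constHS : Set M.H2) := by
    refine (M.isClosed_causal.preimage H2.op.continuous).inter
      (M.isClosed_causal.preimage (f := fun F : M.H2 => (H2.op F)†) ?_)
    exact ContinuousLinearMap.adjoint.continuous.comp H2.op.continuous
  exact hcl.completeSpace_coe

/-- The inclusion of `𝒞₂` into `𝐇₂(T)`. -/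
def C2.incl : M.C2 →ₗᵢ[ℂ] M.H2 := M.constHS.subtypeₗᵢ

theorem C2.range_incl : Set.range (C2.incl M) = {k | M.IsConst (H2.op k)} :=
  Subtype.range_coe

/-- The bounded operator on `ℓ²(T)` given by an element of `𝐇₂(T)`. -/
abbrev opH (F : M.H2) : TreeOp T := H2.op F

/-- The bounded operator on `ℓ²(T)` given by an element of `𝒞₂`. -/
abbrev opC (k : M.C2) : TreeOp T := H2.op (C2.incl M k)

/-! ## de Branges-Rovnyak spaces and right `𝒞`-invariant spaces -/

/-- `𝓑_S = I - M_S M_S*`. -/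
def defect (S : TreeOp T) (hS : M.IsCausal S) : M.H2 →L[ℂ] M.H2 :=
  1 - H2.mulLeft S hS * (H2.mulLeft S hS)†

/-- The positive square root `√𝓑_S`. -/
def defectSqrt (S : TreeOp T) (hS : M.IsCausal S) : M.H2 →L[ℂ] M.H2 :=
  CFC.sqrt (M.defect S hS)

/-- The orthogonal projection `π_S` of `𝐇₂(T)` onto `ker 𝓑_S`. -/
def defectProj (S : TreeOp T) (hS : M.IsCausal S) : M.H2 →L[ℂ] M.H2 :=
  (M.defect S hS).ker.starProjection

/-- A Hilbert space `H` of elements of `𝐇₂(T)` (a Hilbert space with a linear injection `ι` into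
`𝐇₂(T)`) is the de Branges-Rovnyak space `𝐇(S)`: its elements are those of `√𝓑_S 𝐇₂(T)`, and
`‖√𝓑_S G‖ = ‖(I - π_S) G‖₂`. -/
def IsDeBrangesRovnyak {H : Type*} [NormedAddCommGroup H] [InnerProductSpace ℂ H]
    (ι : H →ₗ[ℂ] M.H2) (S : TreeOp T) (hS : M.IsCausal S) : Prop :=
  Set.range ι = Set.range (M.defectSqrt S hS) ∧
  ∀ (F : H) (G : M.H2), ι F = M.defectSqrt S hS G → ‖F‖ = ‖G - M.defectProj S hS G‖

/-- Right `𝒞`-invariance of a Hilbert space `H` of elements of `𝐇₂(T)`. -/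
structure IsRightInvariant {H : Type*} [NormedAddCommGroup H] [InnerProductSpace ℂ H]
    (ι : H →ₗ[ℂ] M.H2) : Prop where
  exists_mul : ∀ (F : H) (c : TreeOp T), M.IsConst c →
    ∃ Fc : H, M.opH (ι Fc) = M.opH (ι F) * c
  norm_le : ∀ (F Fc : H) (c : TreeOp T), M.IsConst c →
    M.opH (ι Fc) = M.opH (ι F) * c → ‖Fc‖ ≤ ‖F‖ * ‖c‖
  inner_eq : ∀ (F G Fc Gc : H) (c : TreeOp T), M.IsConst c →
    M.opH (ι Fc) = M.opH (ι F) * c → M.opH (ι Gc) = M.opH (ι G) * c† → ⟪Fc, G⟫_ℂ = ⟪F, Gc⟫_ℂ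

end MultiscaleTree

/-- The operator matrix `(A B; C D)` on the Hilbert space direct sum `H ⊕ K`. -/
def blockOp {H K : Type*} [NormedAddCommGroup H] [InnerProductSpace ℂ H]
    [NormedAddCommGroup K] [InnerProductSpace ℂ K]
    (A : H →L[ℂ] H) (B : K →L[ℂ] H) (C : H →L[ℂ] K) (D : K →L[ℂ] K) :
    WithLp 2 (H × K) →L[ℂ] WithLp 2 (H × K) :=
  (WithLp.prodContinuousLinearEquiv 2 ℂ H K).symm.toContinuousLinearMap ∘L
    ((A.coprod B).prod (C.coprod D)) ∘L
      (WithLp.prodContinuousLinearEquiv 2 ℂ H K).toContinuousLinearMap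

end

/-! ## Rays and levels of a tree -/

section TreeCombinatorics

variable {T : Type*} {G : SimpleGraph T}

/-! The boundary point gives a Busemann function, and its negative is an integer level with `s ⪯ t`
iff level s ≤ level t. Operators on ℓ²(T) are thereby graded by how much they raise the level:
causal means no part of negative degree, constants are the operators of degree 0, and α_j has degree
-1. Every node is s w for exactly one pair (s, w) with |w| = n, so ∑ w* w = 1 over the words of
length n. Hence ∑ w* S_[w] over these words is the part Sₙ of degree n, and S^∧(c) = ∑ Xⁿ Sₙ with X
= c α. What remains is system theory in one variable. Below, α = α_j and V = V_j.

Since V V* is right multiplication by α* α on H and the identity on 𝒞₂, V is a contraction. The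
transfer operator is prescribed by Sₙ d = (Markov parameter n applied to d) αⁿ*. To bound it, split
a finitely supported vector by level and feed the pieces, as rank one elements of 𝒞₂, into the
system x ↦ A x + B u, y = C x + D u. The columns of the outputs are the level pieces of the image,
and the energy balance of V gives ‖S‖ ≤ 1 (`entries_bound`, `exists_transfer`).

Parts 2 and 3 both multiply V on the left by a row (U W) for which U does not feel right
multiplication by α* α; then (U W) V V* (U' W')* = U U'* + W W'* (`row_identity`). For part 2 take U
F = X (E_c F) α* and W = 1. Then (U W) V = (E_c, multiplication by S^∧(c)), so E_c E_d* satisfies a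
Stein equation Z - X Z Y* = 1 - S^∧(c) S^∧(d)* with Y = d α. The evaluated kernel satisfies the same
equation, and its solution is unique because Xⁿ and Yⁿ tend to 0 (`evalAt_kernel_transfer`). For
part 3 let ρ be right multiplication by α* on 𝐇₂(T), κ the inclusion of 𝒞₂, J that of H and L = M_S.
Then A and C are restrictions of ρ* and κ*, and (ρ J, κ) V = (J, L κ). With ρ ρ* + κ κ* = 1 and ρ L
= L ρ this makes Δ = J J* - (1 - L L*) a solution of Δ = ρ Δ ρ*, so Δ = 0
(`eq_zero_of_shiftH_conj`). Douglas' lemma turns J J* = 𝓑_S into equality of spaces and norms. -/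

theorem SimpleGraph.IsTree.eq_of_adj_of_dist_add_one (hG : G.IsTree) {t u u' v : T}
    (hu : G.Adj t u) (hu' : G.Adj t u') (h : G.dist u v + 1 = G.dist t v)
    (h' : G.dist u' v + 1 = G.dist t v) : u = u' := by
  obtain ⟨p, -, hp⟩ := hG.1.exists_path_of_dist u v
  obtain ⟨p', -, hp'⟩ := hG.1.exists_path_of_dist u' v
  have h1 : (SimpleGraph.Walk.cons hu p).IsPath :=
    SimpleGraph.Walk.isPath_of_length_eq_dist _ (by simp [hp, h])
  have h2 : (SimpleGraph.Walk.cons hu' p').IsPath :=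
    SimpleGraph.Walk.isPath_of_length_eq_dist _ (by simp [hp', h'])
  have h3 := (hG.existsUnique_path t v).unique h1 h2
  have h4 := congrArg (fun w : G.Walk t v => w.getVert 1) h3
  simpa using h4

theorem SimpleGraph.IsTree.dist_adj_cases (hG : G.IsTree) (v : T) {t u : T} (hu : G.Adj t u) :
    G.dist u v + 1 = G.dist t v ∨ G.dist t v + 1 = G.dist u v := by
  have h := hG.dist_eq_dist_add_one_of_adj v hu
  rw [G.dist_comm (u := v), G.dist_comm (u := v)] at h
  omega

/-- Along an edge the distance to the origin changes by exactly 1. If it dropped, the nodes before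
and after the edge's starting point would both be its unique neighbour nearer to the origin, which
is backtracking. -/
theorem TreeRay.dist_node (hG : G.IsTree) (p : TreeRay G) (k : ℕ) :
    G.dist (p.node k) (p.node 0) = k := by
  induction k using Nat.strong_induction_on with
  | _ k ih =>
    match k with
    | 0 => simp
    | 1 => exact SimpleGraph.dist_eq_one_iff_adj.mpr (p.adj 0).symm
    | k + 2 =>
      have h1 := ih (k + 1) (by omega)
      have h0 := ih k (by omega)
      rcases hG.dist_adj_cases (p.node 0) (p.adj (k + 1)) with h | h
      · exact absurd (hG.eq_of_adj_of_dist_add_one (p.adj k).symm (p.adj (k + 1))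
          (by omega) h) (p.nonbacktracking k)
      · change G.dist (p.node (k + 1 + 1)) _ = _
        omega

theorem TreeRay.exists_busemann (hG : G.IsTree) (p : TreeRay G) (t : T) :
    ∃ b : ℤ, ∀ᶠ k : ℕ in atTop, (k : ℤ) - G.dist t (p.node k) = b := by
  have hle : ∀ k, k ≤ G.dist t (p.node k) + G.dist t (p.node 0) := fun k => by
    have h := hG.1.dist_triangle (u := p.node k) (v := t) (w := p.node 0)
    rw [p.dist_node hG k, G.dist_comm (u := p.node k)] at h
    exact h
  -- The added constant keeps the subtraction in ℕ from truncating. The sequence cannot increase,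
  -- because the distance changes by 1 along each edge, so it is constant from its first minimum on.
  let a : ℕ → ℕ := fun k => G.dist t (p.node k) + G.dist t (p.node 0) - k
  have ha : Antitone a := antitone_nat_of_succ_le fun k => by
    have h := hG.dist_eq_dist_add_one_of_adj t (p.adj k)
    have := hle k
    have := hle (k + 1)
    simp only [a]
    omega
  obtain ⟨k₀, hk₀⟩ : ∃ k₀, ∀ k, a k₀ ≤ a k := by
    obtain ⟨x, ⟨k₀, rfl⟩, hx⟩ := wellFounded_lt.has_min (Set.range a) ⟨_, 0, rfl⟩
    exact ⟨k₀, fun k => not_lt.mp (hx _ ⟨k, rfl⟩)⟩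
  refine ⟨(k₀ : ℤ) - G.dist t (p.node k₀), eventually_atTop.mpr ⟨k₀, fun k hk => ?_⟩⟩
  have h1 := hk₀ k
  have h2 := ha hk
  have := hle k
  have := hle k₀
  simp only [a] at h1 h2
  omega

/-- The Busemann function of a ray of a tree, growing towards the end of the ray. -/
noncomputable def TreeRay.busemann (hG : G.IsTree) (p : TreeRay G) (t : T) : ℤ :=
  (p.exists_busemann hG t).choose

namespace TreeRay

variable (hG : G.IsTree) (p : TreeRay G)

theorem busemann_spec (t : T) :
    ∀ᶠ k : ℕ in atTop, (k : ℤ) - G.dist t (p.node k) = p.busemann hG t :=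
  (p.exists_busemann hG t).choose_spec

theorem busemann_adj {t u : T} (h : G.Adj t u) :
    p.busemann hG u = p.busemann hG t + 1 ∨ p.busemann hG u = p.busemann hG t - 1 := by
  obtain ⟨k, h1, h2⟩ := ((p.busemann_spec hG t).and (p.busemann_spec hG u)).exists
  rcases hG.dist_adj_cases (p.node k) h with h' | h' <;> omega

theorem existsUnique_parent (t : T) :
    ∃! u, G.Adj t u ∧ p.busemann hG u = p.busemann hG t + 1 := by
  refine existsUnique_of_exists_of_unique ?_ ?_
  · -- the first step towards a far point of the ray does not depend on that point
    obtain ⟨k, hk⟩ := ((p.busemann_spec hG t).and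
      (eventually_ge_atTop (G.dist t (p.node 0) + 1))).exists_forall_of_atTop
    have h1 := fun l hl => (hk l hl).1
    have h2 := fun l hl => (hk l hl).2
    have hne : ∀ l, k ≤ l → t ≠ p.node l := fun l hl h => by
      have h3 := p.dist_node hG l
      have := h2 l hl
      rw [← h] at h3
      omega
    have hstep : ∀ l, k ≤ l → ∃ u, G.Adj t u ∧ G.dist u (p.node l) + 1 = G.dist t (p.node l) := by
      intro l hl
      obtain ⟨w, -, hw⟩ := hG.1.exists_path_of_dist t (p.node l)
      cases w with
      | nil => exact absurd rfl (hne l hl)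
      | cons hadj w =>
        refine ⟨_, hadj, ?_⟩
        have h3 := SimpleGraph.dist_le w
        rw [SimpleGraph.Walk.length_cons] at hw
        rcases hG.dist_adj_cases (p.node l) hadj with h | h <;> omega
    obtain ⟨u, hu, hu'⟩ := hstep k le_rfl
    have hall : ∀ l, k ≤ l → G.dist u (p.node l) + 1 = G.dist t (p.node l) := by
      intro l hl
      induction l, hl using Nat.le_induction with
      | base => exact hu'
      | succ l hl ih =>
        rcases hG.dist_adj_cases (p.node (l + 1)) hu with h | h
        · exact h
        · have h3 := h1 l hl
          have h4 := h1 (l + 1) (by omega)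
          have h5 := hG.dist_eq_dist_add_one_of_adj u (p.adj l)
          push_cast at h4
          omega
    refine ⟨u, hu, ?_⟩
    obtain ⟨l, h3, h4⟩ := ((p.busemann_spec hG u).and (eventually_ge_atTop k)).exists
    have h5 := hall l h4
    have h6 := h1 l h4
    omega
  · rintro u u' ⟨hu, hb⟩ ⟨hu', hb'⟩
    obtain ⟨k, h1, h2, h3⟩ := ((p.busemann_spec hG t).and
      ((p.busemann_spec hG u).and (p.busemann_spec hG u'))).exists
    exact hG.eq_of_adj_of_dist_add_one (v := p.node k) hu hu' (by omega) (by omega)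

/-- The neighbour of a node of a tree in the direction of the end of the ray `p`. -/
noncomputable def parent (t : T) : T := (p.existsUnique_parent hG t).choose

theorem adj_parent (t : T) : G.Adj t (p.parent hG t) :=
  (p.existsUnique_parent hG t).choose_spec.1.1

theorem busemann_parent (t : T) : p.busemann hG (p.parent hG t) = p.busemann hG t + 1 :=
  (p.existsUnique_parent hG t).choose_spec.1.2

theorem eq_parent {t u : T} (h : G.Adj t u) (hb : p.busemann hG u = p.busemann hG t + 1) :
    u = p.parent hG t :=
  (p.existsUnique_parent hG t).choose_spec.2 u ⟨h, hb⟩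

theorem eq_parent_or {t u : T} (h : G.Adj t u) : u = p.parent hG t ∨ t = p.parent hG u := by
  rcases p.busemann_adj hG h with hb | hb
  · exact Or.inl (p.eq_parent hG h hb)
  · exact Or.inr (p.eq_parent hG h.symm (by omega))

theorem busemann_node (k : ℕ) : p.busemann hG (p.node k) = k := by
  have hd : ∀ l, k ≤ l → G.dist (p.node k) (p.node l) + k = l := by
    intro l hl
    have h := TreeRay.dist_node hG
      (⟨fun i => p.node (k + i), fun i => p.adj (k + i), fun i => p.nonbacktracking (k + i)⟩ :
        TreeRay G) (l - k)
    simp only [add_zero] at h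
    rw [Nat.add_sub_cancel' hl, G.dist_comm] at h
    omega
  obtain ⟨l, h1, h2⟩ := ((p.busemann_spec hG (p.node k)).and (eventually_ge_atTop k)).exists
  have := hd l h2
  omega

theorem busemann_iterate_parent (n : ℕ) (t : T) :
    p.busemann hG ((p.parent hG)^[n] t) = p.busemann hG t + n := by
  induction n with
  | zero => simp
  | succ n ih =>
    rw [Function.iterate_succ_apply', busemann_parent, ih]
    push_cast
    ring

theorem iterate_parent_node (k n : ℕ) : (p.parent hG)^[n] (p.node k) = p.node (k + n) := by
  induction n with
  | zero => simp
  | succ n ih =>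
    rw [Function.iterate_succ_apply', ih, ← add_assoc]
    refine (p.eq_parent hG (p.adj _) ?_).symm
    rw [busemann_node, busemann_node]
    push_cast
    ring

theorem exists_iterate_parent_eq_node (t : T) : ∃ m n, (p.parent hG)^[m] t = p.node n := by
  obtain ⟨w⟩ := hG.1.preconnected t (p.node 0)
  generalize hv : p.node 0 = v at w
  induction w with
  | nil => exact ⟨0, 0, hv.symm⟩
  | @cons t u v h w ih =>
    obtain ⟨m, n, hm⟩ := ih hv
    rcases p.eq_parent_or hG h with hu | ht
    · exact ⟨m + 1, n, by rw [Function.iterate_succ_apply, ← hu, hm]⟩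
    · refine ⟨m, n + 1, ?_⟩
      rw [ht, ← Function.iterate_succ_apply, Function.iterate_succ_apply', hm]
      exact p.iterate_parent_node hG n 1

theorem exists_iterate_parent_eq (s t : T) :
    ∃ m n, (p.parent hG)^[m] s = (p.parent hG)^[n] t := by
  obtain ⟨m, n, h⟩ := p.exists_iterate_parent_eq_node hG s
  obtain ⟨m', n', h'⟩ := p.exists_iterate_parent_eq_node hG t
  refine ⟨n' + m, n + m', ?_⟩
  rw [Function.iterate_add_apply, h, Function.iterate_add_apply, h', iterate_parent_node,
    iterate_parent_node, add_comm]

/-- Once `r` has joined `p` each step goes to the parent. This propagates backwards: a step away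
from the parent followed by a step to the parent would return to the same node. -/
theorem node_eq_iterate_parent {r : TreeRay G} (hr : r ≈ p) (k : ℕ) :
    r.node k = (p.parent hG)^[k] (r.node 0) := by
  obtain ⟨m, n, h⟩ := hr
  have hstep : ∀ i, r.node (i + 1) = p.parent hG (r.node i) := by
    have hlate : ∀ i, m ≤ i → r.node (i + 1) = p.parent hG (r.node i) := fun i hi => by
      obtain ⟨i, rfl⟩ := Nat.exists_eq_add_of_le hi
      rw [h i, add_assoc, h (i + 1)]
      exact (p.iterate_parent_node hG (n + i) 1).symm
    have hback : ∀ i, r.node (i + 1 + 1) = p.parent hG (r.node (i + 1)) →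
        r.node (i + 1) = p.parent hG (r.node i) := fun i hi => by
      rcases p.eq_parent_or hG (r.adj i) with hu | ht
      · exact hu
      · exact absurd (ht.trans hi.symm) (r.nonbacktracking i)
    have hdown : ∀ d i, m ≤ i + d → r.node (i + 1) = p.parent hG (r.node i) := by
      intro d
      induction d with
      | zero => exact fun i hi => hlate i (by omega)
      | succ d ih => exact fun i hi => hback i (ih (i + 1) (by omega))
    exact fun i => hdown m i (by omega)
  induction k with
  | zero => rfl
  | succ k ih => rw [hstep, ih, Function.iterate_succ_apply']

/-- The ray from `t` to the end of the ray `p`. -/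
noncomputable def toward (t : T) : TreeRay G where
  node k := (p.parent hG)^[k] t
  adj k := by
    rw [Function.iterate_succ_apply']
    exact p.adj_parent hG _
  nonbacktracking k h := by
    have h' := congrArg (p.busemann hG) h
    rw [busemann_iterate_parent, busemann_iterate_parent] at h'
    push_cast at h'
    omega

theorem toward_equiv (t : T) : p.toward hG t ≈ p := by
  obtain ⟨m, n, h⟩ := p.exists_iterate_parent_eq_node hG t
  refine ⟨m, n, fun k => ?_⟩
  change (p.parent hG)^[m + k] t = _
  rw [add_comm, Function.iterate_add_apply, h, iterate_parent_node]

theorem dist_iterate_parent (n : ℕ) (t : T) : G.dist t ((p.parent hG)^[n] t) = n := by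
  have h := (p.toward hG t).dist_node hG n
  rwa [G.dist_comm] at h

/-- Both rays climb to the meet by parent steps, so both sides are the Busemann value of `u`. -/
theorem isMeet_iff {s t u : T} :
    IsMeet G (Quotient.mk (TreeRay.setoid G) p) s t u →
      p.busemann hG s + G.dist s u = p.busemann hG t + G.dist t u := by
  rintro ⟨a, b, m, n, ha, hb, rfl, rfl, hab, -, rfl⟩
  have ha' := p.node_eq_iterate_parent hG (Quotient.exact ha)
  have hb' := p.node_eq_iterate_parent hG (Quotient.exact hb)
  have h0 := hab 0
  rw [add_zero, add_zero] at h0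
  have h1 : G.dist (a.node 0) (a.node m) = m := by
    rw [ha' m]
    exact p.dist_iterate_parent hG _ _
  have h2 : G.dist (b.node 0) (a.node m) = n := by
    rw [h0, hb' n]
    exact p.dist_iterate_parent hG _ _
  have h3 : p.busemann hG (a.node m) = p.busemann hG (a.node 0) + m := by
    rw [ha' m]
    exact p.busemann_iterate_parent hG _ _
  have h4 : p.busemann hG (a.node m) = p.busemann hG (b.node 0) + n := by
    rw [h0, hb' n]
    exact p.busemann_iterate_parent hG _ _
  rw [h1, h2]
  omega

theorem exists_isMeet (hG : G.IsTree) (p : TreeRay G) (s t : T) :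
    ∃ u, IsMeet G (Quotient.mk (TreeRay.setoid G) p) s t u := by
  classical
  have hex : ∃ m n, (p.parent hG)^[m] t = (p.parent hG)^[n] s :=
    p.exists_iterate_parent_eq hG t s
  obtain ⟨n, hn⟩ := Nat.find_spec hex
  -- The levels of `s` and `t` fix the difference of the two exponents, so minimising one minimises
  -- the other, as `IsMeet` demands.
  have hlev : ∀ m n, (p.parent hG)^[m] t = (p.parent hG)^[n] s →
      p.busemann hG t + m = p.busemann hG s + n := fun m n h => by
    have h' := congrArg (p.busemann hG) h
    rwa [busemann_iterate_parent, busemann_iterate_parent] at h'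
  refine ⟨_, p.toward hG t, p.toward hG s, Nat.find hex, n, Quotient.sound (p.toward_equiv hG t),
    Quotient.sound (p.toward_equiv hG s), rfl, rfl, fun k => ?_, fun m' n' h => ?_, rfl⟩
  · change (p.parent hG)^[_ + k] t = (p.parent hG)^[_ + k] s
    rw [add_comm, Function.iterate_add_apply, hn, add_comm n, Function.iterate_add_apply]
  · have h0 : (p.parent hG)^[m'] t = (p.parent hG)^[n'] s := h 0
    have h1 : Nat.find hex ≤ m' := Nat.find_min' hex ⟨n', h0⟩
    have h2 := hlev _ _ hn
    have h3 := hlev _ _ h0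
    exact ⟨h1, by omega⟩

theorem treePrec_iff {s t : T} :
    TreePrec G (Quotient.mk (TreeRay.setoid G) p) s t ↔
      p.busemann hG t ≤ p.busemann hG s := by
  constructor
  · rintro ⟨u, hu, h⟩
    have := p.isMeet_iff hG hu
    omega
  · intro h
    obtain ⟨u, hu⟩ := exists_isMeet hG p s t
    have := p.isMeet_iff hG hu
    exact ⟨u, hu, by omega⟩

theorem treeHoro_iff {s t : T} :
    TreeHoro G (Quotient.mk (TreeRay.setoid G) p) s t ↔
      p.busemann hG s = p.busemann hG t := by
  constructor
  · rintro ⟨u, hu, h⟩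
    have := p.isMeet_iff hG hu
    omega
  · intro h
    obtain ⟨u, hu⟩ := exists_isMeet hG p s t
    have := p.isMeet_iff hG hu
    exact ⟨u, hu, by omega⟩

end TreeRay

end TreeCombinatorics

namespace MultiscaleTree

variable {q : ℕ} {T : Type*} (M : MultiscaleTree q T)

/-- Apart from nonemptiness, this is all that is used of the tree afterwards. The neighbours of `t`
are its parent and the nodes t α_j. There are q + 1 of them, so the q shifts of `t` must be
distinct; the unique parent accounts for the rest of the injectivity. -/
theorem exists_level : ∃ h : T → ℤ,
    (∀ s t, M.Prec s t ↔ h s ≤ h t) ∧ (∀ s t, M.Horo s t ↔ h s = h t) ∧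
    (∀ j t, h (M.shift j t) = h t + 1) ∧
    (∀ i j s t, M.shift i s = M.shift j t → i = j ∧ s = t) ∧
    (∀ t, ∃ j s, M.shift j s = t) := by
  obtain ⟨p, hp⟩ := Quotient.exists_rep M.bdry
  have hG := M.isTree
  have hPrec : ∀ s t, M.Prec s t ↔ -p.busemann hG s ≤ -p.busemann hG t := fun s t => by
    rw [Prec, ← hp, p.treePrec_iff hG]
    omega
  have hchild : ∀ t s, s ∈ Set.range (fun j => M.shift j t) ↔ p.parent hG s = t := fun t s => by
    rw [M.range_shift t, Set.mem_ofPred_eq]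
    have h1 := hPrec t s
    rw [Prec] at h1
    rw [h1, SimpleGraph.dist_eq_one_iff_adj]
    constructor
    · rintro ⟨h, hadj⟩
      rcases p.eq_parent_or hG hadj with h' | h'
      · have := p.busemann_parent hG t
        rw [← h'] at this
        omega
      · exact h'.symm
    · rintro rfl
      have := p.busemann_parent hG s
      exact ⟨by omega, (p.adj_parent hG s).symm⟩
  have hpar : ∀ j t, p.parent hG (M.shift j t) = t := fun j t => (hchild t _).mp ⟨j, rfl⟩
  have hinj : ∀ t, Function.Injective (fun j => M.shift j t) := fun t => by
    have hfin : (M.graph.neighborSet t).Finite :=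
      Set.finite_of_ncard_ne_zero (by rw [M.degree t]; omega)
    have hset : M.graph.neighborSet t =
        insert (p.parent hG t) (Set.range fun j => M.shift j t) := by
      ext s
      rw [Set.mem_insert_iff, hchild, SimpleGraph.mem_neighborSet]
      constructor
      · intro h
        rcases p.eq_parent_or hG h with h' | h'
        · exact Or.inl h'
        · exact Or.inr h'.symm
      · rintro (rfl | rfl)
        · exact p.adj_parent hG t
        · exact (p.adj_parent hG s).symm
    have hcard : q ≤ (Set.range fun j => M.shift j t).ncard := by
      have h1 := M.degree t
      have h2 := Set.ncard_insert_le (p.parent hG t) (Set.range fun j => M.shift j t)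
      rw [hset] at h1
      omega
    rw [← Set.image_univ] at hcard
    rw [← Set.injOn_univ]
    refine Set.injOn_of_ncard_image_eq (le_antisymm (Set.ncard_image_le) ?_)
    simpa [Set.ncard_univ] using hcard
  refine ⟨fun t => -p.busemann hG t, hPrec, fun s t => ?_, fun j t => ?_, fun i j s t h => ?_,
    fun t => ?_⟩
  · rw [Horo, ← hp, p.treeHoro_iff hG]
    exact neg_inj.symm
  · have := p.busemann_parent hG (M.shift j t)
    rw [hpar] at this
    change -_ = -_ + (1 : ℤ)
    omega
  · have hst : s = t := by rw [← hpar i s, h, hpar]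
    subst hst
    exact ⟨hinj s h, rfl⟩
  · obtain ⟨j, hj⟩ := (hchild (p.parent hG t) t).mpr rfl
    exact ⟨j, _, hj⟩

/-- The level of a node: minus the Busemann function of the chosen boundary point. -/
noncomputable def level : T → ℤ := M.exists_level.choose

theorem prec_iff {s t : T} : M.Prec s t ↔ M.level s ≤ M.level t :=
  M.exists_level.choose_spec.1 s t

theorem horo_iff {s t : T} : M.Horo s t ↔ M.level s = M.level t :=
  M.exists_level.choose_spec.2.1 s t

theorem level_shift (j : Fin q) (t : T) : M.level (M.shift j t) = M.level t + 1 :=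
  M.exists_level.choose_spec.2.2.1 j t

theorem shift_inj {i j : Fin q} {s t : T} (h : M.shift i s = M.shift j t) : i = j ∧ s = t :=
  M.exists_level.choose_spec.2.2.2.1 i j s t h

theorem exists_shift_eq (t : T) : ∃ j s, M.shift j s = t :=
  M.exists_level.choose_spec.2.2.2.2 t

end MultiscaleTree

/-! ## Matrix entries of operators on `ℓ²(T)` -/

section Entries

variable {T : Type*}

theorem treeBasis_self (t : T) : treeBasis t t = 1 := by
  simp [treeBasis]

theorem treeBasis_of_ne {s t : T} (h : t ≠ s) : treeBasis s t = 0 := by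
  simp [treeBasis, h]

theorem inner_treeBasis_left (t : T) (f : TreeL2 T) : ⟪treeBasis t, f⟫_ℂ = f t := by
  classical
  rw [treeBasis, lp.inner_single_left]
  simp

theorem treeL2_ext {f g : TreeL2 T} (h : ∀ t, f t = g t) : f = g :=
  lp.ext (funext h)

theorem treeL2_norm_sq_hasSum (f : TreeL2 T) : HasSum (fun t => ‖f t‖ ^ 2) (‖f‖ ^ 2) := by
  simpa using lp.hasSum_norm (p := 2) (by simp) f

theorem treeL2_sum_norm_sq_le (f : TreeL2 T) (J : Finset T) :
    ∑ t ∈ J, ‖f t‖ ^ 2 ≤ ‖f‖ ^ 2 :=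
  sum_le_hasSum J (fun _ _ => by positivity) (treeL2_norm_sq_hasSum f)

theorem treeL2_norm_sq_sum_basis (I : Finset T) (f : T → ℂ) :
    ‖∑ s ∈ I, f s • treeBasis s‖ ^ 2 = ∑ s ∈ I, ‖f s‖ ^ 2 := by
  classical
  have h := lp.norm_sum_single (p := 2) (E := fun _ : T => ℂ) (by simp) f I
  simp only [ENNReal.toReal_ofNat, Real.rpow_ofNat] at h
  rw [← h]
  congr 3
  ext s t
  rw [treeBasis, ← lp.single_smul]
  simp

theorem treeOp_apply_hasSum (S : TreeOp T) (f : TreeL2 T) (t : T) :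
    HasSum (fun s => f s * S (treeBasis s) t) (S f t) := by
  have h := (treeOp_hasSum S f).mapL (innerSL ℂ (treeBasis t))
  simpa [inner_treeBasis_left] using h

theorem treeOp_ext {S R : TreeOp T}
    (h : ∀ s t, S (treeBasis s) t = R (treeBasis s) t) : S = R := by
  ext1 f
  refine treeL2_ext fun t => (treeOp_apply_hasSum S f t).unique ?_
  simp only [h]
  exact treeOp_apply_hasSum R f t

theorem treeOp_mul_hasSum (S R : TreeOp T) (s t : T) :
    HasSum (fun r => R (treeBasis s) r * S (treeBasis r) t) ((S * R) (treeBasis s) t) :=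
  treeOp_apply_hasSum S (R (treeBasis s)) t

theorem treeOp_adjoint_entry (S : TreeOp T) (s t : T) :
    (S†) (treeBasis s) t = (starRingEnd ℂ) (S (treeBasis t) s) := by
  rw [← inner_treeBasis_left t, ContinuousLinearMap.adjoint_inner_right, ← inner_conj_symm,
    inner_treeBasis_left]

theorem treeBasis_dense :
    DenseRange (Finsupp.linearCombination ℂ (treeBasis : T → TreeL2 T)) := by
  intro f
  refine mem_closure_of_tendsto (treeOp_hasSum (1 : TreeOp T) f)
    (Eventually.of_forall fun I => ?_)
  refine ⟨∑ s ∈ I, Finsupp.single s (f s), ?_⟩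
  simp [map_sum]

/-- A matrix which is bounded on finitely supported vectors is the matrix of an operator. -/
theorem exists_treeOp_of_entries (a : T → T → ℂ) {K : ℝ} (hK : 0 ≤ K)
    (h : ∀ (I J : Finset T) (f : T → ℂ),
      ∑ t ∈ J, ‖∑ s ∈ I, f s * a t s‖ ^ 2 ≤ K ^ 2 * ∑ s ∈ I, ‖f s‖ ^ 2) :
    ∃ S : TreeOp T, ‖S‖ ≤ K ∧ ∀ s t, S (treeBasis s) t = a t s := by
  classical
  have hcol : ∀ s, Memℓp (fun t => a t s) 2 := fun s =>
    memℓp_gen' (C := K ^ 2) fun J => by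
      have h1 := h {s} J (fun _ => 1)
      simpa using h1
  let col : T → TreeL2 T := fun s => ⟨fun t => a t s, hcol s⟩
  have hbound : ∀ x : T →₀ ℂ, ‖Finsupp.linearCombination ℂ col x‖ ≤
      K * ‖Finsupp.linearCombination ℂ (treeBasis : T → TreeL2 T) x‖ := by
    intro x
    refine lp.norm_le_of_forall_sum_le (by simp) (by positivity) fun J => ?_
    simp only [ENNReal.toReal_ofNat, Real.rpow_ofNat, Finsupp.linearCombination_apply,
      Finsupp.sum, mul_pow]
    rw [treeL2_norm_sq_sum_basis]
    refine le_trans (le_of_eq ?_) (h x.support J x)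
    refine Finset.sum_congr rfl fun t _ => ?_
    rw [lp.coeFn_sum, Finset.sum_apply]
    rfl
  refine ⟨(Finsupp.linearCombination ℂ col).extendOfNorm
    (Finsupp.linearCombination ℂ (treeBasis : T → TreeL2 T)), ?_, fun s t => ?_⟩
  · exact ContinuousLinearMap.opNorm_le_bound _ hK fun f =>
      LinearMap.norm_extendOfNorm_apply_le treeBasis_dense K hbound f
  · have h1 := LinearMap.extendOfNorm_eq treeBasis_dense ⟨K, hbound⟩ (Finsupp.single s 1)
    rw [Finsupp.linearCombination_single, Finsupp.linearCombination_single, one_smul,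
      one_smul] at h1
    rw [h1]

end Entries

namespace MultiscaleTree

variable {q : ℕ} {T : Type*} {M : MultiscaleTree q T}

/-! ## Graded operators -/

/-- `S` raises the level of nodes by `n`. -/
def IsDeg (M : MultiscaleTree q T) (n : ℤ) (S : TreeOp T) : Prop :=
  ∀ s t, M.level t ≠ M.level s + n → S (treeBasis s) t = 0

theorem IsDeg.add {n : ℤ} {S R : TreeOp T} (hS : M.IsDeg n S) (hR : M.IsDeg n R) :
    M.IsDeg n (S + R) := fun s t h => by
  simp [hS s t h, hR s t h]

theorem IsDeg.sub {n : ℤ} {S R : TreeOp T} (hS : M.IsDeg n S) (hR : M.IsDeg n R) :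
    M.IsDeg n (S - R) := fun s t h => by
  simp [hS s t h, hR s t h]

theorem isDeg_zero (n : ℤ) : M.IsDeg n 0 := fun _ _ _ => rfl

theorem isDeg_sum {ι : Type*} (I : Finset ι) {n : ℤ} {S : ι → TreeOp T}
    (hS : ∀ i ∈ I, M.IsDeg n (S i)) : M.IsDeg n (∑ i ∈ I, S i) := by
  classical
  induction I using Finset.induction_on with
  | empty => exact isDeg_zero n
  | insert i I hi ih =>
    rw [Finset.sum_insert hi]
    exact (hS i (by simp)).add (ih fun j hj => hS j (by simp [hj]))

theorem isDeg_one : M.IsDeg 0 1 := fun s t h => by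
  refine treeBasis_of_ne ?_
  rintro rfl
  simp at h

theorem IsDeg.mul {m n : ℤ} {S R : TreeOp T} (hS : M.IsDeg m S) (hR : M.IsDeg n R) :
    M.IsDeg (m + n) (S * R) := fun s t h => by
  refine (treeOp_mul_hasSum S R s t).unique ?_
  convert (hasSum_zero : HasSum (fun _ : T => (0 : ℂ)) 0) using 2 with r
  by_cases hr : M.level r = M.level s + n
  · rw [hS r t (by omega), mul_zero]
  · rw [hR s r hr, zero_mul]

theorem IsDeg.adjoint {n : ℤ} {S : TreeOp T} (hS : M.IsDeg n S) : M.IsDeg (-n) (S†) :=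
  fun s t h => by
    rw [treeOp_adjoint_entry, hS t s (by omega), map_zero]

theorem IsDeg.pow {n : ℤ} {S : TreeOp T} (hS : M.IsDeg n S) (k : ℕ) : M.IsDeg (k * n) (S ^ k) := by
  induction k with
  | zero => simpa using isDeg_one
  | succ k ih =>
    rw [pow_succ, Nat.cast_succ, add_mul, one_mul]
    exact ih.mul hS

/-- The order only compares levels, so causality is block triangularity with respect to the level.
-/
theorem isCausal_iff {S : TreeOp T} :
    M.IsCausal S ↔ ∀ s t, M.level t < M.level s → S (treeBasis s) t = 0 := by
  constructor
  · intro hS s t h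
    refine hS t _ (fun r hr => treeBasis_of_ne ?_) t (M.prec_iff.mpr le_rfl)
    rintro rfl
    exact absurd (M.prec_iff.mp hr) (not_le.mpr h)
  · intro hS s f hf t ht
    refine (treeOp_apply_hasSum S f t).unique ?_
    convert (hasSum_zero : HasSum (fun _ : T => (0 : ℂ)) 0) using 2 with r
    by_cases h : M.level r ≤ M.level s
    · rw [hf r (M.prec_iff.mpr h), zero_mul]
    · have := M.prec_iff.mp ht
      rw [hS r t (by omega), mul_zero]

theorem IsDeg.isCausal {n : ℤ} {S : TreeOp T} (hS : M.IsDeg n S) (hn : 0 ≤ n) : M.IsCausal S :=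
  isCausal_iff.mpr fun s t h => hS s t (by omega)

theorem isConst_iff {S : TreeOp T} : M.IsConst S ↔ M.IsDeg 0 S := by
  constructor
  · rintro ⟨h1, h2⟩ s t h
    rcases lt_or_gt_of_ne h with h | h
    · exact isCausal_iff.mp h1 s t (by omega)
    · have h3 := isCausal_iff.mp h2 t s (by omega)
      rw [treeOp_adjoint_entry] at h3
      simpa using h3
  · intro h
    exact ⟨h.isCausal le_rfl, h.adjoint.isCausal (by simp)⟩

/-- The degree part is the direct sum of the blocks of `S` from level m - n to level m. Their
domains are mutually orthogonal, as are their ranges, and each block has norm at most `‖S‖`. -/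
theorem exists_degPart (M : MultiscaleTree q T) (n : ℤ) (S : TreeOp T) :
    ∃ D : TreeOp T, ‖D‖ ≤ ‖S‖ ∧ ∀ s t, D (treeBasis s) t =
      if M.level t = M.level s + n then S (treeBasis s) t else 0 := by
  classical
  refine exists_treeOp_of_entries _ (norm_nonneg S) fun I J f => ?_
  let g : ℤ → TreeL2 T := fun m => ∑ s ∈ I with M.level s = m, f s • treeBasis s
  have hentry : ∀ m, ∀ t ∈ J.filter (fun t => M.level t = m),
      ∑ s ∈ I, f s * (if M.level t = M.level s + n then S (treeBasis s) t else 0) =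
        S (g (m - n)) t := by
    intro m t ht
    have ht' := (Finset.mem_filter.mp ht).2
    simp only [g, map_sum, lp.coeFn_sum, Finset.sum_apply, Finset.sum_filter, mul_ite, mul_zero]
    refine Finset.sum_congr rfl fun s _ => ?_
    by_cases hs : M.level t = M.level s + n
    · rw [if_pos hs, if_pos (by omega), map_smul]
      rfl
    · rw [if_neg hs, if_neg (by omega), map_zero]
      rfl
  rw [← Finset.sum_fiberwise_of_maps_to (t := J.image M.level) (g := M.level)
    (fun t ht => Finset.mem_image_of_mem _ ht)]
  calc ∑ m ∈ J.image M.level, ∑ t ∈ J with M.level t = m,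
        ‖∑ s ∈ I, f s * (if M.level t = M.level s + n then S (treeBasis s) t else 0)‖ ^ 2
      ≤ ∑ m ∈ J.image M.level, ‖S‖ ^ 2 * ∑ s ∈ I with M.level s + n = m, ‖f s‖ ^ 2 := by
        refine Finset.sum_le_sum fun m _ => ?_
        rw [Finset.sum_congr rfl fun t ht => by rw [hentry m t ht]]
        refine (treeL2_sum_norm_sq_le _ _).trans ?_
        refine (pow_le_pow_left₀ (norm_nonneg _) (S.le_opNorm _) 2).trans ?_
        rw [mul_pow, treeL2_norm_sq_sum_basis]
        refine le_of_eq ?_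
        congr 2
        ext s
        simp only [Finset.mem_filter]
        exact and_congr_right fun _ => by omega
    _ ≤ ‖S‖ ^ 2 * ∑ s ∈ I, ‖f s‖ ^ 2 := by
        rw [← Finset.mul_sum]
        refine mul_le_mul_of_nonneg_left ?_ (by positivity)
        exact Finset.sum_fiberwise_le_sum_of_sum_fiber_nonneg fun m _ =>
          Finset.sum_nonneg fun s _ => by positivity

/-- The part of degree `n` of an operator. -/
noncomputable def degPart (M : MultiscaleTree q T) (n : ℤ) (S : TreeOp T) : TreeOp T :=
  (M.exists_degPart n S).choose

theorem norm_degPart_le (n : ℤ) (S : TreeOp T) : ‖M.degPart n S‖ ≤ ‖S‖ :=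
  (M.exists_degPart n S).choose_spec.1

theorem degPart_entry (n : ℤ) (S : TreeOp T) (s t : T) : M.degPart n S (treeBasis s) t =
    if M.level t = M.level s + n then S (treeBasis s) t else 0 :=
  (M.exists_degPart n S).choose_spec.2 s t

theorem isDeg_degPart (n : ℤ) (S : TreeOp T) : M.IsDeg n (M.degPart n S) := fun s t h => by
  rw [degPart_entry, if_neg h]

theorem IsDeg.degPart_self {n : ℤ} {S : TreeOp T} (hS : M.IsDeg n S) : M.degPart n S = S :=
  treeOp_ext fun s t => by
    rw [degPart_entry]
    split_ifs with h
    · rfl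
    · exact (hS s t h).symm

theorem IsDeg.degPart_of_ne {m n : ℤ} {S : TreeOp T} (hS : M.IsDeg n S) (h : m ≠ n) :
    M.degPart m S = 0 :=
  treeOp_ext fun s t => by
    rw [degPart_entry]
    split_ifs with h'
    · exact hS s t (by omega)
    · rfl

theorem IsCausal.degPart_of_neg {n : ℤ} {S : TreeOp T} (hS : M.IsCausal S) (h : n < 0) :
    M.degPart n S = 0 :=
  treeOp_ext fun s t => by
    rw [degPart_entry]
    split_ifs with h'
    · exact isCausal_iff.mp hS s t (by omega)
    · rfl

theorem degPart_add (n : ℤ) (S R : TreeOp T) :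
    M.degPart n (S + R) = M.degPart n S + M.degPart n R :=
  treeOp_ext fun s t => by
    change _ = M.degPart n S (treeBasis s) t + M.degPart n R (treeBasis s) t
    simp only [degPart_entry]
    split_ifs
    · rfl
    · simp

theorem degPart_sub (n : ℤ) (S R : TreeOp T) :
    M.degPart n (S - R) = M.degPart n S - M.degPart n R :=
  treeOp_ext fun s t => by
    change _ = M.degPart n S (treeBasis s) t - M.degPart n R (treeBasis s) t
    simp only [degPart_entry]
    split_ifs
    · rfl
    · simp

theorem degPart_ext {S R : TreeOp T} (h : ∀ n, M.degPart n S = M.degPart n R) : S = R :=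
  treeOp_ext fun s t => by
    have h1 := congrArg (fun D : TreeOp T => D (treeBasis s) t)
      (h (M.level t - M.level s))
    simpa [degPart_entry] using h1

theorem degPart_causal_ext {S R : TreeOp T} (hS : M.IsCausal S) (hR : M.IsCausal R)
    (h : ∀ n : ℕ, M.degPart n S = M.degPart n R) : S = R :=
  degPart_ext (M := M) fun n => by
    rcases lt_or_ge n 0 with hn | hn
    · rw [hS.degPart_of_neg hn, hR.degPart_of_neg hn]
    · lift n to ℕ using hn
      exact h n

theorem IsDeg.degPart_mul_right {k : ℤ} {R : TreeOp T} (hR : M.IsDeg k R) (n : ℤ)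
    (S : TreeOp T) : M.degPart n (S * R) = M.degPart (n - k) S * R :=
  treeOp_ext fun s t => by
    refine HasSum.unique ?_ (treeOp_mul_hasSum (M.degPart (n - k) S) R s t)
    rw [degPart_entry]
    have h := treeOp_mul_hasSum S R s t
    split_ifs with h'
    · convert h using 2 with r
      rw [degPart_entry]
      by_cases hr : M.level r = M.level s + k
      · rw [if_pos (by omega)]
      · rw [hR s r hr, zero_mul, zero_mul]
    · convert (hasSum_zero : HasSum (fun _ : T => (0 : ℂ)) 0) using 2 with r
      rw [degPart_entry]
      by_cases hr : M.level r = M.level s + k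
      · rw [if_neg (by omega), mul_zero]
      · rw [hR s r hr, zero_mul]

/-! ## Shifts and words -/

theorem α_basis_apply (j : Fin q) (s t : T) :
    M.α j (treeBasis s) t = treeBasis s (M.shift j t) := rfl

theorem isDeg_α (j : Fin q) : M.IsDeg (-1) (M.α j) := fun s t h => by
  refine treeBasis_of_ne ?_
  rintro rfl
  rw [M.level_shift] at h
  omega

theorem node_cons (t : T) (i : Fin q) (w : List (Fin q)) :
    M.node t (i :: w) = M.node (M.shift i t) w := rfl

theorem word_cons (i : Fin q) (w : List (Fin q)) :
    M.word (i :: w) = M.α i * M.word w := by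
  simp [word]

theorem word_apply (w : List (Fin q)) (f : TreeL2 T) (t : T) :
    M.word w f t = f (M.node t w) := by
  induction w generalizing t with
  | nil => rfl
  | cons i w ih =>
    rw [word_cons]
    exact ih _

theorem level_node (t : T) (w : List (Fin q)) : M.level (M.node t w) = M.level t + w.length := by
  induction w generalizing t with
  | nil => simp [node]
  | cons i w ih =>
    rw [node_cons, ih, M.level_shift, List.length_cons]
    push_cast
    ring

theorem node_inj {s t : T} {v w : List (Fin q)} (hl : v.length = w.length)
    (h : M.node s v = M.node t w) : s = t ∧ v = w := by
  induction v generalizing s t w with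
  | nil =>
    rw [List.length_nil] at hl
    have hw : w = [] := List.length_eq_zero_iff.mp hl.symm
    subst hw
    exact ⟨h, rfl⟩
  | cons i v ih =>
    match w, hl, h with
    | [], hl, _ => simp at hl
    | j :: w, hl, h =>
      obtain ⟨h1, rfl⟩ := ih (s := M.shift i s) (t := M.shift j t)
        (by simpa only [List.length_cons, Nat.add_right_cancel_iff] using hl) h
      obtain ⟨rfl, rfl⟩ := M.shift_inj h1
      exact ⟨rfl, rfl⟩

theorem exists_node_eq (M : MultiscaleTree q T) (n : ℕ) (t : T) :
    ∃ (w : List (Fin q)) (s : T), w.length = n ∧ M.node s w = t := by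
  induction n with
  | zero => exact ⟨[], t, rfl, rfl⟩
  | succ n ih =>
    obtain ⟨w, s, rfl, rfl⟩ := ih
    obtain ⟨i, r, rfl⟩ := M.exists_shift_eq s
    exact ⟨i :: w, r, rfl, rfl⟩

theorem isDeg_word (w : List (Fin q)) : M.IsDeg (-w.length) (M.word w) := fun s t h => by
  rw [word_apply]
  refine treeBasis_of_ne ?_
  rintro rfl
  rw [level_node] at h
  omega

theorem adjoint_word_node (w : List (Fin q)) (f : TreeL2 T) (s : T) :
    ((M.word w)†) f (M.node s w) = f s := by
  rw [← inner_treeBasis_left, ContinuousLinearMap.adjoint_inner_right, ← inner_treeBasis_left]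
  congr 1
  refine treeL2_ext fun t => ?_
  rw [word_apply]
  by_cases h : t = s
  · rw [h, treeBasis_self, treeBasis_self]
  · rw [treeBasis_of_ne h, treeBasis_of_ne]
    exact fun h' => h (node_inj rfl h').1

theorem adjoint_word_of_ne (w : List (Fin q)) (f : TreeL2 T) {t : T}
    (h : ∀ s, M.node s w ≠ t) : ((M.word w)†) f t = 0 := by
  rw [← inner_treeBasis_left, ContinuousLinearMap.adjoint_inner_right]
  convert inner_zero_left f
  refine treeL2_ext fun s => ?_
  rw [word_apply]
  exact treeBasis_of_ne (h s)

theorem word_mul_adjoint (w : List (Fin q)) : M.word w * (M.word w)† = 1 := by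
  ext1 f
  refine treeL2_ext fun t => ?_
  change M.word w (((M.word w)†) f) t = f t
  rw [word_apply, adjoint_word_node]

theorem α_mul_adjoint (j : Fin q) : M.α j * (M.α j)† = 1 := by
  have h := word_mul_adjoint (M := M) [j]
  simpa [word] using h

theorem α_pow_mul_adjoint (j : Fin q) (n : ℕ) : M.α j ^ n * (M.α j ^ n)† = 1 := by
  have h := word_mul_adjoint (M := M) (List.replicate n j)
  simpa [word] using h

theorem isDeg_α_pow (j : Fin q) (n : ℕ) : M.IsDeg (-n) (M.α j ^ n) := by
  have h := (isDeg_α (M := M) j).pow n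
  simpa using h

theorem isDeg_α_pow_adjoint (j : Fin q) (n : ℕ) : M.IsDeg n ((M.α j ^ n)†) := by
  have h := (isDeg_α_pow (M := M) j n).adjoint
  simpa using h

theorem isDeg_α_adjoint (j : Fin q) : M.IsDeg 1 ((M.α j)†) := by
  have h := (isDeg_α (M := M) j).adjoint
  simpa using h

/-- Each w* w is the projection onto the functions supported on {s w : s ∈ T}, and for words of
length n these sets partition the tree. -/
theorem sum_adjoint_word_mul_word (M : MultiscaleTree q T) (n : ℕ) :
    ∑ w : Fin n → Fin q, (M.word (List.ofFn w))† * M.word (List.ofFn w) = 1 := by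
  ext1 f
  refine treeL2_ext fun t => ?_
  obtain ⟨v, s, hv, rfl⟩ := M.exists_node_eq n t
  obtain ⟨v, rfl⟩ : ∃ v' : Fin n → Fin q, List.ofFn v' = v := by
    subst hv
    exact ⟨v.get, List.ofFn_get v⟩
  rw [sum_apply, lp.coeFn_sum, Finset.sum_apply, Finset.sum_eq_single v]
  · rw [mul_apply_eq_comp, adjoint_word_node, word_apply,
      one_apply_eq_self]
  · intro w _ hw
    rw [mul_apply_eq_comp]
    refine adjoint_word_of_ne _ _ fun r hr => hw ?_
    exact List.ofFn_injective (node_inj (by simp) hr).2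
  · simp

/-! ## Coefficients, expansions and evaluations -/

open scoped Classical in
-- The condition `t ≍ s` says that s w lies |w| levels above t, so it selects the part of degree
-- |w|. The product is bounded, hence the definition of `coeff` always takes its first branch.
theorem coeff_eq (S : TreeOp T) (w : List (Fin q)) :
    M.coeff S w = M.word w * M.degPart w.length S := by
  have hmat : ∀ t s, (M.word w * M.degPart w.length S) (treeBasis t) s =
      if M.Horo t s then S (treeBasis t) (M.node s w) else 0 := fun t s => by
    change M.word w (M.degPart w.length S (treeBasis t)) s = _
    rw [word_apply, degPart_entry]
    refine if_congr ?_ rfl rfl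
    rw [M.horo_iff, level_node]
    omega
  have hex : ∃ A : TreeOp T, ∀ t s,
      A (treeBasis t) s = if M.Horo t s then S (treeBasis t) (M.node s w) else 0 := ⟨_, hmat⟩
  rw [coeff, dif_pos hex]
  exact treeOp_ext fun t s => by rw [hmat, hex.choose_spec t s]

theorem sum_adjoint_word_mul_coeff (S : TreeOp T) (n : ℕ) :
    ∑ w : Fin n → Fin q, ((M.word (List.ofFn w))†) * M.coeff S (List.ofFn w) =
      M.degPart n S := by
  simp only [coeff_eq, List.length_ofFn, ← mul_assoc]
  rw [← Finset.sum_mul, sum_adjoint_word_mul_word, one_mul]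

theorem eval_eq_tsum (S : TreeOp T) (c : Fin q → TreeOp T) :
    M.eval S c = ∑' n : ℕ, M.rowα c ^ n * M.degPart n S := by
  simp only [eval, sum_adjoint_word_mul_coeff]

theorem eval_zero (S : TreeOp T) : M.eval S 0 = M.degPart 0 S := by
  have h0 : M.rowα (0 : Fin q → TreeOp T) = 0 := by simp [rowα]
  rw [eval_eq_tsum, tsum_eq_single 0]
  · simp
  · intro n hn
    rw [h0, zero_pow hn, zero_mul]

theorem isConst_word_mul {w : List (Fin q)} {S : TreeOp T} (hS : M.IsDeg w.length S) :
    M.IsConst (M.word w * S) := by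
  rw [isConst_iff]
  have h := (isDeg_word (M := M) w).mul hS
  simpa using h

theorem degPart_apply_hasSum (S : TreeOp T) (n : ℤ) (f : TreeL2 T) (t : T) :
    HasSum (fun s : {s // M.level t - M.level s = n} => f s * S (treeBasis s) t)
      (M.degPart n S f t) := by
  refine (hasSum_subtype_iff_indicator (f := fun s => f s * S (treeBasis s) t)
    (s := {s | M.level t - M.level s = n})).mpr ?_
  convert treeOp_apply_hasSum (M.degPart n S) f t using 2 with s
  rw [degPart_entry, Set.indicator_apply, mul_ite, mul_zero]
  exact if_congr (by simp; omega) rfl rfl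

/-- The expansion of `S f t` along row `t` of the matrix is regrouped by the level difference;
absolute convergence is automatic for scalars. -/
theorem IsCausal.hasSum_degPart {S : TreeOp T} (hS : M.IsCausal S) (f : TreeL2 T) (t : T) :
    Summable (fun n : ℕ => ‖M.degPart n S f t‖) ∧
      HasSum (fun n : ℕ => M.degPart n S f t) (S f t) := by
  have h := treeOp_apply_hasSum S f t
  let e := Equiv.sigmaFiberEquiv fun s => M.level t - M.level s
  have h1 : HasSum (fun n : ℤ => M.degPart n S f t) (S f t) :=
    ((e.hasSum_iff (f := fun s => f s * S (treeBasis s) t)).mpr h).sigma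
      fun n => degPart_apply_hasSum S n f t
  have h2 : HasSum (fun n : ℕ => M.degPart n S f t) (S f t) := by
    refine (Nat.cast_injective.hasSum_iff (f := fun n : ℤ => M.degPart n S f t)
      fun n hn => ?_).mpr h1
    have hneg : n < 0 := by
      by_contra h0
      lift n to ℕ using not_lt.mp h0
      exact hn ⟨n, rfl⟩
    simp only [hS.degPart_of_neg hneg]
    rfl
  exact ⟨summable_norm_iff.mpr h2.summable, h2⟩

/-- At a fixed node `t` only one word of each length n contributes, the one with t = s w, and its
term is (Sₙ f)(t). -/
theorem IsCausal.hasExpansion {S : TreeOp T} (hS : M.IsCausal S) :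
    M.HasExpansion S fun w => M.word w * M.degPart w.length S := by
  intro f t
  choose w s hw hs using fun n => M.exists_node_eq n t
  have hinj : Function.Injective w := fun m n h => by
    rw [← hw m, h, hw n]
  have hterm : ∀ n, ((M.word (w n))†) ((M.word (w n) * M.degPart (w n).length S) f) t =
      M.degPart n S f t := fun n => by
    conv_lhs => rw [← hs n]
    change ((M.word (w n))†) ((M.word (w n)) (M.degPart (w n).length S f)) _ = _
    rw [adjoint_word_node, word_apply, hs n, hw n]
  have hzero : ∀ v ∉ Set.range w,
      ((M.word v)†) ((M.word v * M.degPart v.length S) f) t = 0 := fun v hv => by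
    refine adjoint_word_of_ne _ _ fun r hr => hv ⟨v.length, ?_⟩
    exact (node_inj (hw _) ((hs _).trans hr.symm)).2
  obtain ⟨h1, h2⟩ := hS.hasSum_degPart f t
  constructor
  · refine (hinj.summable_iff fun v hv => by simp only [hzero v hv, norm_zero]).mp ?_
    refine h1.congr fun n => ?_
    rw [Function.comp_apply, hterm]
  · refine (hinj.hasSum_iff fun v hv => hzero v hv).mp ?_
    convert h2 using 2 with n
    exact hterm n

end MultiscaleTree

/-! ## Two-sided multiplications of Hilbert-Schmidt operators -/

section HilbertSchmidt

variable {T : Type*}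

/-- The square summable families of columns, that is, the Hilbert-Schmidt operators. -/
abbrev TreeHS (T : Type*) : Type _ := lp (fun _ : T => TreeL2 T) 2

/-- The square of the Hilbert-Schmidt norm. -/
noncomputable def hsSq (S : TreeOp T) : ℝ≥0∞ := ∑' t, ‖S (treeBasis t)‖ₑ ^ 2

theorem treeL2_enorm_sq (f : TreeL2 T) : ‖f‖ₑ ^ 2 = ∑' t, ‖f t‖ₑ ^ 2 := by
  have h := treeL2_norm_sq_hasSum f
  simp only [← ofReal_norm, ← ENNReal.ofReal_pow (norm_nonneg _)]
  rw [← h.tsum_eq, ENNReal.ofReal_tsum_of_nonneg (fun _ => by positivity) h.summable]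

theorem hsSq_adjoint (S : TreeOp T) : hsSq (S†) = hsSq S := by
  simp only [hsSq, treeL2_enorm_sq]
  rw [ENNReal.tsum_comm]
  refine tsum_congr fun s => tsum_congr fun t => ?_
  rw [treeOp_adjoint_entry, ← ofReal_norm, RCLike.norm_conj, ofReal_norm]

theorem hsSq_mul_left_le (X S : TreeOp T) : hsSq (X * S) ≤ ‖X‖ₑ ^ 2 * hsSq S := by
  rw [hsSq, hsSq, ← ENNReal.tsum_mul_left]
  refine ENNReal.tsum_le_tsum fun t => ?_
  rw [← mul_pow]
  gcongr
  exact X.le_opENorm _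

theorem treeOp_adjoint_mul (S R : TreeOp T) : ((S * R)†) = (R†) * (S†) :=
  ContinuousLinearMap.adjoint_comp S R

theorem hsSq_mul_right_le (S Z : TreeOp T) : hsSq (S * Z) ≤ ‖Z‖ₑ ^ 2 * hsSq S := by
  rw [← hsSq_adjoint, treeOp_adjoint_mul, ← hsSq_adjoint S]
  refine (hsSq_mul_left_le _ _).trans_eq ?_
  rw [← ofReal_norm, LinearIsometryEquiv.norm_map, ofReal_norm]

theorem hsSq_treeSynth (g : TreeHS T) : hsSq (treeSynth T g) = ‖g‖ₑ ^ 2 := by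
  have h := lp.hasSum_norm (p := 2) (by simp) g
  simp only [ENNReal.toReal_ofNat, Real.rpow_ofNat] at h
  simp only [hsSq, treeSynth_basis, ← ofReal_norm, ← ENNReal.ofReal_pow (norm_nonneg _)]
  rw [← h.tsum_eq, ENNReal.ofReal_tsum_of_nonneg (fun _ => by positivity) h.summable]

theorem exists_treeSynth_eq {S : TreeOp T} (h : hsSq S ≠ ⊤) : ∃ g, treeSynth T g = S := by
  have hs : Summable fun t => ‖S (treeBasis t)‖ ^ 2 := by
    refine (ENNReal.summable_toReal h).congr fun t => ?_
    simp
  have hmem : Memℓp (fun t => S (treeBasis t)) 2 := memℓp_gen (by simpa using hs)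
  refine ⟨⟨fun t => S (treeBasis t), hmem⟩, ?_⟩
  ext1 f
  rw [treeSynth_apply]
  exact (treeOp_hasSum S f).tsum_eq

theorem treeSynth_injective : Function.Injective (treeSynth T) := fun g g' h => by
  refine lp.ext (funext fun t => ?_)
  rw [← treeSynth_basis, h, treeSynth_basis]

theorem hsSq_lr_ne_top (X Z : TreeOp T) (g : TreeHS T) :
    hsSq (X * treeSynth T g * Z) ≠ ⊤ := by
  refine ne_top_of_le_ne_top ?_ ((hsSq_mul_right_le _ Z).trans
    (mul_le_mul_right (hsSq_mul_left_le X _) _))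
  rw [hsSq_treeSynth]
  finiteness

theorem exists_lr (X Z : TreeOp T) : ∃ L : TreeHS T →L[ℂ] TreeHS T,
    ‖L‖ ≤ ‖X‖ * ‖Z‖ ∧ ∀ g, treeSynth T (L g) = X * treeSynth T g * Z := by
  choose φ hφ using fun g => exists_treeSynth_eq (hsSq_lr_ne_top X Z g)
  let L : TreeHS T →ₗ[ℂ] TreeHS T :=
    { toFun := φ
      map_add' := fun g g' => treeSynth_injective (by
        rw [hφ, map_add, map_add, hφ, hφ, mul_add, add_mul])
      map_smul' := fun a g => treeSynth_injective (by
        rw [hφ, map_smul, RingHom.id_apply, map_smul, hφ, mul_smul_comm, smul_mul_assoc]) }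
  refine ⟨L.mkContinuous (‖X‖ * ‖Z‖) fun g => ?_, L.mkContinuous_norm_le (by positivity) _, hφ⟩
  have h : ‖φ g‖ₑ ^ 2 ≤ (‖X‖ₑ * ‖Z‖ₑ * ‖g‖ₑ) ^ 2 := by
    rw [← hsSq_treeSynth, hφ]
    refine ((hsSq_mul_right_le _ Z).trans
      (mul_le_mul_right (hsSq_mul_left_le X _) _)).trans_eq ?_
    rw [hsSq_treeSynth]
    ring
  have h' : ‖φ g‖ₑ ≤ ‖X‖ₑ * ‖Z‖ₑ * ‖g‖ₑ := by
    simpa using (ENNReal.pow_le_pow_left_iff two_ne_zero).mp h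
  have h2 := ENNReal.toReal_mono (by finiteness) h'
  change ‖φ g‖ ≤ _
  simpa using h2

/-- The two-sided multiplication `g ↦ X g Z` of Hilbert-Schmidt operators. -/
noncomputable def hsMul (X Z : TreeOp T) : TreeHS T →L[ℂ] TreeHS T := (exists_lr X Z).choose

theorem norm_hsMul_le (X Z : TreeOp T) : ‖hsMul X Z‖ ≤ ‖X‖ * ‖Z‖ :=
  (exists_lr X Z).choose_spec.1

theorem treeSynth_hsMul (X Z : TreeOp T) (g : TreeHS T) :
    treeSynth T (hsMul X Z g) = X * treeSynth T g * Z :=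
  (exists_lr X Z).choose_spec.2 g

theorem exists_hsStar (g : TreeHS T) : ∃ g', treeSynth T g' = (treeSynth T g)† :=
  exists_treeSynth_eq (by
    rw [hsSq_adjoint, hsSq_treeSynth]
    finiteness)

/-- The adjoint of a Hilbert-Schmidt operator. -/
noncomputable def hsStar (g : TreeHS T) : TreeHS T := (exists_hsStar g).choose

theorem treeSynth_hsStar (g : TreeHS T) : treeSynth T (hsStar g) = (treeSynth T g)† :=
  (exists_hsStar g).choose_spec

theorem norm_hsStar (g : TreeHS T) : ‖hsStar g‖ = ‖g‖ := by
  have h : ‖hsStar g‖ₑ ^ 2 = ‖g‖ₑ ^ 2 := by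
    rw [← hsSq_treeSynth, treeSynth_hsStar, hsSq_adjoint, hsSq_treeSynth]
  have h' : ‖hsStar g‖ₑ = ‖g‖ₑ := le_antisymm
    ((ENNReal.pow_le_pow_left_iff two_ne_zero).mp h.le)
    ((ENNReal.pow_le_pow_left_iff two_ne_zero).mp h.ge)
  simpa using congrArg ENNReal.toReal h'

/-- The adjoint is an antilinear isometry for the Hilbert-Schmidt norm, so polarization applies. -/
theorem inner_hsStar (f g : TreeHS T) : ⟪hsStar f, hsStar g⟫_ℂ = ⟪g, f⟫_ℂ := by
  have hadd : ∀ (a : ℂ) (f g : TreeHS T),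
      hsStar f + a • hsStar g = hsStar (f + (starRingEnd ℂ) a • g) := fun a f g =>
    treeSynth_injective (by
      simp only [treeSynth_hsStar, map_add, map_smul, map_smulₛₗ, Complex.conj_conj])
  have key : ∀ (a : ℂ) (f g : TreeHS T),
      ‖hsStar f + a • hsStar g‖ = ‖f + (starRingEnd ℂ) a • g‖ := fun a f g => by
    rw [hadd, norm_hsStar]
  have h1 := key 1 f g
  have h2 := key (-1) f g
  have h3 := key Complex.I f g
  have h4 := key (-Complex.I) f g
  simp only [one_smul, map_one, map_neg, neg_smul, Complex.conj_I, neg_neg,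
    ← sub_eq_add_neg] at h1 h2 h3 h4
  rw [← inner_conj_symm g f, inner_eq_sum_norm_sq_div_four, inner_eq_sum_norm_sq_div_four f g]
  simp only [RCLike.I_to_complex, h1, h2, h3, h4]
  simp only [map_div₀, map_add, map_sub, map_mul, map_pow, map_ofNat, Complex.conj_I,
    Complex.conj_ofReal, Complex.coe_algebraMap]
  ring

theorem inner_hsMul_left (X : TreeOp T) (f g : TreeHS T) :
    ⟪hsMul X 1 f, g⟫_ℂ = ⟪f, hsMul (X†) 1 g⟫_ℂ := by
  rw [lp.inner_eq_tsum, lp.inner_eq_tsum]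
  refine tsum_congr fun t => ?_
  rw [← treeSynth_basis, ← treeSynth_basis g, ← treeSynth_basis f,
    ← treeSynth_basis (hsMul (X†) 1 g), treeSynth_hsMul, treeSynth_hsMul, mul_one, mul_one]
  exact (ContinuousLinearMap.adjoint_inner_right X _ _).symm

theorem hsStar_hsStar (g : TreeHS T) : hsStar (hsStar g) = g :=
  treeSynth_injective (by
    simp only [treeSynth_hsStar, ContinuousLinearMap.adjoint_adjoint])

/-- Left multiplication acts column by column, where the claim is clear; right multiplication is
left multiplication conjugated by `hsStar`. -/
theorem adjoint_hsMul (X Z : TreeOp T) : ((hsMul X Z)†) = hsMul (X†) (Z†) := by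
  symm
  rw [ContinuousLinearMap.eq_adjoint_iff]
  intro f g
  have h : ∀ g : TreeHS T, ⟪hsMul 1 (Z†) f, g⟫_ℂ = ⟪f, hsMul 1 Z g⟫_ℂ := fun g => by
    have h1 : ∀ (Z : TreeOp T) (g : TreeHS T),
        hsMul 1 Z g = hsStar (hsMul (Z†) 1 (hsStar g)) := fun Z g =>
      treeSynth_injective (by
        simp only [treeSynth_hsMul, treeSynth_hsStar, mul_one, one_mul, treeOp_adjoint_mul,
          ContinuousLinearMap.adjoint_adjoint])
    rw [h1, h1, ← hsStar_hsStar g, inner_hsStar, hsStar_hsStar,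
      ContinuousLinearMap.adjoint_adjoint]
    conv_rhs => rw [← hsStar_hsStar f, inner_hsStar]
    rw [inner_hsMul_left, ContinuousLinearMap.adjoint_adjoint]
  have h2 : ∀ X Z : TreeOp T, ∀ g, hsMul X Z g = hsMul X 1 (hsMul 1 Z g) := fun X Z g =>
    treeSynth_injective (by simp only [treeSynth_hsMul, mul_one, one_mul, mul_assoc])
  have h3 : hsMul X Z g = hsMul 1 Z (hsMul X 1 g) :=
    treeSynth_injective (by simp only [treeSynth_hsMul, mul_one, one_mul])
  rw [h2, inner_hsMul_left, ContinuousLinearMap.adjoint_adjoint, h, h3]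

/-- The matrix unit `χ_t ⊗ χ_s*` as a Hilbert-Schmidt operator. -/
noncomputable def hsUnit (t s : T) : TreeHS T :=
  open scoped Classical in lp.single 2 s (treeBasis t)

theorem inner_hsUnit_left (t s : T) (g : TreeHS T) :
    ⟪hsUnit t s, g⟫_ℂ = treeSynth T g (treeBasis s) t := by
  classical
  rw [hsUnit, lp.inner_single_left, inner_treeBasis_left, treeSynth_basis]

theorem treeSynth_hsUnit (t s : T) : treeSynth T (hsUnit t s) (treeBasis s) = treeBasis t := by
  classical
  rw [treeSynth_basis, hsUnit, lp.single_apply_self]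

theorem treeSynth_hsUnit_of_ne (t : T) {s r : T} (h : r ≠ s) :
    treeSynth T (hsUnit t s) (treeBasis r) = 0 := by
  classical
  rw [treeSynth_basis, hsUnit, lp.single_apply_ne _ _ _ h]

end HilbertSchmidt

/-! ### The spaces 𝐇₂(T) and 𝒞₂ inside the Hilbert-Schmidt operators -/

namespace MultiscaleTree

variable {q : ℕ} {T : Type*} {M : MultiscaleTree q T}

theorem isDeg_hsUnit {n : ℤ} {t s : T} (h : M.level t = M.level s + n) :
    M.IsDeg n (treeSynth T (hsUnit t s)) := fun r r' hr => by
  by_cases hrs : r = s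
  · subst hrs
    rw [treeSynth_hsUnit]
    refine treeBasis_of_ne ?_
    rintro rfl
    exact hr h
  · rw [treeSynth_hsUnit_of_ne t hrs]
    rfl

/-- The columns of the causal Hilbert-Schmidt operators as a bounded operator. -/
noncomputable def colH (M : MultiscaleTree q T) : M.H2 →L[ℂ] TreeHS T :=
  (H2.columns (M := M)).toContinuousLinearMap

/-- The inclusion of `𝒞₂` as a bounded operator. -/
noncomputable def inclC (M : MultiscaleTree q T) : M.C2 →L[ℂ] M.H2 :=
  (C2.incl M).toContinuousLinearMap

/-- The columns of the elements of `𝒞₂` as a bounded operator. -/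
noncomputable def colC (M : MultiscaleTree q T) : M.C2 →L[ℂ] TreeHS T := M.colH ∘L M.inclC

theorem treeSynth_colH (F : M.H2) : treeSynth T (M.colH F) = M.opH F := rfl

theorem treeSynth_colC (k : M.C2) : treeSynth T (M.colC k) = M.opC k := rfl

theorem norm_colC_apply (k : M.C2) : ‖M.colC k‖ = ‖k‖ :=
  ((H2.columns (M := M)).norm_map _).trans ((C2.incl M).norm_map k)

theorem inner_colC (k k' : M.C2) : ⟪M.colC k, M.colC k'⟫_ℂ = ⟪k, k'⟫_ℂ :=
  ((H2.columns (M := M)).inner_map_map _ _).trans ((C2.incl M).inner_map_map k k')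

theorem inner_colH (F G : M.H2) : ⟪M.colH F, M.colH G⟫_ℂ = ⟪F, G⟫_ℂ :=
  (H2.columns (M := M)).inner_map_map F G

theorem norm_colC_le : ‖M.colC‖ ≤ 1 :=
  ContinuousLinearMap.opNorm_le_bound _ zero_le_one fun k => by rw [norm_colC_apply, one_mul]

theorem opC_injective {k k' : M.C2} (h : M.opC k = M.opC k') : k = k' :=
  (C2.incl M).injective (H2.op_injective h)

theorem isDeg_opC (k : M.C2) : M.IsDeg 0 (M.opC k) := by
  rw [← isConst_iff]
  have h : C2.incl M k ∈ Set.range (C2.incl M) := ⟨k, rfl⟩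
  rw [C2.range_incl] at h
  exact h

theorem exists_colH_eq {g : TreeHS T} (h : M.IsCausal (treeSynth T g)) :
    ∃ F : M.H2, M.colH F = g := ⟨⟨g, h⟩, rfl⟩

theorem exists_colC_eq {g : TreeHS T} (h : M.IsDeg 0 (treeSynth T g)) :
    ∃ k : M.C2, M.colC k = g := by
  obtain ⟨F, hF⟩ := exists_colH_eq (h.isCausal le_rfl)
  have hmem : F ∈ {k | M.IsConst (H2.op k)} := by
    change M.IsConst (treeSynth T (M.colH F))
    rw [hF, isConst_iff]
    exact h
  rw [← C2.range_incl] at hmem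
  obtain ⟨k, rfl⟩ := hmem
  exact ⟨k, hF⟩

/-- The adjoint of an isometric inclusion is the orthogonal projection. Its entries are inner
products with matrix units, which lie in 𝒞₂ when both nodes have the same level. -/
theorem opC_adjoint_colC (g : TreeHS T) : M.opC ((M.colC†) g) = M.degPart 0 (treeSynth T g) := by
  refine treeOp_ext fun s t => ?_
  rw [degPart_entry]
  split_ifs with h
  · obtain ⟨u, hu⟩ := exists_colC_eq (isDeg_hsUnit h)
    rw [← treeSynth_colC, ← inner_hsUnit_left, ← inner_hsUnit_left, ← hu, inner_colC,
      ContinuousLinearMap.adjoint_inner_right]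
  · exact isDeg_opC _ s t h

theorem opC_adjoint_inclC (F : M.H2) : M.opC ((M.inclC†) F) = M.degPart 0 (M.opH F) := by
  have h : (M.inclC†) F = (M.colC†) (M.colH F) := by
    refine ext_inner_left ℂ fun k => ?_
    rw [ContinuousLinearMap.adjoint_inner_right, ContinuousLinearMap.adjoint_inner_right,
      ← inner_colH]
    rfl
  rw [h, opC_adjoint_colC, treeSynth_colH]

theorem opH_adjoint_colH_entry (g : TreeHS T) {s t : T} (h : M.level s ≤ M.level t) :
    M.opH ((M.colH†) g) (treeBasis s) t = treeSynth T g (treeBasis s) t := by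
  have hdeg : M.IsDeg (M.level t - M.level s) (treeSynth T (hsUnit t s)) :=
    isDeg_hsUnit (by omega)
  obtain ⟨u, hu⟩ := exists_colH_eq (hdeg.isCausal (by omega))
  rw [← treeSynth_colH, ← inner_hsUnit_left, ← inner_hsUnit_left, ← hu, inner_colH,
    ContinuousLinearMap.adjoint_inner_right]

theorem opH_adjoint_colH {g : TreeHS T} (h : M.IsCausal (treeSynth T g)) :
    M.opH ((M.colH†) g) = treeSynth T g := by
  refine treeOp_ext fun s t => ?_
  rcases le_or_gt (M.level s) (M.level t) with hst | hst
  · exact opH_adjoint_colH_entry g hst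
  · rw [isCausal_iff.mp (H2.op_causal _) s t hst, isCausal_iff.mp h s t hst]

/-- The compression `k ↦ X k Z` to `𝒞₂`. -/
noncomputable def mulC (M : MultiscaleTree q T) (X Z : TreeOp T) : M.C2 →L[ℂ] M.C2 :=
  (M.colC†) ∘L hsMul X Z ∘L M.colC

/-- Opposite degrees cancel, so the product is already a constant and the compression loses nothing.
Defining `mulC` as a compression makes its adjoint and norm immediate. -/
theorem opC_mulC {m : ℤ} {X Z : TreeOp T} (hX : M.IsDeg m X) (hZ : M.IsDeg (-m) Z) (k : M.C2) :
    M.opC (M.mulC X Z k) = X * M.opC k * Z := by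
  change M.opC ((M.colC†) (hsMul X Z (M.colC k))) = _
  rw [opC_adjoint_colC, treeSynth_hsMul, treeSynth_colC]
  refine IsDeg.degPart_self ?_
  have h := (hX.mul (isDeg_opC k)).mul hZ
  simpa using h

theorem opC_mulC_const {X : TreeOp T} (hX : M.IsDeg 0 X) (k : M.C2) :
    M.opC (M.mulC X 1 k) = X * M.opC k := by
  rw [opC_mulC hX (by simpa using isDeg_one), mul_one]

theorem adjoint_mulC (X Z : TreeOp T) : ((M.mulC X Z)†) = M.mulC (X†) (Z†) := by
  rw [mulC, mulC, ContinuousLinearMap.adjoint_comp, ContinuousLinearMap.adjoint_comp,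
    ContinuousLinearMap.adjoint_adjoint, adjoint_hsMul]
  rfl

theorem norm_mulC_le (X Z : TreeOp T) : ‖M.mulC X Z‖ ≤ ‖X‖ * ‖Z‖ := by
  have h1 : ‖M.colC†‖ ≤ 1 := by
    rw [LinearIsometryEquiv.norm_map]
    exact norm_colC_le
  calc ‖M.mulC X Z‖ ≤ ‖M.colC†‖ * (‖hsMul X Z‖ * ‖M.colC‖) :=
        (ContinuousLinearMap.opNorm_comp_le _ _).trans
          (mul_le_mul_of_nonneg_left (ContinuousLinearMap.opNorm_comp_le _ _) (norm_nonneg _))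
    _ ≤ 1 * ((‖X‖ * ‖Z‖) * 1) := by
        gcongr
        · exact norm_hsMul_le X Z
        · exact norm_colC_le
    _ = ‖X‖ * ‖Z‖ := by ring

theorem mulC_pow {m : ℤ} {X Z : TreeOp T} (hX : M.IsDeg m X) (hZ : M.IsDeg (-m) Z) (n : ℕ) :
    M.mulC X Z ^ n = M.mulC (X ^ n) (Z ^ n) := by
  have hX' := fun n => hX.pow n
  have hZ' : ∀ n : ℕ, M.IsDeg (-(n * m)) (Z ^ n) := fun n => by
    rw [← mul_neg]
    exact hZ.pow n
  induction n with
  | zero =>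
    ext1 k
    refine opC_injective ?_
    rw [opC_mulC (hX' 0) (hZ' 0)]
    simp
  | succ n ih =>
    ext1 k
    refine opC_injective ?_
    rw [pow_succ', ih, opC_mulC (hX' _) (hZ' _), mul_apply_eq_comp,
      opC_mulC hX hZ, opC_mulC (hX' _) (hZ' _), pow_succ' X, pow_succ Z]
    simp only [mul_assoc]

/-- The matrix unit `χ_t ⊗ χ_s*` of two nodes of the same level. -/
noncomputable def unitC (M : MultiscaleTree q T) (t s : T) : M.C2 :=
  (M.colC†) (hsUnit t s)

theorem colC_unitC {t s : T} (h : M.level t = M.level s) : M.colC (M.unitC t s) = hsUnit t s := by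
  refine treeSynth_injective ?_
  rw [treeSynth_colC, unitC, opC_adjoint_colC]
  exact (isDeg_hsUnit (by simpa using h)).degPart_self

theorem opC_unitC_basis {t s : T} (h : M.level t = M.level s) :
    M.opC (M.unitC t s) (treeBasis s) = treeBasis t := by
  rw [← treeSynth_colC, colC_unitC h, treeSynth_hsUnit]

theorem opC_unitC_basis_of_ne {t s r : T} (h : M.level t = M.level s) (hr : r ≠ s) :
    M.opC (M.unitC t s) (treeBasis r) = 0 := by
  rw [← treeSynth_colC, colC_unitC h, treeSynth_hsUnit_of_ne t hr]

theorem inner_unitC_left {t s : T} (h : M.level t = M.level s) (k : M.C2) :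
    ⟪M.unitC t s, k⟫_ℂ = M.opC k (treeBasis s) t := by
  rw [← inner_colC, colC_unitC h, inner_hsUnit_left, treeSynth_colC]

/-- Bounded operators on `𝒞₂` which agree on the matrix units are equal. -/
theorem clm_ext_unitC {E : Type*} [NormedAddCommGroup E] [NormedSpace ℂ E]
    {φ ψ : M.C2 →L[ℂ] E}
    (h : ∀ t s, M.level t = M.level s → φ (M.unitC t s) = ψ (M.unitC t s)) : φ = ψ := by
  let U : Set M.C2 := {u | ∃ t s, M.level t = M.level s ∧ u = M.unitC t s}
  have hU : Dense (Submodule.span ℂ U : Set M.C2) := by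
    rw [Submodule.dense_iff_topologicalClosure_eq_top,
      Submodule.topologicalClosure_eq_top_iff, Submodule.eq_bot_iff]
    intro k hk
    refine opC_injective (treeOp_ext fun s t => ?_)
    by_cases hst : M.level t = M.level s
    · rw [← inner_unitC_left hst]
      have h0 := (Submodule.mem_orthogonal _ k).mp hk (M.unitC t s)
        (Submodule.subset_span ⟨t, s, hst, rfl⟩)
      rw [h0, ← inner_unitC_left hst, inner_zero_right]
    · rw [isDeg_opC k s t (by simpa using hst), isDeg_opC 0 s t (by simpa using hst)]
  refine ContinuousLinearMap.ext_on hU ?_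
  rintro _ ⟨t, s, hst, rfl⟩
  exact h t s hst

end MultiscaleTree

/-! ## Row operators and operator matrices -/

section Blocks

variable {H K E : Type*} [NormedAddCommGroup H] [InnerProductSpace ℂ H]
  [NormedAddCommGroup K] [InnerProductSpace ℂ K] [NormedAddCommGroup E] [InnerProductSpace ℂ E]

/-- The operator row `(U W)`. -/
noncomputable def rowOp (U : H →L[ℂ] E) (W : K →L[ℂ] E) : WithLp 2 (H × K) →L[ℂ] E :=
  U ∘L WithLp.fstL 2 ℂ H K + W ∘L WithLp.sndL 2 ℂ H K

theorem rowOp_apply (U : H →L[ℂ] E) (W : K →L[ℂ] E) (x : WithLp 2 (H × K)) :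
    rowOp U W x = U x.fst + W x.snd := rfl

theorem rowOp_comp_blockOp (U : H →L[ℂ] E) (W : K →L[ℂ] E) (A : H →L[ℂ] H) (B : K →L[ℂ] H)
    (C : H →L[ℂ] K) (D : K →L[ℂ] K) :
    rowOp U W ∘L blockOp A B C D = rowOp (U ∘L A + W ∘L C) (U ∘L B + W ∘L D) := by
  ext1 x
  change U (A x.fst + B x.snd) + W (C x.fst + D x.snd) =
    U (A x.fst) + W (C x.fst) + (U (B x.snd) + W (D x.snd))
  rw [map_add, map_add]
  abel

variable [CompleteSpace H] [CompleteSpace K] [CompleteSpace E]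

theorem adjoint_rowOp_apply (U : H →L[ℂ] E) (W : K →L[ℂ] E) (y : E) :
    ((rowOp U W)†) y = WithLp.toLp 2 ((U†) y, (W†) y) := by
  refine ext_inner_left ℂ fun x => ?_
  rw [ContinuousLinearMap.adjoint_inner_right, rowOp_apply, inner_add_left,
    WithLp.prod_inner_apply]
  change _ = ⟪x.fst, (U†) y⟫_ℂ + ⟪x.snd, (W†) y⟫_ℂ
  rw [ContinuousLinearMap.adjoint_inner_right, ContinuousLinearMap.adjoint_inner_right]

theorem rowOp_comp_adjoint (U U' : H →L[ℂ] E) (W W' : K →L[ℂ] E) :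
    rowOp U W ∘L ((rowOp U' W')†) = U ∘L (U'†) + W ∘L (W'†) := by
  ext1 y
  rw [ContinuousLinearMap.comp_apply, adjoint_rowOp_apply, rowOp_apply]
  rfl

end Blocks

/-! ### Colligations: contractivity, the row identity and the module property -/

namespace MultiscaleTree

variable {q : ℕ} {T : Type*} {M : MultiscaleTree q T}

theorem norm_adjoint_le_one {R : TreeOp T} (hR : R * R† = 1) : ‖R†‖ ≤ 1 := by
  refine ContinuousLinearMap.opNorm_le_bound _ zero_le_one fun f => ?_
  have h1 : ‖(R†) f‖ ^ 2 = ‖f‖ ^ 2 := by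
    rw [← inner_self_eq_norm_sq (𝕜 := ℂ), ContinuousLinearMap.adjoint_inner_left,
      ← mul_apply_eq_comp, hR, one_apply_eq_self, inner_self_eq_norm_sq]
  rw [one_mul]
  exact ((pow_left_inj₀ (norm_nonneg _) (norm_nonneg _) two_ne_zero).mp h1).le

theorem norm_α_adjoint_mul_le (j : Fin q) : ‖(M.α j)† * M.α j‖ ≤ 1 := by
  have h : ‖(M.α j)†‖ ≤ 1 := norm_adjoint_le_one (α_mul_adjoint j)
  have h' : ‖M.α j‖ ≤ 1 := by rwa [LinearIsometryEquiv.norm_map] at h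
  calc ‖(M.α j)† * M.α j‖ ≤ ‖(M.α j)†‖ * ‖M.α j‖ := norm_mul_le _ _
    _ ≤ 1 * 1 := by gcongr
    _ = 1 := one_mul 1

theorem isConst_conj_α_pow (j : Fin q) (n : ℕ) {c : TreeOp T} (hc : M.IsConst c) :
    M.IsConst ((M.α j ^ n)† * c * M.α j ^ n) := by
  rw [isConst_iff] at hc ⊢
  have h := ((isDeg_α_pow_adjoint (M := M) j n).mul hc).mul (isDeg_α_pow j n)
  simpa using h

variable {H : Type*} [NormedAddCommGroup H] [InnerProductSpace ℂ H] [CompleteSpace H]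

/-- The operator matrix `(A B; C D)` on `H ⊕ 𝒞₂` intertwines the actions of constants, and its
adjoint is isometric on the range of the right multiplication by `α_j* α_j`. -/
structure IsColligation (M : MultiscaleTree q T) (ι : H →ₗ[ℂ] M.H2) (j : Fin q)
    (A : H →L[ℂ] H) (B : M.C2 →L[ℂ] H) (C : H →L[ℂ] M.C2) (D : M.C2 →L[ℂ] M.C2) : Prop where
  inv : M.IsRightInvariant ι
  hA : ∀ (F Fc : H) (c : TreeOp T), M.IsConst c → M.opH (ι Fc) = M.opH (ι F) * c →
      M.opH (ι (A Fc)) = M.opH (ι (A F)) * ((M.α j)† * c * M.α j)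
  hB : ∀ (d dc : M.C2) (c : TreeOp T), M.IsConst c → M.opC dc = M.opC d * c →
      M.opH (ι (B dc)) = M.opH (ι (B d)) * ((M.α j)† * c * M.α j)
  hC : ∀ (F Fc : H) (c : TreeOp T), M.IsConst c → M.opH (ι Fc) = M.opH (ι F) * c →
      M.opC (C Fc) = M.opC (C F) * c
  hD : ∀ (d dc : M.C2) (c : TreeOp T), M.IsConst c → M.opC dc = M.opC d * c →
      M.opC (D dc) = M.opC (D d) * c
  hV : ∀ x : WithLp 2 (H × M.C2),
      M.opH (ι ((blockOp A B C D (((blockOp A B C D)†) x)).fst)) =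
        M.opH (ι x.fst) * ((M.α j)† * M.α j) ∧
      (blockOp A B C D (((blockOp A B C D)†) x)).snd = x.snd

/-- The Markov parameters `D, C B, C A B, C A² B, …`. -/
noncomputable def markov {M : MultiscaleTree q T} (A : H →L[ℂ] H) (B : M.C2 →L[ℂ] H)
    (C : H →L[ℂ] M.C2) (D : M.C2 →L[ℂ] M.C2) : ℕ → M.C2 →L[ℂ] M.C2
  | 0 => D
  | n + 1 => C ∘L (A ^ n) ∘L B

namespace IsColligation

variable {ι : H →ₗ[ℂ] M.H2} {j : Fin q} {A : H →L[ℂ] H} {B : M.C2 →L[ℂ] H} {C : H →L[ℂ] M.C2}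
  {D : M.C2 →L[ℂ] M.C2}

/-- ‖V* (F, e)‖² = ⟪F α* α, F⟫ + ‖e‖², and right invariance bounds ‖F α* α‖ by ‖F‖ because ‖α* α‖ ≤
1. -/
theorem norm_blockOp_le (h : M.IsColligation ι j A B C D) : ‖blockOp A B C D‖ ≤ 1 := by
  rw [← LinearIsometryEquiv.norm_map ContinuousLinearMap.adjoint]
  refine ContinuousLinearMap.opNorm_le_bound _ zero_le_one fun x => ?_
  rw [one_mul]
  refine abs_le_of_sq_le_sq' ?_ (norm_nonneg _) |>.2
  have hα : M.IsConst ((M.α j)† * M.α j) := by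
    rw [isConst_iff]
    have h1 := (isDeg_α_adjoint (M := M) j).mul (isDeg_α j)
    simpa using h1
  obtain ⟨h1, h2⟩ := h.hV x
  have h3 := h.inv.norm_le _ _ _ hα h1
  have h4 : ‖(blockOp A B C D (((blockOp A B C D)†) x)).fst‖ ≤ ‖x.fst‖ :=
    h3.trans (mul_le_of_le_one_right (norm_nonneg _) (norm_α_adjoint_mul_le j))
  rw [← inner_self_eq_norm_sq (𝕜 := ℂ), ContinuousLinearMap.adjoint_inner_right,
    WithLp.prod_inner_apply, map_add, WithLp.prod_norm_sq_eq_of_L2]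
  change RCLike.re ⟪(blockOp A B C D (((blockOp A B C D)†) x)).fst, x.fst⟫_ℂ +
    RCLike.re ⟪(blockOp A B C D (((blockOp A B C D)†) x)).snd, x.snd⟫_ℂ ≤ _
  rw [h2, inner_self_eq_norm_sq]
  refine add_le_add ((re_inner_le_norm _ _).trans ?_) le_rfl
  rw [sq]
  gcongr

theorem energy (h : M.IsColligation ι j A B C D) (F : H) (k : M.C2) :
    ‖A F + B k‖ ^ 2 + ‖C F + D k‖ ^ 2 ≤ ‖F‖ ^ 2 + ‖k‖ ^ 2 := by
  have h1 := (blockOp A B C D).le_of_opNorm_le h.norm_blockOp_le (WithLp.toLp 2 (F, k))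
  rw [one_mul] at h1
  have h2 := pow_le_pow_left₀ (norm_nonneg _) h1 2
  rwa [WithLp.prod_norm_sq_eq_of_L2, WithLp.prod_norm_sq_eq_of_L2] at h2

theorem norm_A_le (h : M.IsColligation ι j A B C D) : ‖A‖ ≤ 1 := by
  refine ContinuousLinearMap.opNorm_le_bound _ zero_le_one fun F => ?_
  have h1 := h.energy F 0
  rw [map_zero, map_zero, add_zero, add_zero, norm_zero] at h1
  rw [one_mul]
  refine abs_le_of_sq_le_sq' ?_ (norm_nonneg _) |>.2
  nlinarith [sq_nonneg ‖C F‖]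

/-- The left side is (U W) V V* (U' W')*. Only `U` is applied to the component altered by V V*, so
only `U` has to be insensitive to right multiplication by α* α. -/
theorem row_identity {E : Type*} [NormedAddCommGroup E] [InnerProductSpace ℂ E] [CompleteSpace E]
    (h : M.IsColligation ι j A B C D) {U U' : H →L[ℂ] E} {W W' : M.C2 →L[ℂ] E}
    (hU : ∀ F F' : H, M.opH (ι F') = M.opH (ι F) * ((M.α j)† * M.α j) → U F' = U F) :
    (U ∘L A + W ∘L C) ∘L ((U' ∘L A + W' ∘L C)†) +
      (U ∘L B + W ∘L D) ∘L ((U' ∘L B + W' ∘L D)†) = U ∘L (U'†) + W ∘L (W'†) := by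
  rw [← rowOp_comp_adjoint, ← rowOp_comp_adjoint, ← rowOp_comp_blockOp, ← rowOp_comp_blockOp,
    ContinuousLinearMap.adjoint_comp]
  ext1 y
  obtain ⟨h1, h2⟩ := h.hV (((rowOp U' W')†) y)
  change rowOp U W (blockOp A B C D (((blockOp A B C D)†) (((rowOp U' W')†) y))) = _
  rw [rowOp_apply, hU _ _ h1, h2]
  rfl

theorem opH_pow (h : M.IsColligation ι j A B C D) {F Fc : H} {c : TreeOp T} (hc : M.IsConst c)
    (hF : M.opH (ι Fc) = M.opH (ι F) * c) (n : ℕ) :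
    M.opH (ι ((A ^ n) Fc)) = M.opH (ι ((A ^ n) F)) * ((M.α j ^ n)† * c * M.α j ^ n) := by
  induction n with
  | zero =>
    have h1 : ((1 : TreeOp T)†) = 1 := ContinuousLinearMap.adjoint_id
    simpa [h1] using hF
  | succ n ih =>
    rw [pow_succ' A, mul_apply_eq_comp, mul_apply_eq_comp,
      h.hA _ _ _ (isConst_conj_α_pow j n hc) ih, pow_succ (M.α j), treeOp_adjoint_mul]
    simp only [mul_assoc]

theorem opC_pow (h : M.IsColligation ι j A B C D) {F Fc : H} {c : TreeOp T} (hc : M.IsConst c)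
    (hF : M.opH (ι Fc) = M.opH (ι F) * c) (n : ℕ) :
    M.opC (C ((A ^ n) Fc)) = M.opC (C ((A ^ n) F)) * ((M.α j ^ n)† * c * M.α j ^ n) :=
  h.hC _ _ _ (isConst_conj_α_pow j n hc) (h.opH_pow hc hF n)

theorem opC_markov_mul (h : M.IsColligation ι j A B C D) {d dc : M.C2} {c : TreeOp T}
    (hc : M.IsConst c) (hd : M.opC dc = M.opC d * c) (n : ℕ) :
    M.opC (markov A B C D n dc) =
      M.opC (markov A B C D n d) * ((M.α j ^ n)† * c * M.α j ^ n) := by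
  cases n with
  | zero =>
    have h1 : ((1 : TreeOp T)†) = 1 := ContinuousLinearMap.adjoint_id
    simpa [h1, markov] using h.hD d dc c hc hd
  | succ n =>
    have hc1 : M.IsConst ((M.α j)† * c * M.α j) := by
      simpa using isConst_conj_α_pow (M := M) j 1 hc
    have h1 := h.opC_pow hc1 (h.hB d dc c hc hd) n
    change M.opC (C ((A ^ n) (B dc))) = M.opC (C ((A ^ n) (B d))) * _
    rw [h1, pow_succ' (M.α j), treeOp_adjoint_mul]
    simp only [mul_assoc]

end IsColligation

/-! ## The transfer operator of a colligation -/

theorem isDeg_opC_mul_adjoint (k : M.C2) (j : Fin q) (n : ℕ) :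
    M.IsDeg n (M.opC k * (M.α j ^ n)†) := by
  simpa using (isDeg_opC k).mul (isDeg_α_pow_adjoint j n)

theorem α_adjoint_basis (j : Fin q) (s : T) :
    ((M.α j)†) (treeBasis s) = treeBasis (M.shift j s) := by
  refine treeL2_ext fun t => ?_
  rw [treeOp_adjoint_entry, α_basis_apply]
  by_cases h : M.shift j s = t
  · rw [h, treeBasis_self, map_one]
  · rw [treeBasis_of_ne h, treeBasis_of_ne (Ne.symm h), map_zero]

theorem α_pow_adjoint_basis (j : Fin q) (n : ℕ) (s : T) :
    ((M.α j ^ n)†) (treeBasis s) = treeBasis ((M.shift j)^[n] s) := by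
  induction n generalizing s with
  | zero =>
    have h1 : ((1 : TreeOp T)†) = 1 := ContinuousLinearMap.adjoint_id
    rw [pow_zero, h1]
    rfl
  | succ n ih =>
    rw [pow_succ', treeOp_adjoint_mul, mul_apply_eq_comp, α_adjoint_basis, ih,
      Function.iterate_succ_apply]

theorem level_iterate_shift (j : Fin q) (n : ℕ) (s : T) :
    M.level ((M.shift j)^[n] s) = M.level s + n := by
  induction n with
  | zero => simp
  | succ n ih =>
    rw [Function.iterate_succ_apply', level_shift, ih]
    push_cast
    ring

theorem exists_level_le (M : MultiscaleTree q T) (I : Finset T) :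
    ∃ v, ∀ s ∈ I, M.level v ≤ M.level s := by
  classical
  obtain ⟨v₀⟩ := M.isTree.1.nonempty
  induction I using Finset.induction_on with
  | empty => exact ⟨v₀, by simp⟩
  | insert s I _ ih =>
    obtain ⟨v, hv⟩ := ih
    rcases le_total (M.level v) (M.level s) with h | h
    · refine ⟨v, fun r hr => ?_⟩
      rcases Finset.mem_insert.mp hr with rfl | hr
      · exact h
      · exact hv r hr
    · refine ⟨s, fun r hr => ?_⟩
      rcases Finset.mem_insert.mp hr with rfl | hr
      · exact le_rfl
      · exact h.trans (hv r hr)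

theorem norm_opC_basis_le (k : M.C2) (v : T) : ‖M.opC k (treeBasis v)‖ ≤ ‖k‖ := by
  rw [← treeSynth_colC, treeSynth_basis, ← norm_colC_apply k]
  exact lp.norm_apply_le_norm two_ne_zero _ _

/-- The sum is the rank one operator whose only nonzero column, at `v`, is the vector ∑ f(s) χ_s. -/
theorem norm_sq_sum_unitC_le {I : Finset T} {v : T} {p : T → Prop} [DecidablePred p] (f : T → ℂ)
    (hp : ∀ s ∈ I, p s → M.level s = M.level v) :
    ‖∑ s ∈ I, if p s then f s • M.unitC s v else 0‖ ^ 2 ≤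
      ∑ s ∈ I, if p s then ‖f s‖ ^ 2 else 0 := by
  classical
  rw [← Finset.sum_filter, ← Finset.sum_filter, ← norm_colC_apply, map_sum]
  have h : ∑ s ∈ I with p s, M.colC (f s • M.unitC s v) =
      lp.single 2 v (∑ s ∈ I with p s, f s • treeBasis s) := by
    refine treeSynth_injective ?_
    rw [map_sum]
    refine treeOp_ext fun r t => ?_
    rw [treeSynth_basis]
    by_cases hr : r = v
    · subst hr
      rw [lp.single_apply_self, sum_apply]
      refine congrArg (fun z : TreeL2 T => z t) (Finset.sum_congr rfl fun s hs => ?_)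
      have hs' := Finset.mem_filter.mp hs
      rw [map_smul, map_smul, colC_unitC (hp s hs'.1 hs'.2)]
      exact congrArg (f s • ·) (treeSynth_hsUnit s r)
    · rw [lp.single_apply_ne _ _ _ hr, sum_apply, Finset.sum_eq_zero]
      intro s hs
      have hs' := Finset.mem_filter.mp hs
      rw [map_smul, map_smul, colC_unitC (hp s hs'.1 hs'.2)]
      change f s • treeSynth T (hsUnit s v) (treeBasis r) = 0
      rw [treeSynth_hsUnit_of_ne s hr, smul_zero]
  rw [h, lp.norm_single (by simp), treeL2_norm_sq_sum_basis]

namespace IsColligation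

variable {ι : H →ₗ[ℂ] M.H2} {j : Fin q} {A : H →L[ℂ] H} {B : M.C2 →L[ℂ] H} {C : H →L[ℂ] M.C2}
  {D : M.C2 →L[ℂ] M.C2}

/-- Right multiplication by χ_r ⊗ χ_s* carries χ_r ⊗ χ_r* to χ_r ⊗ χ_s*, and αⁿ αⁿ* = 1 removes the
conjugation in the module property. Thus the response to a matrix unit does not depend on its
column, which may be placed anywhere on the same level. -/
theorem out_unitC (h : M.IsColligation ι j A B C D) {r s : T} (hrs : M.level r = M.level s)
    (n : ℕ) :
    M.opC (markov A B C D n (M.unitC r s)) * (M.α j ^ n)† =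
      M.opC (markov A B C D n (M.unitC r r)) * (M.α j ^ n)† * M.opC (M.unitC r s) := by
  have hc : M.opC (M.unitC r s) = M.opC (M.unitC r r) * M.opC (M.unitC r s) := by
    refine treeOp_ext fun t t' => ?_
    rw [mul_apply_eq_comp]
    by_cases ht : t = s
    · rw [ht, opC_unitC_basis hrs, opC_unitC_basis rfl]
    · rw [opC_unitC_basis_of_ne hrs ht, map_zero]
  rw [h.opC_markov_mul (isConst_iff.mpr (isDeg_opC _)) hc n]
  simp only [mul_assoc, α_pow_mul_adjoint, mul_one]

/-- The energy balance of the system `x ↦ A x + B u`, `y = C x + D u` started at `0`. -/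
theorem sum_norm_sq_output_le (h : M.IsColligation ι j A B C D) (u : ℕ → M.C2) (N : ℕ) :
    ∑ k ∈ Finset.range N, ‖∑ i ∈ Finset.range (k + 1), markov A B C D (k - i) (u i)‖ ^ 2 ≤
      ∑ k ∈ Finset.range N, ‖u k‖ ^ 2 := by
  let x : ℕ → H := fun n => Nat.rec 0 (fun k xk => A xk + B (u k)) n
  have hx : ∀ k, x (k + 1) = A (x k) + B (u k) := fun _ => rfl
  -- The exponent `n` stays free because the induction trades one unit of time for one more power of
  -- `A`.
  have hout : ∀ k n, C ((A ^ n) (x k)) =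
      ∑ i ∈ Finset.range k, markov A B C D (k - i + n) (u i) := by
    intro k
    induction k with
    | zero =>
      intro n
      change C ((A ^ n) 0) = _
      simp
    | succ k ih =>
      intro n
      rw [hx, map_add, map_add, ← mul_apply_eq_comp, ← pow_succ, ih (n + 1),
        Finset.sum_range_succ]
      congr 1
      · refine Finset.sum_congr rfl fun i hi => ?_
        have := Finset.mem_range.mp hi
        congr 2
        omega
      · rw [show k + 1 - k + n = n + 1 by omega]
        rfl
  have hy : ∀ k, ∑ i ∈ Finset.range (k + 1), markov A B C D (k - i) (u i) =
      C (x k) + D (u k) := fun k => by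
    have h1 := hout k 0
    rw [Finset.sum_range_succ, Nat.sub_self]
    rw [pow_zero, one_apply_eq_self] at h1
    rw [h1]
    rfl
  -- The final state is kept on the left so that the energy inequalities of the single steps
  -- telescope.
  have key : ∑ k ∈ Finset.range N, ‖C (x k) + D (u k)‖ ^ 2 + ‖x N‖ ^ 2 ≤
      ∑ k ∈ Finset.range N, ‖u k‖ ^ 2 := by
    induction N with
    | zero =>
      change _ + ‖(0 : H)‖ ^ 2 ≤ _
      simp
    | succ N ih =>
      rw [Finset.sum_range_succ, Finset.sum_range_succ, hx]
      have := h.energy (x N) (u N)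
      linarith
  simp only [hy]
  have := sq_nonneg ‖x N‖
  linarith

/-- The matrix is that of the future transfer operator: the entry (t, s) is read off the response to
χ_s ⊗ χ_s*, after as many steps as `t` lies above `s`. Time in the system is the level above a node
`v` that lies no higher than the support of the input. -/
theorem entries_bound (h : M.IsColligation ι j A B C D) (I J : Finset T) (f : T → ℂ) :
    ∑ t ∈ J, ‖∑ s ∈ I, f s * (if M.level s ≤ M.level t then
      (M.opC (markov A B C D (M.level t - M.level s).toNat (M.unitC s s)) *
        (M.α j ^ (M.level t - M.level s).toNat)†) (treeBasis s) t else 0)‖ ^ 2 ≤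
      1 ^ 2 * ∑ s ∈ I, ‖f s‖ ^ 2 := by
  classical
  obtain ⟨v, hv⟩ := M.exists_level_le I
  let l : T → ℕ := fun s => (M.level s - M.level v).toNat
  let vk : ℕ → T := fun k => (M.shift j)^[k] v
  have hvk : ∀ k, M.level (vk k) = M.level v + k := fun k => level_iterate_shift j k v
  have hl : ∀ s ∈ I, M.level s = M.level v + l s := fun s hs => by
    have := hv s hs
    simp only [l]
    omega
  have hlv : ∀ s ∈ I, ∀ k, l s = k → M.level s = M.level (vk k) := fun s hs k hk => by
    rw [hl s hs, hvk, hk]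
  -- The input at time k is the part of `f` on level k above `v`, written into the column of v α^k.
  -- Placing the columns on one path lets the output column at v α^k collect the contributions of
  -- all earlier inputs.
  let u : ℕ → M.C2 := fun k => ∑ s ∈ I, if l s = k then f s • M.unitC s (vk k) else 0
  let y : ℕ → M.C2 := fun k => ∑ i ∈ Finset.range (k + 1), markov A B C D (k - i) (u i)
  have hout : ∀ i k, i ≤ k → ∀ s ∈ I, l s = i →
      M.opC (markov A B C D (k - i) (M.unitC s (vk i))) (treeBasis (vk k)) =
        (M.opC (markov A B C D (k - i) (M.unitC s s)) * (M.α j ^ (k - i))†) (treeBasis s) := by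
    intro i k hik s hs hi
    have h1 := congrArg (fun R : TreeOp T => R (treeBasis (vk i)))
      (h.out_unitC (hlv s hs i hi) (k - i))
    simp only [mul_apply_eq_comp, opC_unitC_basis (hlv s hs i hi)] at h1
    rw [α_pow_adjoint_basis] at h1
    rw [mul_apply_eq_comp, ← h1]
    simp only [vk, ← Function.iterate_add_apply, Nat.sub_add_cancel hik]
  have hentry : ∀ t ∈ J, ∀ k : ℕ, M.level t = M.level v + k →
      ∑ s ∈ I, f s * (if M.level s ≤ M.level t then
        (M.opC (markov A B C D (M.level t - M.level s).toNat (M.unitC s s)) *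
          (M.α j ^ (M.level t - M.level s).toNat)†) (treeBasis s) t else 0) =
        M.opC (y k) (treeBasis (vk k)) t := by
    intro t _ k hk
    have hyk : M.opC (y k) (treeBasis (vk k)) t = ∑ i ∈ Finset.range (k + 1), ∑ s ∈ I,
        if l s = i then f s * M.opC (markov A B C D (k - i) (M.unitC s (vk i)))
          (treeBasis (vk k)) t else 0 := by
      have htk : M.level t = M.level (vk k) := by rw [hk, hvk]
      simp only [← inner_unitC_left htk, y, u, map_sum, inner_sum]
      refine Finset.sum_congr rfl fun i _ => Finset.sum_congr rfl fun s _ => ?_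
      split_ifs
      · rw [map_smul, inner_smul_right]
      · rw [map_zero, inner_zero_right]
    rw [hyk, Finset.sum_comm]
    refine Finset.sum_congr rfl fun s hs => ?_
    rw [Finset.sum_ite_eq]
    have hls := hl s hs
    by_cases hsk : l s ≤ k
    · rw [if_pos (by omega), if_pos (Finset.mem_range.mpr (by omega)),
        hout (l s) k hsk s hs rfl, show (M.level t - M.level s).toNat = k - l s by omega]
    · rw [if_neg (by omega), if_neg (by simpa using hsk), mul_zero]
  have hneg : ∀ t ∈ J, M.level t < M.level v →
      ∑ s ∈ I, f s * (if M.level s ≤ M.level t then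
        (M.opC (markov A B C D (M.level t - M.level s).toNat (M.unitC s s)) *
          (M.α j ^ (M.level t - M.level s).toNat)†) (treeBasis s) t else 0) = 0 := by
    intro t _ ht
    refine Finset.sum_eq_zero fun s hs => ?_
    have := hv s hs
    rw [if_neg (by omega), mul_zero]
  -- The horizon only has to cover the levels of the outputs in `J`.
  let N := J.sup l + 1
  calc _ ≤ ∑ t ∈ J, ∑ k ∈ Finset.range N,
        if M.level t = M.level v + k then ‖M.opC (y k) (treeBasis (vk k)) t‖ ^ 2 else 0 := by
        refine Finset.sum_le_sum fun t ht => ?_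
        rcases lt_or_ge (M.level t) (M.level v) with hlt | hge
        · rw [hneg t ht hlt, norm_zero, zero_pow two_ne_zero]
          exact Finset.sum_nonneg fun k _ => by split_ifs <;> positivity
        · have hk : M.level t = M.level v + (l t : ℕ) := by
            simp only [l]
            omega
          have hmem : l t ∈ Finset.range N :=
            Finset.mem_range.mpr (Nat.lt_succ_of_le (Finset.le_sup ht))
          rw [hentry t ht (l t) hk]
          refine le_trans (le_of_eq ?_) (Finset.single_le_sum
            (fun k _ => by split_ifs <;> positivity) hmem)
          rw [if_pos hk]
    _ = ∑ k ∈ Finset.range N, ∑ t ∈ J,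
        if M.level t = M.level v + k then ‖M.opC (y k) (treeBasis (vk k)) t‖ ^ 2 else 0 :=
        Finset.sum_comm
    _ ≤ ∑ k ∈ Finset.range N, ‖y k‖ ^ 2 := by
        refine Finset.sum_le_sum fun k _ => ?_
        rw [← Finset.sum_filter]
        exact (treeL2_sum_norm_sq_le _ _).trans
          (pow_le_pow_left₀ (norm_nonneg _) (norm_opC_basis_le _ _) 2)
    _ ≤ ∑ k ∈ Finset.range N, ‖u k‖ ^ 2 := h.sum_norm_sq_output_le u N
    _ ≤ ∑ k ∈ Finset.range N, ∑ s ∈ I, if l s = k then ‖f s‖ ^ 2 else 0 :=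
        Finset.sum_le_sum fun k _ =>
          norm_sq_sum_unitC_le f fun s hs hk => hlv s hs k hk
    _ ≤ 1 ^ 2 * ∑ s ∈ I, ‖f s‖ ^ 2 := by
        rw [Finset.sum_comm, one_pow, one_mul]
        refine Finset.sum_le_sum fun s _ => ?_
        rw [Finset.sum_ite_eq]
        split_ifs
        · exact le_rfl
        · positivity

/-- The transfer operator of a colligation. -/
theorem exists_transfer (h : M.IsColligation ι j A B C D) :
    ∃ S : TreeOp T, M.IsSchur S ∧ ∀ (n : ℕ) (d : M.C2),
      M.degPart n S * M.opC d = M.opC (markov A B C D n d) * (M.α j ^ n)† := by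
  obtain ⟨S, hS, hent⟩ := exists_treeOp_of_entries _ zero_le_one h.entries_bound
  have hcausal : M.IsCausal S := isCausal_iff.mpr fun s t hst => by
    rw [hent, if_neg (by omega)]
  refine ⟨S, ⟨hcausal, hS⟩, fun n d => ?_⟩
  -- Both sides depend boundedly on `d`, so it suffices to compare them on matrix units.
  let φ : M.C2 →L[ℂ] TreeOp T :=
    ContinuousLinearMap.mul ℂ (TreeOp T) (M.degPart n S) ∘L H2.op ∘L M.inclC
  let ψ : M.C2 →L[ℂ] TreeOp T :=
    (ContinuousLinearMap.mul ℂ (TreeOp T)).flip ((M.α j ^ n)†) ∘L H2.op ∘L M.inclC ∘L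
      markov A B C D n
  have hφψ : φ = ψ := by
    refine clm_ext_unitC fun r s hrs => ?_
    change M.degPart n S * M.opC (M.unitC r s) =
      M.opC (markov A B C D n (M.unitC r s)) * (M.α j ^ n)†
    rw [h.out_unitC hrs]
    refine treeOp_ext fun s' t => ?_
    rw [mul_apply_eq_comp, mul_apply_eq_comp (f := _ * _)]
    by_cases hs : s' = s
    · rw [hs, opC_unitC_basis hrs, degPart_entry, hent]
      split_ifs with h1 h2
      · rw [show (M.level t - M.level r).toNat = n by omega]
      · omega
      · exact (isDeg_opC_mul_adjoint _ j n r t h1).symm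
    · rw [opC_unitC_basis_of_ne hrs hs, map_zero, map_zero]
  exact congrArg (fun χ : M.C2 →L[ℂ] TreeOp T => χ d) hφψ

end IsColligation

theorem eq_of_forall_mul_opC {X Y : TreeOp T} (h : ∀ d : M.C2, X * M.opC d = Y * M.opC d) :
    X = Y :=
  treeOp_ext fun s t => by
    have h1 := congrArg (fun R : TreeOp T => R (treeBasis s) t) (h (M.unitC s s))
    simpa only [mul_apply_eq_comp, opC_unitC_basis (rfl : M.level s = M.level s)] using h1

end MultiscaleTree

theorem HasSum.of_forall_eq {ι E : Type*} [AddCommMonoid E] [TopologicalSpace E] {f g : ι → E}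
    {a : E} (h : HasSum f a) (hfg : ∀ i, g i = f i) : HasSum g a := by
  rwa [funext hfg]

namespace MultiscaleTree

variable {q : ℕ} {T : Type*} {M : MultiscaleTree q T}

/-! ## Point evaluation at operators of degree `-1` -/

/-- An operator of degree `-1` whose powers are summable, as are the `c α` with `c` in the ball. -/
structure IsEvalPoint (M : MultiscaleTree q T) (X : TreeOp T) : Prop where
  deg : M.IsDeg (-1) X
  summable : Summable fun n : ℕ => ‖X ^ n‖

/-- This is the root test. -/
theorem isEvalPoint_rowα {c : Fin q → TreeOp T} (hc : c ∈ M.ball) : M.IsEvalPoint (M.rowα c) := by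
  obtain ⟨hconst, r, hr, hlim⟩ := hc
  refine ⟨isDeg_sum _ fun j _ => ?_, ?_⟩
  · have h := (isConst_iff.mp (hconst j)).mul (isDeg_α j)
    simpa using h
  · have hr0 : 0 ≤ r := ge_of_tendsto' hlim fun _ => by positivity
    obtain ⟨ρ, hrρ, hρ⟩ := exists_between hr
    refine Summable.of_norm_bounded_eventually_nat
      (summable_geometric_of_lt_one (hr0.trans hrρ.le) hρ) ?_
    filter_upwards [hlim.eventually_lt_const hrρ, eventually_ge_atTop 1] with n hn hn1
    have hn0 : (n : ℝ) ≠ 0 := by positivity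
    rw [norm_norm]
    calc ‖M.rowα c ^ n‖ = (‖M.rowα c ^ n‖ ^ (1 / (n : ℝ))) ^ n := by
          rw [← Real.rpow_natCast, ← Real.rpow_mul (norm_nonneg _), one_div_mul_cancel hn0,
            Real.rpow_one]
      _ ≤ ρ ^ n := pow_le_pow_left₀ (by positivity) hn.le n

/-- `∑ₙ Xⁿ Sₙ`, where `Sₙ` is the part of degree `n` of `S`. -/
noncomputable def evalAt (M : MultiscaleTree q T) (X S : TreeOp T) : TreeOp T :=
  ∑' n : ℕ, X ^ n * M.degPart n S

theorem eval_eq_evalAt (S : TreeOp T) (c : Fin q → TreeOp T) :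
    M.eval S c = M.evalAt (M.rowα c) S := eval_eq_tsum S c

namespace IsEvalPoint

variable {X Y : TreeOp T}

theorem summable_degPart (hX : M.IsEvalPoint X) (S : TreeOp T) :
    Summable fun n : ℕ => X ^ n * M.degPart n S :=
  Summable.of_norm_bounded (hX.summable.mul_right ‖S‖) fun _ =>
    (norm_mul_le _ _).trans
      (mul_le_mul_of_nonneg_left (norm_degPart_le _ _) (norm_nonneg _))

theorem hasSum_evalAt (hX : M.IsEvalPoint X) (S : TreeOp T) :
    HasSum (fun n : ℕ => X ^ n * M.degPart n S) (M.evalAt X S) :=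
  (hX.summable_degPart S).hasSum

theorem isDeg_evalAt (hX : M.IsEvalPoint X) (S : TreeOp T) : M.IsDeg 0 (M.evalAt X S) :=
  fun s t h => by
    have h1 := (hX.hasSum_evalAt S).mapL (ContinuousLinearMap.apply ℂ (TreeL2 T) (treeBasis s))
    have h2 := h1.mapL (innerSL ℂ (treeBasis t))
    simp only [innerSL_apply_apply, inner_treeBasis_left] at h2
    refine h2.unique (hasSum_zero.of_forall_eq fun n => ?_)
    have hdeg := (hX.deg.pow n).mul (isDeg_degPart (M := M) n S)
    exact hdeg s t (by simpa using h)

theorem evalAt_sub (hX : M.IsEvalPoint X) (S R : TreeOp T) :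
    M.evalAt X (S - R) = M.evalAt X S - M.evalAt X R := by
  refine (hX.hasSum_evalAt (S - R)).unique
    (((hX.hasSum_evalAt S).sub (hX.hasSum_evalAt R)).of_forall_eq fun n => ?_)
  rw [degPart_sub, mul_sub]

theorem evalAt_mul_const (hX : M.IsEvalPoint X) (S : TreeOp T) {z : TreeOp T}
    (hz : M.IsDeg 0 z) : M.evalAt X (S * z) = M.evalAt X S * z := by
  refine (hX.hasSum_evalAt (S * z)).unique
    (((hX.hasSum_evalAt S).mul_right z).of_forall_eq fun n => ?_)
  rw [hz.degPart_mul_right, sub_zero, mul_assoc]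

theorem evalAt_one (M : MultiscaleTree q T) (X : TreeOp T) : M.evalAt X 1 = 1 := by
  rw [evalAt, tsum_eq_single 0]
  · rw [pow_zero, one_mul, Nat.cast_zero, isDeg_one.degPart_self]
  · intro n hn
    rw [isDeg_one.degPart_of_ne (by exact_mod_cast hn), mul_zero]

/-- Multiplication by Y* raises degrees by one, so the part of degree n + 1 of K Y* is Kₙ Y*. The
part of degree 0 vanishes because a causal `K` has none of degree -1. -/
theorem evalAt_mul_adjoint (hX : M.IsEvalPoint X) (hY : M.IsDeg (-1) Y) {K : TreeOp T}
    (hK : M.IsCausal K) : M.evalAt X (K * Y†) = X * M.evalAt X K * Y† := by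
  have hY' : M.IsDeg 1 (Y†) := by simpa using hY.adjoint
  refine (hX.hasSum_evalAt (K * Y†)).unique ?_
  have h1 : HasSum (fun n : ℕ => X ^ (n + 1) * M.degPart (n + 1 : ℕ) (K * Y†))
      (X * M.evalAt X K * Y†) := by
    refine (((hX.hasSum_evalAt K).mul_left X).mul_right (Y†)).of_forall_eq fun n => ?_
    rw [hY'.degPart_mul_right, pow_succ' X]
    simp only [mul_assoc, Nat.cast_add, Nat.cast_one, add_sub_cancel_right]
  have h2 := HasSum.zero_add (f := fun n : ℕ => X ^ n * M.degPart n (K * Y†)) h1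
  rwa [hY'.degPart_mul_right, Nat.cast_zero, zero_sub, hK.degPart_of_neg (by norm_num), zero_mul,
    mul_zero, zero_add] at h2

theorem summable_adjoint_pow (hY : M.IsEvalPoint Y) : Summable fun n : ℕ => (Y†) ^ n := by
  refine Summable.of_norm (hY.summable.congr fun n => ?_)
  rw [← ContinuousLinearMap.star_eq_adjoint, ← star_pow, norm_star]

theorem isUnit_one_sub_adjoint (hY : M.IsEvalPoint Y) : IsUnit (1 - Y†) :=
  ⟨⟨1 - Y†, ∑' n : ℕ, (Y†) ^ n, hY.summable_adjoint_pow.one_sub_mul_tsum_pow,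
    hY.summable_adjoint_pow.tsum_pow_mul_one_sub⟩, rfl⟩

/-- The Neumann series has terms of degree n ≥ 0, and causal operators form a closed set. -/
theorem isCausal_inverse (hY : M.IsEvalPoint Y) : M.IsCausal (Ring.inverse (1 - Y†)) := by
  have h : Ring.inverse (1 - Y†) = ∑' n : ℕ, (Y†) ^ n := by
    calc Ring.inverse (1 - Y†) = Ring.inverse (1 - Y†) * ((1 - Y†) * ∑' n : ℕ, (Y†) ^ n) := by
          rw [hY.summable_adjoint_pow.one_sub_mul_tsum_pow, mul_one]
      _ = ∑' n : ℕ, (Y†) ^ n := by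
          rw [← mul_assoc, Ring.inverse_mul_cancel _ hY.isUnit_one_sub_adjoint, one_mul]
  rw [h]
  refine (isClosed_causal M).mem_of_tendsto hY.summable_adjoint_pow.hasSum
    (Eventually.of_forall fun I => ?_)
  have hY' : M.IsDeg 1 (Y†) := by simpa using hY.deg.adjoint
  refine Finset.sum_induction _ M.IsCausal (fun _ _ => IsCausal.add) M.isCausal_zero fun n _ => ?_
  exact (hY'.pow n).isCausal (by positivity)

/-- The Stein equation of the reproducing kernel. -/
theorem evalAt_kernel (hX : M.IsEvalPoint X) (hY : M.IsEvalPoint Y) {S : TreeOp T}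
    (hS : M.IsCausal S) :
    M.evalAt X ((1 - S * (M.evalAt Y S)†) * Ring.inverse (1 - Y†)) -
        X * M.evalAt X ((1 - S * (M.evalAt Y S)†) * Ring.inverse (1 - Y†)) * Y† =
      1 - M.evalAt X S * (M.evalAt Y S)† := by
  have hz : M.IsDeg 0 ((M.evalAt Y S)†) := by simpa using (hY.isDeg_evalAt S).adjoint
  have hcausal : M.IsCausal (1 - S * (M.evalAt Y S)†) := by
    have h1 := isDeg_one.isCausal (M := M) le_rfl
    have h2 := (hS.mul (hz.isCausal le_rfl)).smul (-1)
    simpa [sub_eq_add_neg] using h1.add h2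
  have hK := hcausal.mul hY.isCausal_inverse
  rw [← hX.evalAt_mul_adjoint hY.deg hK, ← hX.evalAt_sub]
  have h : ∀ K : TreeOp T, K - K * Y† = K * (1 - Y†) := fun K => by rw [mul_sub, mul_one]
  rw [h, mul_assoc, Ring.inverse_mul_cancel _ hY.isUnit_one_sub_adjoint, mul_one, hX.evalAt_sub,
    evalAt_one, hX.evalAt_mul_const _ hz]

end IsEvalPoint

/-! ## The evaluation of the states of a colligation -/

variable {H : Type*} [NormedAddCommGroup H] [InnerProductSpace ℂ H] [CompleteSpace H]

/-- The operator `F ↦ ∑ₙ Xⁿ (C Aⁿ F) (αⁿ)*`. -/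
noncomputable def stateEval (M : MultiscaleTree q T) (j : Fin q) (A : H →L[ℂ] H)
    (C : H →L[ℂ] M.C2) (X : TreeOp T) : H →L[ℂ] M.C2 :=
  ∑' n : ℕ, M.mulC (X ^ n) ((M.α j ^ n)†) ∘L C ∘L A ^ n

theorem opC_mulC_pow {X : TreeOp T} (hX : M.IsDeg (-1) X) (j : Fin q) (n : ℕ) (k : M.C2) :
    M.opC (M.mulC (X ^ n) ((M.α j ^ n)†) k) = X ^ n * M.opC k * (M.α j ^ n)† := by
  refine opC_mulC (hX.pow n) ?_ k
  simpa using isDeg_α_pow_adjoint (M := M) j n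

theorem opC_mulC_α {X : TreeOp T} (hX : M.IsDeg (-1) X) (j : Fin q) (k : M.C2) :
    M.opC (M.mulC X ((M.α j)†) k) = X * M.opC k * (M.α j)† := by
  simpa using opC_mulC_pow hX j 1 k

theorem mulC_α_mulC_pow {X : TreeOp T} (hX : M.IsDeg (-1) X) (j : Fin q) (n : ℕ) (k : M.C2) :
    M.mulC X ((M.α j)†) (M.mulC (X ^ n) ((M.α j ^ n)†) k) =
      M.mulC (X ^ (n + 1)) ((M.α j ^ (n + 1))†) k := by
  refine opC_injective ?_
  rw [opC_mulC_α hX, opC_mulC_pow hX, opC_mulC_pow hX, pow_succ' X, pow_succ' (M.α j),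
    treeOp_adjoint_mul]
  simp only [mul_assoc]

namespace IsColligation

variable {ι : H →ₗ[ℂ] M.H2} {j : Fin q} {A : H →L[ℂ] H} {B : M.C2 →L[ℂ] H} {C : H →L[ℂ] M.C2}
  {D : M.C2 →L[ℂ] M.C2} {X Y : TreeOp T}

theorem norm_stateEval_term_le (h : M.IsColligation ι j A B C D) (X : TreeOp T) (n : ℕ) :
    ‖M.mulC (X ^ n) ((M.α j ^ n)†) ∘L C ∘L A ^ n‖ ≤ ‖X ^ n‖ * ‖C‖ := by
  have hA : ‖A ^ n‖ ≤ 1 := by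
    -- The power 0 is treated apart: on the zero space the identity has norm 0, so the identity need
    -- not have norm 1.
    rcases Nat.eq_zero_or_pos n with rfl | hn
    · exact ContinuousLinearMap.norm_id_le
    · exact (norm_pow_le' A hn).trans (pow_le_one₀ (norm_nonneg _) h.norm_A_le)
  have hα : ‖(M.α j ^ n)†‖ ≤ 1 := norm_adjoint_le_one (α_pow_mul_adjoint j n)
  calc ‖M.mulC (X ^ n) ((M.α j ^ n)†) ∘L C ∘L A ^ n‖
      ≤ ‖M.mulC (X ^ n) ((M.α j ^ n)†)‖ * (‖C‖ * ‖A ^ n‖) :=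
        (ContinuousLinearMap.opNorm_comp_le _ _).trans
          (mul_le_mul_of_nonneg_left (ContinuousLinearMap.opNorm_comp_le _ _) (norm_nonneg _))
    _ ≤ (‖X ^ n‖ * 1) * (‖C‖ * 1) := by
        gcongr
        exact (norm_mulC_le _ _).trans (mul_le_mul_of_nonneg_left hα (norm_nonneg _))
    _ = ‖X ^ n‖ * ‖C‖ := by ring

theorem summable_norm_stateEval (h : M.IsColligation ι j A B C D) (hX : M.IsEvalPoint X) :
    Summable fun n : ℕ => ‖M.mulC (X ^ n) ((M.α j ^ n)†) ∘L C ∘L A ^ n‖ :=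
  Summable.of_nonneg_of_le (fun _ => norm_nonneg _) (h.norm_stateEval_term_le X)
    (hX.summable.mul_right _)

theorem hasSum_stateEval (h : M.IsColligation ι j A B C D) (hX : M.IsEvalPoint X) (F : H) :
    HasSum (fun n : ℕ => M.mulC (X ^ n) ((M.α j ^ n)†) (C ((A ^ n) F)))
      (M.stateEval j A C X F) :=
  ((h.summable_norm_stateEval hX).of_norm.hasSum).mapL (ContinuousLinearMap.apply ℂ M.C2 F)

/-- The term n = 0 of the series is C F, and the others form X (E (A F)) α*. This and
`evalAt_transfer` are the two entries of the row (X E(·) α*, 1) V. -/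
theorem stateEval_eq (h : M.IsColligation ι j A B C D) (hX : M.IsEvalPoint X) :
    (M.mulC X ((M.α j)†) ∘L M.stateEval j A C X) ∘L A + (1 : M.C2 →L[ℂ] M.C2) ∘L C =
      M.stateEval j A C X := by
  ext1 F
  refine HasSum.unique ?_ (h.hasSum_stateEval hX F)
  have h1 : HasSum (fun n : ℕ => M.mulC (X ^ (n + 1)) ((M.α j ^ (n + 1))†) (C ((A ^ (n + 1)) F)))
      (M.mulC X ((M.α j)†) (M.stateEval j A C X (A F))) := by
    refine ((h.hasSum_stateEval hX (A F)).mapL (M.mulC X ((M.α j)†))).of_forall_eq fun n => ?_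
    rw [mulC_α_mulC_pow hX.deg, pow_succ A, mul_apply_eq_comp]
  have h2 := HasSum.zero_add
    (f := fun n : ℕ => M.mulC (X ^ n) ((M.α j ^ n)†) (C ((A ^ n) F))) h1
  have h0 : M.mulC (X ^ 0) ((M.α j ^ 0)†) (C ((A ^ 0) F)) = C F := by
    refine opC_injective ?_
    have h1 : ((1 : TreeOp T)†) = 1 := ContinuousLinearMap.adjoint_id
    rw [opC_mulC_pow hX.deg, pow_zero, pow_zero, pow_zero, h1, one_mul, mul_one]
    rfl
  rw [h0, add_comm] at h2
  exact h2

theorem evalAt_transfer (h : M.IsColligation ι j A B C D) (hX : M.IsEvalPoint X) {S : TreeOp T}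
    (hS : ∀ (n : ℕ) (d : M.C2),
      M.degPart n S * M.opC d = M.opC (markov A B C D n d) * (M.α j ^ n)†) :
    (M.mulC X ((M.α j)†) ∘L M.stateEval j A C X) ∘L B + (1 : M.C2 →L[ℂ] M.C2) ∘L D =
      M.mulC (M.evalAt X S) 1 := by
  ext1 d
  refine opC_injective ?_
  rw [opC_mulC_const (hX.isDeg_evalAt S)]
  refine HasSum.unique ?_ ((hX.hasSum_evalAt S).mul_right (M.opC d))
  have h1 : HasSum (fun n : ℕ => X ^ (n + 1) * M.degPart (n + 1 : ℕ) S * M.opC d)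
      (M.opC (M.mulC X ((M.α j)†) (M.stateEval j A C X (B d)))) := by
    refine (((h.hasSum_stateEval hX (B d)).mapL (M.mulC X ((M.α j)†))).mapL
      (H2.op ∘L M.inclC)).of_forall_eq fun n => ?_
    rw [mulC_α_mulC_pow hX.deg, mul_assoc, hS]
    exact (mul_assoc _ _ _).symm.trans (opC_mulC_pow hX.deg j (n + 1) _).symm
  have h2 := HasSum.zero_add (f := fun n : ℕ => X ^ n * M.degPart n S * M.opC d) h1
  have h0 : X ^ 0 * M.degPart (0 : ℕ) S * M.opC d = M.opC (D d) := by
    have h1 : ((1 : TreeOp T)†) = 1 := ContinuousLinearMap.adjoint_id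
    rw [pow_zero, one_mul, hS, pow_zero, h1, mul_one]
    rfl
  rw [h0, add_comm] at h2
  change HasSum _ (H2.op (M.inclC (_ + _)))
  rw [map_add, map_add]
  exact h2

/-- This is the hypothesis of `row_identity`. In each term the extra factor αⁿ* α* α αⁿ meets
α^(n+1)* on its right and is absorbed, since αⁿ αⁿ* = 1 and α α* = 1. -/
theorem mulC_stateEval_congr (h : M.IsColligation ι j A B C D) (hX : M.IsEvalPoint X) {F F' : H}
    (hF : M.opH (ι F') = M.opH (ι F) * ((M.α j)† * M.α j)) :
    (M.mulC X ((M.α j)†) ∘L M.stateEval j A C X) F' =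
      (M.mulC X ((M.α j)†) ∘L M.stateEval j A C X) F := by
  have hα : M.IsConst ((M.α j)† * M.α j) := by
    rw [isConst_iff]
    have h1 := (isDeg_α_adjoint (M := M) j).mul (isDeg_α j)
    simpa using h1
  have h1 := (h.hasSum_stateEval hX F').mapL (M.mulC X ((M.α j)†))
  have h2 := (h.hasSum_stateEval hX F).mapL (M.mulC X ((M.α j)†))
  refine h1.unique (h2.of_forall_eq fun n => ?_)
  rw [mulC_α_mulC_pow hX.deg, mulC_α_mulC_pow hX.deg]
  refine opC_injective ?_
  rw [opC_mulC_pow hX.deg, opC_mulC_pow hX.deg, h.opC_pow hα hF n, pow_succ' (M.α j),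
    treeOp_adjoint_mul]
  have e1 : M.α j ^ n * ((M.α j ^ n)† * (M.α j)†) = (M.α j)† := by
    rw [← mul_assoc, α_pow_mul_adjoint, one_mul]
  have e2 : (M.α j)† * (M.α j * (M.α j)†) = (M.α j)† := by rw [α_mul_adjoint, mul_one]
  simp only [mul_assoc, e1, e2]

/-- The evaluation of the reproducing kernel of the transfer operator. -/
theorem evalAt_kernel_transfer (h : M.IsColligation ι j A B C D) (hX : M.IsEvalPoint X)
    (hY : M.IsEvalPoint Y) {S : TreeOp T} (hScausal : M.IsCausal S)
    (hS : ∀ (n : ℕ) (d : M.C2),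
      M.degPart n S * M.opC d = M.opC (markov A B C D n d) * (M.α j ^ n)†) :
    M.mulC (M.evalAt X ((1 - S * (M.evalAt Y S)†) * Ring.inverse (1 - Y†))) 1 =
      M.stateEval j A C X ∘L ((M.stateEval j A C Y)†) := by
  set K := M.evalAt X ((1 - S * (M.evalAt Y S)†) * Ring.inverse (1 - Y†)) with hK
  set E := M.stateEval j A C X
  set E' := M.stateEval j A C Y
  have hadj1 : ((1 : TreeOp T)†) = 1 := ContinuousLinearMap.adjoint_id
  have hadj1' : ((1 : M.C2 →L[ℂ] M.C2)†) = 1 := ContinuousLinearMap.adjoint_id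
  have hKdeg : M.IsDeg 0 K := hX.isDeg_evalAt _
  have hzX := hX.isDeg_evalAt S
  have hzY : M.IsDeg 0 ((M.evalAt Y S)†) := by simpa using (hY.isDeg_evalAt S).adjoint
  have hY' : M.IsDeg 1 (Y†) := by simpa using hY.deg.adjoint
  -- both sides satisfy the Stein equation
  have h1 := h.row_identity (U := M.mulC X ((M.α j)†) ∘L E) (U' := M.mulC Y ((M.α j)†) ∘L E')
    (W := 1) (W' := 1) fun F F' hF => h.mulC_stateEval_congr hX hF
  rw [h.stateEval_eq hX, h.stateEval_eq hY, h.evalAt_transfer hX hS, h.evalAt_transfer hY hS,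
    adjoint_mulC, hadj1, hadj1', ContinuousLinearMap.adjoint_comp, adjoint_mulC,
    ContinuousLinearMap.adjoint_adjoint] at h1
  have h2 : M.mulC K 1 + M.mulC (M.evalAt X S) 1 ∘L M.mulC ((M.evalAt Y S)†) 1 =
      M.mulC X ((M.α j)†) ∘L M.mulC K 1 ∘L M.mulC (Y†) (M.α j) + 1 := by
    have hstein := hX.evalAt_kernel hY hScausal
    rw [← hK] at hstein
    ext1 k
    refine opC_injective ?_
    change H2.op (M.inclC (M.mulC K 1 k + M.mulC (M.evalAt X S) 1 (M.mulC ((M.evalAt Y S)†) 1 k))) =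
      H2.op (M.inclC (M.mulC X ((M.α j)†) (M.mulC K 1 (M.mulC (Y†) (M.α j) k)) + k))
    rw [map_add, map_add, map_add, map_add]
    change M.opC _ + M.opC _ = M.opC _ + M.opC _
    rw [opC_mulC_const hKdeg, opC_mulC_const hzX, opC_mulC_const hzY, opC_mulC_α hX.deg,
      opC_mulC_const hKdeg, opC_mulC hY' (isDeg_α j)]
    have e1 : X * (K * (Y† * M.opC k * M.α j)) * (M.α j)† = X * K * Y† * M.opC k := by
      simp only [mul_assoc, α_mul_adjoint, mul_one]
    have e2 : K + M.evalAt X S * (M.evalAt Y S)† = X * K * Y† + 1 := by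
      rw [sub_eq_sub_iff_add_eq_add.mp hstein, add_comm]
    rw [e1, ← mul_assoc, ← add_mul, e2, add_mul, one_mul]
  -- hence their difference is fixed by the compressions with all powers
  rw [← sub_eq_zero]
  set Z := M.mulC K 1 - E ∘L (E'†) with hZ
  have hfix : Z = M.mulC X ((M.α j)†) * Z * M.mulC (Y†) (M.α j) := by
    have e : M.mulC X ((M.α j)†) * Z * M.mulC (Y†) (M.α j) =
        M.mulC X ((M.α j)†) ∘L M.mulC K 1 ∘L M.mulC (Y†) (M.α j) -
          (M.mulC X ((M.α j)†) ∘L E) ∘L ((E'†) ∘L M.mulC (Y†) (M.α j)) := by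
      rw [hZ, mul_sub, sub_mul]
      rfl
    rw [e, hZ, ← add_sub_add_right_eq_sub _ _ (M.mulC (M.evalAt X S) 1 ∘L
      M.mulC ((M.evalAt Y S)†) 1), h2, h1]
    exact add_sub_add_right_eq_sub _ _ _
  have hpow : ∀ n : ℕ, Z = M.mulC X ((M.α j)†) ^ n * Z * M.mulC (Y†) (M.α j) ^ n := by
    intro n
    induction n with
    | zero => simp
    | succ n ih =>
      conv_lhs => rw [hfix, ih]
      rw [pow_succ', pow_succ]
      simp only [mul_assoc]
  -- The powers of α and their adjoints are contractions, so only the powers of X and Y remain;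
  -- these tend to 0 by summability.
  have hbound : ∀ n : ℕ, ‖Z‖ ≤ ‖X ^ n‖ * ‖Z‖ * ‖Y ^ n‖ := fun n => by
    have hαn : ‖(M.α j ^ n)†‖ ≤ 1 := norm_adjoint_le_one (α_pow_mul_adjoint j n)
    have hα : ‖M.α j ^ n‖ ≤ 1 := by rwa [LinearIsometryEquiv.norm_map] at hαn
    have hX1 : ‖M.mulC X ((M.α j)†) ^ n‖ ≤ ‖X ^ n‖ * 1 := by
      rw [mulC_pow hX.deg (by simpa using isDeg_α_adjoint j), ← ContinuousLinearMap.star_eq_adjoint,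
        ← star_pow]
      exact (norm_mulC_le _ _).trans (mul_le_mul_of_nonneg_left hαn (norm_nonneg _))
    have hY1 : ‖M.mulC (Y†) (M.α j) ^ n‖ ≤ ‖Y ^ n‖ * 1 := by
      rw [mulC_pow hY' (isDeg_α j), ← ContinuousLinearMap.star_eq_adjoint, ← star_pow]
      refine (norm_mulC_le _ _).trans ?_
      change ‖(Y ^ n)†‖ * _ ≤ _
      rw [LinearIsometryEquiv.norm_map]
      exact mul_le_mul_of_nonneg_left hα (norm_nonneg _)
    calc ‖Z‖ = ‖M.mulC X ((M.α j)†) ^ n * Z * M.mulC (Y†) (M.α j) ^ n‖ := by rw [← hpow n]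
      _ ≤ ‖M.mulC X ((M.α j)†) ^ n‖ * ‖Z‖ * ‖M.mulC (Y†) (M.α j) ^ n‖ :=
        (norm_mul_le _ _).trans (mul_le_mul_of_nonneg_right (norm_mul_le _ _) (norm_nonneg _))
      _ ≤ (‖X ^ n‖ * 1) * ‖Z‖ * (‖Y ^ n‖ * 1) := by gcongr
      _ = ‖X ^ n‖ * ‖Z‖ * ‖Y ^ n‖ := by ring
  have hlim : Tendsto (fun n : ℕ => ‖X ^ n‖ * ‖Z‖ * ‖Y ^ n‖) atTop (𝓝 (0 * ‖Z‖ * 0)) :=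
    (hX.summable.tendsto_atTop_zero.mul_const ‖Z‖).mul hY.summable.tendsto_atTop_zero
  have hle := ge_of_tendsto' hlim hbound
  rw [mul_zero] at hle
  exact norm_le_zero_iff.mp hle

end IsColligation

end MultiscaleTree

/-! ## Range inclusion of operators between Hilbert spaces -/

section Douglas

variable {E E₁ E₂ : Type*} [NormedAddCommGroup E] [InnerProductSpace ℂ E] [CompleteSpace E]
  [NormedAddCommGroup E₁] [InnerProductSpace ℂ E₁] [CompleteSpace E₁]
  [NormedAddCommGroup E₂] [InnerProductSpace ℂ E₂] [CompleteSpace E₂]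

/-- Douglas' lemma: if `‖A* y‖ ≤ ‖B* y‖` for all `y`, then `A` factors through `B` by a
contraction. -/
theorem exists_apply_eq_of_norm_adjoint_le {A : E₁ →L[ℂ] E} {B : E₂ →L[ℂ] E}
    (h : ∀ y, ‖(A†) y‖ ≤ ‖(B†) y‖) (x : E₁) : ∃ z, B z = A x ∧ ‖z‖ ≤ ‖x‖ := by
  let K : Submodule ℂ E₂ := (LinearMap.range (B†).toLinearMap).topologicalClosure
  have hKcl : IsClosed (K : Set E₂) := Submodule.isClosed_topologicalClosure _
  have : CompleteSpace K := hKcl.completeSpace_coe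
  have hmem : ∀ y, (B†) y ∈ K := fun y =>
    Submodule.le_topologicalClosure _ ⟨y, rfl⟩
  let e : E →ₗ[ℂ] K := (B†).toLinearMap.codRestrict K hmem
  have hdense : DenseRange e := by
    intro z
    rw [closure_subtype]
    have hz : (z : E₂) ∈ closure (LinearMap.range (B†).toLinearMap : Set E₂) := z.2
    convert hz using 2
    ext w
    constructor
    · rintro ⟨_, ⟨y, rfl⟩, rfl⟩
      exact ⟨y, rfl⟩
    · rintro ⟨y, rfl⟩
      exact ⟨e y, ⟨y, rfl⟩, rfl⟩
  have hle : ∀ y, ‖(A†).toLinearMap y‖ ≤ 1 * ‖e y‖ := fun y => by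
    rw [one_mul]
    exact h y
  -- The assignment B* y ↦ A* y is well defined and contractive by hypothesis and extends to the
  -- closure of the range of B*; the required preimage of A x is W* x.
  let W : K →L[ℂ] E₁ := (A†).toLinearMap.extendOfNorm e
  have hW : ∀ y, W (e y) = (A†) y := LinearMap.extendOfNorm_eq hdense ⟨1, hle⟩
  have hWnorm : ‖W‖ ≤ 1 := ContinuousLinearMap.opNorm_le_bound _ zero_le_one
    (LinearMap.norm_extendOfNorm_apply_le hdense 1 hle)
  refine ⟨(W†) x, ?_, ?_⟩
  · refine ext_inner_left ℂ fun y => ?_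
    rw [← ContinuousLinearMap.adjoint_inner_left]
    change ⟪e y, (W†) x⟫_ℂ = _
    rw [ContinuousLinearMap.adjoint_inner_right, hW, ContinuousLinearMap.adjoint_inner_left]
  · have h1 : ‖W†‖ ≤ 1 := by rwa [LinearIsometryEquiv.norm_map]
    have h2 := (W†).le_of_opNorm_le h1 x
    rwa [one_mul] at h2

end Douglas

/-! ### De Branges-Rovnyak spaces through range inclusion -/

namespace MultiscaleTree

variable {q : ℕ} {T : Type*} {M : MultiscaleTree q T}
variable {H : Type*} [NormedAddCommGroup H] [InnerProductSpace ℂ H] [CompleteSpace H]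

/-- A Hilbert space boundedly included in `𝐇₂(T)` by `ι` with `ι ι* = I - M_S M_S*` is `𝐇(S)`. -/
theorem isDeBrangesRovnyak_of_comp_adjoint {ι : H →L[ℂ] M.H2} (hι : Function.Injective ι)
    {S : TreeOp T} (hS : M.IsCausal S) (h : ι ∘L (ι†) = M.defect S hS) :
    M.IsDeBrangesRovnyak ι.toLinearMap S hS := by
  have hpos : 0 ≤ M.defect S hS := by
    rw [← h, ContinuousLinearMap.nonneg_iff_isPositive]
    exact ContinuousLinearMap.isPositive_self_comp_adjoint ι
  have hRR : M.defectSqrt S hS * M.defectSqrt S hS = M.defect S hS :=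
    CFC.sqrt_mul_sqrt_self _ hpos
  have hRadj : ((M.defectSqrt S hS)†) = M.defectSqrt S hS :=
    (CFC.sqrt_nonneg (M.defect S hS)).isSelfAdjoint
  set R := M.defectSqrt S hS
  -- R R* = ι ι*, so Douglas' lemma applies in both directions and gives equal ranges together with
  -- control of the norms.
  have hnorm : ∀ y, ‖(R†) y‖ = ‖(ι†) y‖ := fun y => by
    refine (pow_left_inj₀ (norm_nonneg _) (norm_nonneg _) two_ne_zero).mp ?_
    rw [← inner_self_eq_norm_sq (𝕜 := ℂ), ← inner_self_eq_norm_sq (𝕜 := ℂ),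
      ContinuousLinearMap.adjoint_inner_left, ContinuousLinearMap.adjoint_inner_left, hRadj,
      ← mul_apply_eq_comp, hRR, ← h]
    rfl
  have hker : ∀ G, G ∈ (M.defect S hS).ker ↔ R G = 0 := fun G => by
    rw [LinearMap.mem_ker]
    constructor
    · intro hG
      have h1 : ‖R G‖ ^ 2 = 0 := by
        rw [← inner_self_eq_norm_sq (𝕜 := ℂ), ← ContinuousLinearMap.adjoint_inner_right, hRadj,
          ← mul_apply_eq_comp, hRR]
        change RCLike.re ⟪G, (M.defect S hS).toLinearMap G⟫_ℂ = 0
        rw [hG, inner_zero_right, map_zero]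
      simpa using h1
    · intro hG
      change M.defect S hS G = 0
      rw [← hRR, mul_apply_eq_comp, hG, map_zero]
  have hπ : ∀ G, R (M.defectProj S hS G) = 0 := fun G =>
    (hker _).mp (Submodule.starProjection_apply_mem _ G)
  refine ⟨?_, fun F G hFG => le_antisymm ?_ ?_⟩
  · ext F
    constructor
    · rintro ⟨x, rfl⟩
      obtain ⟨z, hz, -⟩ := exists_apply_eq_of_norm_adjoint_le (fun y => (hnorm y).ge) x
      exact ⟨z, hz⟩
    · rintro ⟨x, rfl⟩
      obtain ⟨z, hz, -⟩ := exists_apply_eq_of_norm_adjoint_le (fun y => (hnorm y).le) x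
      exact ⟨z, hz⟩
  · obtain ⟨F', hF', hle⟩ := exists_apply_eq_of_norm_adjoint_le (fun y => (hnorm y).le)
      (G - M.defectProj S hS G)
    rw [map_sub, hπ, sub_zero, ← hFG] at hF'
    rwa [hι hF'] at hle
  -- `K` is a preimage of ι F under `R` with ‖K‖ ≤ ‖F‖. It differs from `G` by an element of the
  -- kernel, so both have the same component orthogonal to the kernel.
  · obtain ⟨K, hK, hle⟩ := exists_apply_eq_of_norm_adjoint_le (fun y => (hnorm y).ge) F
    have hGK : G - K ∈ (M.defect S hS).ker := by
      rw [hker, map_sub, hK, sub_eq_zero]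
      exact hFG.symm
    have h1 : M.defectProj S hS (G - K) = G - K := Submodule.starProjection_eq_self_iff.mpr hGK
    have h2 : G - M.defectProj S hS G = K - M.defectProj S hS K := by
      rw [map_sub] at h1
      rw [sub_eq_sub_iff_sub_eq_sub, h1]
    rw [h2]
    refine le_trans ?_ hle
    have h3 : K - M.defectProj S hS K = (M.defect S hS).kerᗮ.starProjection K :=
      (Submodule.starProjection_orthogonal_val K).symm
    rw [h3]
    exact Submodule.norm_starProjection_apply_le _ K

/-! ## The right shift of `𝐇₂(T)` -/

/-- The right multiplication `G ↦ G α_j*` of `𝐇₂(T)`. -/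
noncomputable def shiftH (M : MultiscaleTree q T) (j : Fin q) : M.H2 →L[ℂ] M.H2 :=
  (M.colH†) ∘L hsMul 1 ((M.α j)†) ∘L M.colH

theorem opH_causal (G : M.H2) : M.IsCausal (M.opH G) := H2.op_causal G

theorem opH_shiftH (j : Fin q) (G : M.H2) : M.opH (M.shiftH j G) = M.opH G * (M.α j)† := by
  change M.opH ((M.colH†) (hsMul 1 ((M.α j)†) (M.colH G))) = _
  have h1 : treeSynth T (hsMul 1 ((M.α j)†) (M.colH G)) = M.opH G * (M.α j)† := by
    rw [treeSynth_hsMul, one_mul, treeSynth_colH]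
  rw [opH_adjoint_colH, h1]
  rw [h1]
  exact (opH_causal G).mul ((isDeg_α_adjoint j).isCausal zero_le_one)

theorem adjoint_shiftH (j : Fin q) :
    ((M.shiftH j)†) = (M.colH†) ∘L hsMul 1 (M.α j) ∘L M.colH := by
  have h1 : ((1 : TreeOp T)†) = 1 := ContinuousLinearMap.adjoint_id
  rw [shiftH, ContinuousLinearMap.adjoint_comp, ContinuousLinearMap.adjoint_comp,
    ContinuousLinearMap.adjoint_adjoint, adjoint_hsMul, ContinuousLinearMap.adjoint_adjoint, h1]
  rfl

/-- The adjoint of G ↦ G α* multiplies by α and projects onto the causal operators. The projection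
removes exactly the part of degree -1, which is G₀ α, and leaves the backward shift of part 3. -/
theorem opH_adjoint_shiftH (j : Fin q) (G : M.H2) :
    M.opH (((M.shiftH j)†) G) = (M.opH G - M.degPart 0 (M.opH G)) * M.α j := by
  have hcausal : M.IsCausal ((M.opH G - M.degPart 0 (M.opH G)) * M.α j) :=
    isCausal_iff.mpr fun s t hst => by
      refine (treeOp_mul_hasSum _ _ s t).unique (hasSum_zero.of_forall_eq fun r => ?_)
      by_cases hr : M.level r = M.level s + -1
      · have h2 : (M.opH G - M.degPart 0 (M.opH G)) (treeBasis r) t = 0 := by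
          change M.opH G (treeBasis r) t - M.degPart 0 (M.opH G) (treeBasis r) t = 0
          rw [degPart_entry]
          split_ifs with h
          · exact sub_self _
          · rw [sub_zero]
            exact isCausal_iff.mp (opH_causal G) r t (by omega)
        rw [h2, mul_zero]
      · rw [isDeg_α j s r hr, zero_mul]
  refine treeOp_ext fun s t => ?_
  rcases le_or_gt (M.level s) (M.level t) with hst | hst
  · rw [adjoint_shiftH]
    change M.opH ((M.colH†) (hsMul 1 (M.α j) (M.colH G))) _ _ = _
    rw [opH_adjoint_colH_entry _ hst, treeSynth_hsMul, one_mul, treeSynth_colH, sub_mul]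
    have h0 : (M.degPart 0 (M.opH G) * M.α j) (treeBasis s) t = 0 :=
      ((isDeg_degPart 0 _).mul (isDeg_α j)) s t (by omega)
    change _ = (M.opH G * M.α j) (treeBasis s) t - (M.degPart 0 (M.opH G) * M.α j) (treeBasis s) t
    rw [h0, sub_zero]
  · rw [isCausal_iff.mp (opH_causal _) s t hst, isCausal_iff.mp hcausal s t hst]

theorem shiftH_mul_adjoint_add (j : Fin q) :
    M.shiftH j * (M.shiftH j)† + M.inclC ∘L (M.inclC†) = 1 := by
  ext1 G
  refine H2.op_injective ?_
  change H2.op (M.shiftH j (((M.shiftH j)†) G) + M.inclC ((M.inclC†) G)) = M.opH G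
  rw [map_add]
  change M.opH _ + M.opC _ = _
  rw [opH_shiftH, opH_adjoint_shiftH, opC_adjoint_inclC, mul_assoc, α_mul_adjoint, mul_one,
    sub_add_cancel]

theorem degPart_adjoint_shiftH_pow (j : Fin q) (N n : ℕ) (G : M.H2) :
    M.degPart n (M.opH ((((M.shiftH j)†) ^ N) G)) =
      M.degPart (n + N : ℕ) (M.opH G) * M.α j ^ N := by
  induction N generalizing n with
  | zero => simp
  | succ N ih =>
    rw [pow_succ', mul_apply_eq_comp, opH_adjoint_shiftH, (isDeg_α j).degPart_mul_right,
      degPart_sub, (isDeg_degPart 0 _).degPart_of_ne (by omega), sub_zero, sub_neg_eq_add,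
      ← Nat.cast_succ, ih, mul_assoc, ← pow_succ]
    congr 2
    push_cast
    ring

theorem opC_adjoint_inclC_shiftH_pow (j : Fin q) (n : ℕ) (G : M.H2) :
    M.opC ((M.inclC†) ((((M.shiftH j)†) ^ n) G)) = M.degPart n (M.opH G) * M.α j ^ n := by
  rw [opC_adjoint_inclC]
  simpa using degPart_adjoint_shiftH_pow j n 0 G

theorem eq_of_forall_adjoint_shiftH_pow {j : Fin q} {F G : M.H2}
    (h : ∀ n : ℕ, (M.inclC†) ((((M.shiftH j)†) ^ n) F) = (M.inclC†) ((((M.shiftH j)†) ^ n) G)) :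
    F = G := by
  refine H2.op_injective (degPart_causal_ext (opH_causal F) (opH_causal G) fun n => ?_)
  have h1 := congrArg (fun k => M.opC k * (M.α j ^ n)†) (h n)
  simp only [opC_adjoint_inclC_shiftH_pow, mul_assoc, α_pow_mul_adjoint, mul_one] at h1
  exact h1

/-- A selfadjoint operator `Δ` on `𝐇₂(T)` with `Δ = ρ Δ ρ*`, where `ρ` is the right shift,
vanishes. -/
theorem eq_zero_of_shiftH_conj {j : Fin q} {Δ : M.H2 →L[ℂ] M.H2} (hadj : (Δ†) = Δ)
    (h : Δ = M.shiftH j * Δ * (M.shiftH j)†) : Δ = 0 := by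
  have hpow : ∀ n : ℕ, Δ = M.shiftH j ^ n * Δ * ((M.shiftH j)†) ^ n := by
    intro n
    induction n with
    | zero => simp
    | succ n ih =>
      conv_lhs => rw [h, ih]
      rw [pow_succ', pow_succ]
      simp only [mul_assoc]
  -- The adjoint shift lowers degrees and annihilates constants, so its power n + 1 kills elements
  -- of degree n. Selfadjointness then makes every matrix entry of Δ G an inner product with some Δ
  -- U = 0.
  have hdeg : ∀ {n : ℕ} {U : M.H2}, M.IsDeg n (M.opH U) → Δ U = 0 := by
    intro n U hU
    have h0 : (((M.shiftH j)†) ^ (n + 1)) U = 0 := by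
      refine H2.op_injective (degPart_causal_ext (opH_causal _) (opH_causal _) fun k => ?_)
      rw [degPart_adjoint_shiftH_pow, hU.degPart_of_ne (by push_cast; omega), zero_mul]
      change 0 = M.degPart k (H2.op 0)
      rw [map_zero, (isDeg_zero (k + 1)).degPart_of_ne (by omega)]
    rw [hpow (n + 1), mul_apply_eq_comp, h0, map_zero]
  ext1 G
  refine H2.op_injective (treeOp_ext fun s t => ?_)
  rw [zero_apply, map_zero]
  rcases le_or_gt (M.level s) (M.level t) with hst | hst
  · have hunit : M.IsDeg (M.level t - M.level s).toNat (treeSynth T (hsUnit t s)) :=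
      isDeg_hsUnit (by omega)
    obtain ⟨U, hU⟩ := exists_colH_eq (hunit.isCausal (by positivity))
    have hUdeg : M.IsDeg (M.level t - M.level s).toNat (M.opH U) := by
      rwa [← treeSynth_colH, hU]
    change treeSynth T (M.colH (Δ G)) _ _ = _
    rw [← inner_hsUnit_left, ← hU, inner_colH, ← ContinuousLinearMap.adjoint_inner_left, hadj,
      hdeg hUdeg, inner_zero_left]
    rfl
  · exact isCausal_iff.mp (opH_causal _) s t hst

/-! ### Identification of H with 𝐇(S) -/

namespace IsColligation

variable {ι : H →ₗ[ℂ] M.H2} {j : Fin q} {A : H →L[ℂ] H} {B : M.C2 →L[ℂ] H} {C : H →L[ℂ] M.C2}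
  {D : M.C2 →L[ℂ] M.C2}

omit [CompleteSpace H] in
theorem adjoint_shiftH_pow_incl (hA : ∀ F, ι (A F) = ((M.shiftH j)†) (ι F)) (n : ℕ) (F : H) :
    ι ((A ^ n) F) = (((M.shiftH j)†) ^ n) (ι F) := by
  induction n with
  | zero => rfl
  | succ n ih => rw [pow_succ', mul_apply_eq_comp, hA, ih, pow_succ', mul_apply_eq_comp]

/-- Continuity of `ι` is not assumed and comes from the closed graph theorem: the data C Aⁿ F = κ*
ρ*ⁿ (ι F) determine ι F and pass to the limit in both spaces. -/
theorem continuous_incl (hA : ∀ F, ι (A F) = ((M.shiftH j)†) (ι F))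
    (hC : ∀ F, C F = (M.inclC†) (ι F)) : Continuous ι := by
  refine ι.continuous_of_seq_closed_graph fun u x y hu hy => ?_
  refine eq_of_forall_adjoint_shiftH_pow (j := j) fun n => ?_
  have h1 : Tendsto (fun i => C ((A ^ n) (u i))) atTop (𝓝 (C ((A ^ n) x))) :=
    ((C ∘L A ^ n).continuous.tendsto x).comp hu
  have h2 : Tendsto (fun i => (M.inclC†) ((((M.shiftH j)†) ^ n) (ι (u i)))) atTop
      (𝓝 ((M.inclC†) ((((M.shiftH j)†) ^ n) y))) :=
    (((M.inclC†) ∘L ((M.shiftH j)†) ^ n).continuous.tendsto y).comp hy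
  simp only [hC, adjoint_shiftH_pow_incl hA] at h1
  exact tendsto_nhds_unique h2 h1

omit [CompleteSpace H] in
-- Compare degrees: ι(B k) has the parts (C Aⁿ B k) αⁿ*, and shifting them by α* gives the parts of
-- positive degree of S k, while D k is the part of degree 0.
theorem mulLeft_incl (hA : ∀ F, ι (A F) = ((M.shiftH j)†) (ι F))
    (hC : ∀ F, C F = (M.inclC†) (ι F)) {S : TreeOp T} (hS : M.IsCausal S)
    (hSC : ∀ (n : ℕ) (d : M.C2),
      M.degPart n S * M.opC d = M.opC (markov A B C D n d) * (M.α j ^ n)†) (k : M.C2) :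
    H2.mulLeft S hS (M.inclC k) = M.shiftH j (ι (B k)) + M.inclC (D k) := by
  have hadj1 : ((1 : TreeOp T)†) = 1 := ContinuousLinearMap.adjoint_id
  refine H2.op_injective (degPart_causal_ext (opH_causal _) (opH_causal _) fun n => ?_)
  rw [H2.op_mulLeft, map_add]
  change M.degPart n (S * M.opC k) = M.degPart n (M.opH _ + M.opC (D k))
  rw [(isDeg_opC k).degPart_mul_right, sub_zero, hSC, degPart_add, opH_shiftH,
    (isDeg_α_adjoint j).degPart_mul_right]
  cases n with
  | zero =>
    rw [(opH_causal _).degPart_of_neg (by norm_num), pow_zero, hadj1, mul_one, zero_mul, zero_add,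
      Nat.cast_zero, (isDeg_opC _).degPart_self]
    rfl
  | succ n =>
    have h1 : M.opC (C ((A ^ n) (B k))) = M.degPart n (M.opH (ι (B k))) * M.α j ^ n := by
      rw [hC, adjoint_shiftH_pow_incl hA, opC_adjoint_inclC_shiftH_pow]
    change M.opC (C ((A ^ n) (B k))) * _ = _
    rw [h1, (isDeg_opC _).degPart_of_ne (by omega), add_zero, pow_succ', treeOp_adjoint_mul,
      Nat.cast_succ, add_sub_cancel_right, mul_assoc, ← mul_assoc (M.α j ^ n), α_pow_mul_adjoint,
      one_mul]

theorem isDeBrangesRovnyak (h : M.IsColligation ι j A B C D) (hι : Function.Injective ι)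
    (hA : ∀ F, ι (A F) = ((M.shiftH j)†) (ι F)) (hC : ∀ F, C F = (M.inclC†) (ι F))
    {S : TreeOp T} (hS : M.IsCausal S)
    (hSC : ∀ (n : ℕ) (d : M.C2),
      M.degPart n S * M.opC d = M.opC (markov A B C D n d) * (M.α j ^ n)†) :
    M.IsDeBrangesRovnyak ι S hS := by
  let J : H →L[ℂ] M.H2 := ⟨ι, continuous_incl hA hC⟩
  refine isDeBrangesRovnyak_of_comp_adjoint (ι := J) hι hS ?_
  set ρ := M.shiftH j with hρ
  set κ := M.inclC
  set L := H2.mulLeft S hS with hL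
  have hsplit : ρ * ρ† + κ ∘L (κ†) = 1 := shiftH_mul_adjoint_add j
  have hU : ∀ F F' : H, M.opH (ι F') = M.opH (ι F) * ((M.α j)† * M.α j) →
      (ρ ∘L J) F' = (ρ ∘L J) F := fun F F' hF => by
    refine H2.op_injective ?_
    change M.opH (M.shiftH j (ι F')) = M.opH (M.shiftH j (ι F))
    rw [opH_shiftH, opH_shiftH, hF, mul_assoc, mul_assoc, α_mul_adjoint, mul_one]
  have h1 := h.row_identity (U' := ρ ∘L J) (W := κ) (W' := κ) hU
  have e1 : (ρ ∘L J) ∘L A + κ ∘L C = J := by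
    ext1 F
    change ρ (ι (A F)) + κ (C F) = ι F
    rw [hA, hC]
    exact congrArg (fun R : M.H2 →L[ℂ] M.H2 => R (ι F)) hsplit
  have e2 : (ρ ∘L J) ∘L B + κ ∘L D = L ∘L κ := by
    ext1 k
    exact (mulLeft_incl hA hC hS hSC k).symm
  rw [e1, e2, ContinuousLinearMap.adjoint_comp, ContinuousLinearMap.adjoint_comp] at h1
  have hcomm : ρ * L = L * ρ := by
    ext1 G
    refine H2.op_injective ?_
    change M.opH (M.shiftH j (H2.mulLeft S hS G)) = H2.op (H2.mulLeft S hS (M.shiftH j G))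
    rw [opH_shiftH, H2.op_mulLeft]
    change H2.op (H2.mulLeft S hS G) * _ = S * M.opH (M.shiftH j G)
    rw [opH_shiftH, H2.op_mulLeft, mul_assoc]
  have hcomm' : (L†) * ρ† = ρ† * L† := by
    have := congrArg (fun R : M.H2 →L[ℂ] M.H2 => R†) hcomm
    simpa only [← ContinuousLinearMap.star_eq_adjoint, star_mul] using this
  -- For the row (ρ J, κ), the row identity says J J* + L κ κ* L* = ρ J J* ρ* + κ κ*. The
  -- computation below shows that 1 - L L* satisfies the same equation in place of J J*.
  have h2 : J ∘L (J†) + L * (κ ∘L (κ†)) * L† = ρ * (J ∘L (J†)) * ρ† + κ ∘L (κ†) := h1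
  set P := J ∘L (J†) with hP
  set Q := κ ∘L (κ†) with hQ
  have hPadj : (P†) = P := by
    rw [hP, ContinuousLinearMap.adjoint_comp, ContinuousLinearMap.adjoint_adjoint]
  have hdefect : M.defect S hS = 1 - L * L† := rfl
  rw [hdefect, ← sub_eq_zero]
  refine eq_zero_of_shiftH_conj (j := j) ?_ ?_
  · rw [map_sub, map_sub, hPadj, ← ContinuousLinearMap.star_eq_adjoint,
      ← ContinuousLinearMap.star_eq_adjoint, ← ContinuousLinearMap.star_eq_adjoint,
      star_mul, star_star, star_one]
  · have hQ' : ρ * ρ† = 1 - Q := eq_sub_of_add_eq hsplit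
    have h3 : ρ * (L * L†) * ρ† = L * L† - L * Q * L† := by
      calc ρ * (L * L†) * ρ† = (ρ * L) * ((L†) * ρ†) := by simp only [mul_assoc]
        _ = L * (ρ * ρ†) * L† := by rw [hcomm, hcomm']; simp only [mul_assoc]
        _ = L * L† - L * Q * L† := by rw [hQ', mul_sub, mul_one, sub_mul]
    have h4 : ρ * (P - (1 - L * L†)) * ρ† = ρ * P * ρ† - (1 - Q) + (L * L† - L * Q * L†) := by
      rw [← h3, ← hQ', mul_sub, mul_sub, mul_one, sub_mul, sub_mul]
      abel
    rw [← hρ, h4, ← sub_eq_zero]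
    rw [← sub_eq_zero] at h2
    rw [← h2]
    abel

end IsColligation

end MultiscaleTree

/-! ### Assembly of the three assertions -/

theorem theorem6p6 {q : ℕ} (hq : 1 ≤ q) {T : Type*} (M : MultiscaleTree q T)
    -- a right `𝒞`-invariant Hilbert space `H` included in `𝐇₂(T)`
    {H : Type*} [NormedAddCommGroup H] [InnerProductSpace ℂ H] [CompleteSpace H]
    (ι : H →ₗ[ℂ] M.H2) (hι : Function.Injective ι) (hH : M.IsRightInvariant ι)
    -- the bounded operator `V_j = (A_j B_j; C D)` on `H ⊕ 𝒞₂`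
    (j : Fin q) (A : H →L[ℂ] H) (B : M.C2 →L[ℂ] H) (C : H →L[ℂ] M.C2) (D : M.C2 →L[ℂ] M.C2)
    -- `A_j (F c) = (A_j F) α_j* c α_j`
    (hA : ∀ (F Fc : H) (c : TreeOp T), M.IsConst c → M.opH (ι Fc) = M.opH (ι F) * c →
      M.opH (ι (A Fc)) = M.opH (ι (A F)) * ((M.α j)† * c * M.α j))
    -- `B_j (d c) = (B_j d) α_j* c α_j`
    (hB : ∀ (d dc : M.C2) (c : TreeOp T), M.IsConst c → M.opC dc = M.opC d * c →
      M.opH (ι (B dc)) = M.opH (ι (B d)) * ((M.α j)† * c * M.α j))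
    -- `C (F c) = (C F) c`
    (hC : ∀ (F Fc : H) (c : TreeOp T), M.IsConst c → M.opH (ι Fc) = M.opH (ι F) * c →
      M.opC (C Fc) = M.opC (C F) * c)
    -- `D (d c) = (D d) c`
    (hD : ∀ (d dc : M.C2) (c : TreeOp T), M.IsConst c → M.opC dc = M.opC d * c →
      M.opC (D dc) = M.opC (D d) * c)
    -- `V_j V_j* (F, e) = (F α_j* α_j, e)`
    (hV : ∀ x : WithLp 2 (H × M.C2),
      M.opH (ι ((blockOp A B C D (((blockOp A B C D)†) x)).fst)) =
        M.opH (ι x.fst) * ((M.α j)† * M.α j) ∧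
      (blockOp A B C D (((blockOp A B C D)†) x)).snd = x.snd) :
    ∃ (σ : List (Fin q) → TreeOp T) (S : TreeOp T) (hS : M.IsSchur S)
      (E : (Fin q → TreeOp T) → (H →L[ℂ] M.C2)),
      -- (I) the coefficients are constants, uniquely determined by the formulae, and the series
      -- defines the Schur multiplier `S`
      (∀ τ : List (Fin q) → TreeOp T,
        ((∀ w, M.IsConst (τ w)) ∧
          (∀ d : M.C2, τ [] * M.opC d = M.opC (D d)) ∧
          (∀ (d : M.C2) (w : List (Fin q)), 1 ≤ w.length →
            τ w * M.opC d =
              M.word w * M.opC (C ((A ^ (w.length - 1)) (B d))) *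
                ((M.α j) ^ w.length)†)) ↔ τ = σ) ∧
      M.HasExpansion S σ ∧
      -- (II) the operators `E_c`
      (∀ c ∈ M.ball, ∀ F : H, ∃ u : ℕ → M.C2,
        (∀ n, M.opC (u n) =
          M.rowα c ^ n * M.opC (C ((A ^ n) F)) * ((M.α j) ^ n)†) ∧
        Summable (fun n => ‖u n‖) ∧ HasSum u (E c F)) ∧
      (∀ c ∈ M.ball, ∀ d ∈ M.ball, ∀ k : M.C2,
        M.eval (M.schurKernel S d) c * M.opC k =
          M.opC (E c (((E d)†) k))) ∧
      -- (III) if `A_j F = (F - F^∧(0)) α_j` and `C F = F^∧(0)`, then `H = 𝐇(S)`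
      ((∀ F : H, M.opH (ι (A F)) =
          (M.opH (ι F) - M.eval (M.opH (ι F)) 0) * M.α j) →
        (∀ F : H, M.opC (C F) = M.eval (M.opH (ι F)) 0) →
        M.IsDeBrangesRovnyak ι S hS.1) := by
  have h : M.IsColligation ι j A B C D := ⟨hH, hA, hB, hC, hD, hV⟩
  obtain ⟨S, hS, hSC⟩ := h.exists_transfer
  have hadj1 : ((1 : TreeOp T)†) = 1 := ContinuousLinearMap.adjoint_id
  refine ⟨fun w => M.word w * M.degPart w.length S, S, hS,
    fun c => M.stateEval j A C (M.rowα c), ?_, hS.1.hasExpansion, ?_, ?_, ?_⟩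
  · have hσ0 : ∀ d : M.C2, M.word [] * M.degPart ([] : List (Fin q)).length S * M.opC d =
        M.opC (D d) := fun d => by
      have h1 : M.word ([] : List (Fin q)) = 1 := rfl
      rw [h1, one_mul, hSC, List.length_nil, pow_zero, hadj1, mul_one]
      rfl
    have hσ : ∀ (d : M.C2) (w : List (Fin q)), 1 ≤ w.length →
        M.word w * M.degPart w.length S * M.opC d =
          M.word w * M.opC (C ((A ^ (w.length - 1)) (B d))) * ((M.α j) ^ w.length)† := by
      intro d w hw
      rw [mul_assoc, hSC, ← mul_assoc]
      congr 3
      obtain ⟨n, hn⟩ := Nat.exists_eq_add_of_le' hw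
      rw [hn]
      rfl
    intro τ
    constructor
    · rintro ⟨-, hτ0, hτ⟩
      funext w
      -- The products with all elements of 𝒞₂ determine a coefficient, since the diagonal matrix
      -- units recover its columns.
      refine MultiscaleTree.eq_of_forall_mul_opC (M := M) fun d => ?_
      rcases Nat.eq_zero_or_pos w.length with hw | hw
      · rw [List.length_eq_zero_iff.mp hw, hτ0, hσ0]
      · rw [hτ d w hw, hσ d w hw]
    · rintro rfl
      exact ⟨fun w => MultiscaleTree.isConst_word_mul (MultiscaleTree.isDeg_degPart _ S), hσ0, hσ⟩
  · intro c hc F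
    have hX := MultiscaleTree.isEvalPoint_rowα hc
    refine ⟨fun n => M.mulC (M.rowα c ^ n) ((M.α j ^ n)†) (C ((A ^ n) F)),
      fun n => MultiscaleTree.opC_mulC_pow hX.deg j n _, ?_, h.hasSum_stateEval hX F⟩
    exact Summable.of_nonneg_of_le (fun _ => norm_nonneg _)
      (fun n => (M.mulC (M.rowα c ^ n) ((M.α j ^ n)†) ∘L C ∘L A ^ n).le_opNorm F)
      ((h.summable_norm_stateEval hX).mul_right ‖F‖)
  · intro c hc d hd k
    have hX := MultiscaleTree.isEvalPoint_rowα hc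
    have hY := MultiscaleTree.isEvalPoint_rowα hd
    have h1 := congrArg (fun R : M.C2 →L[ℂ] M.C2 => M.opC (R k))
      (h.evalAt_kernel_transfer hX hY hS.1 hSC)
    simp only [MultiscaleTree.opC_mulC_const (hX.isDeg_evalAt _)] at h1
    rw [MultiscaleTree.eval_eq_evalAt, MultiscaleTree.schurKernel, MultiscaleTree.kernel,
      MultiscaleTree.eval_eq_evalAt]
    exact h1
  · intro hA' hC'
    refine h.isDeBrangesRovnyak hι (fun F => MultiscaleTree.H2.op_injective ?_)
      (fun F => MultiscaleTree.opC_injective ?_) hS.1 hSC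
    · refine (hA' F).trans ?_
      rw [MultiscaleTree.eval_zero]
      exact (MultiscaleTree.opH_adjoint_shiftH j (ι F)).symm
    · rw [MultiscaleTree.opC_adjoint_inclC, ← MultiscaleTree.eval_zero]
      exact hC' F
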